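/- **Setting.** Let $T^*=(\mathbb R^2/\mathbb Z^2)\setminus\{0\}$, with $\pi_1(T^*)$ free on $a$ (direction $(1,0)$) and $b$ (direction $(0,1)$). Let $\mathcal X=\mathrm{Hom}(\pi_1T^*,\mathrm{SL}(2,\mathbb R))/\mathrm{SL}(2,\mathbb R)$ be the character variety with its quotient topology, and $\mathcal X_c\subset\mathcal X$ the set of classes with $\operatorname{tr}\rho([a,b])=c$. The class $[\rho]$ has the trace coordinates $(\operatorname{tr}\rho(a),\operatorname{tr}\rho(b),\operatorname{tr}\rho(ab))\in\mathbb R^3$, and for a norm on $\mathbb R^3$ we write $\|\rho\|$ for the norm of this vector. A representation $\rho$ is *generic* if its image contains no parabolic element and no elliptic element of finite order. A measured lamination $\lambda$ is a linear foliation of $\mathbb R^2/\mathbb Z^2$, given by its direction $(u,v)\in S^1$. For $p$ in the torus and $t>0$, let $\Phi_t(p)\in \mathrm{SL}(2,\mathbb R)$ be the parallel transport of the flat $\mathbb R^2$-bundle of $\rho$ along the unit speed line of direction $(u,v)$ from $p$ for time $t$, in the trivialisation over the unit square: the product of a factor $\rho(a)^{\operatorname{sgn}u}$ for each vertical side crossed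 and $\rho(b)^{\operatorname{sgn}v}$ for each horizontal side crossed, later factors on the left. The Lyapunov exponent is $\chi(\rho,\lambda)=\lim_{t\to\infty}\frac1t\int\log\|\Phi_t(p)\|\,dp$, and $\mathrm{Sp}(\rho)$ is the set of $\lambda$ with $\chi(\rho,\lambda)=0$. The trajectory $(\varphi_n)$ of $\lambda$ in the mapping class group is given by Rauzy induction. Put $\varepsilon=1$ if $u\ge0$ and $\varepsilon=-1$ otherwise, $\delta=1$ if $v\ge0$ and $\delta=-1$ otherwise, $\varphi_0=1$ and $(\ell_a,\ell_b)=(|u|,|v|)$. At each step, if $\ell_b\le\ell_a$, replace $\ell_a$ by $\ell_a-\ell_b$ and compose $\varphi_n$ with the Dehn twist along $a$; otherwise replace $\ell_b$ by $\ell_b-\ell_a$ and compose with the Dehn twist along $b$. With $A_n=(\varphi_n\rho)(a)^{\varepsilon}$ and $B_n=(\varphi_n\rho)(b)^{\delta}$, the twists act by $(A_{n+1},B_{n+1})=(A_n,B_nA_n)$ and $(A_{n+1},B_{n+1})=(B_nA_n,B_n)$ respectively. The support of $\lambda$ is a simple curve if and only if $\alpha=|v|/(|u|+|v|)$ is rational.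 If it is irrational, write $\alpha=1/(a_1+1/(a_2+\cdots))$, with $q_0=1$, $q_1=a_1$, $q_n=a_nq_{n-1}+q_{n-2}$, and $k_n=a_1+\dots+a_n$ (the acceleration times). **Theorem.** Let $c\neq 2$. There is a compact set $K\subset\mathcal X$, depending only on $c$, such that for every generic representation $\rho$ with $[\rho]\in\mathcal X_c$ and every measured lamination $\lambda$ with trajectory $(\varphi_n)$: 1. If $\lambda\notin\mathrm{Sp}(\rho)$, then $[\varphi_n\rho]$ goes to infinity in $\mathcal X$ (it eventually leaves every compact set). If moreover the support of $\lambda$ is not a simple curve, then for any norm on $\mathbb R^3$ there are a constant $C>0$ such that $\|\varphi_n\rho\|\ge e^{Cn}$ for all large $n$, and a constant $C>0$ such that $\|\varphi_{k_n}\rho\|\ge e^{Cq_n}$ for all large $n$. 2. If $\lambda\in\mathrm{Sp}(\rho)$, then $[\varphi_n\rho]$ does not go to infinity. If moreover the support of $\lambda$ is not a simple curve, then $[\varphi_{k_n}\rho]\in K$ for all large $n$; and if in addition the $a_n$ are bounded, then all $[\varphi_n\rho]$ stay in a compact set. -/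

import Mathlib

open Filter Topology MeasureTheory Set
open scoped MatrixGroups ENNReal Classical

noncomputable section

namespace PuncturedTorus

/-! ### Representations and the character variety -/

/-- The fundamental group of the once-punctured torus, free on `a = of 0` and `b = of 1`. With
`T* = (ℝ² / ℤ²) ∖ {0}`, the loop `a` goes once around in the direction `(1, 0)`, and `b` in the
direction `(0, 1)`. -/
abbrev Pi1 : Type := FreeGroup (Fin 2)

def genA : Pi1 := FreeGroup.of 0

def genB : Pi1 := FreeGroup.of 1

/-- Representations of the fundamental group into `SL(2, ℝ)`. -/
def Rep : Type := Pi1 →* SL(2, ℝ)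

/-- The topology of pointwise convergence on `Hom(π₁ T*, SL(2, ℝ))`. -/
instance : TopologicalSpace Rep :=
  TopologicalSpace.induced (fun (ρ : Pi1 →* SL(2, ℝ)) (g : Pi1) => ρ g) inferInstance

/-- Evaluation of a representation at an element of the fundamental group. -/
def Rep.eval (ρ : Rep) (g : Pi1) : SL(2, ℝ) := (show Pi1 →* SL(2, ℝ) from ρ) g

/-- The trace of `ρ(g)`. -/
def Rep.trace (ρ : Rep) (g : Pi1) : ℝ := Matrix.trace (ρ.eval g : Matrix (Fin 2) (Fin 2) ℝ)

/-- Conjugacy of representations under `SL(2, ℝ)`. -/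
instance conjSetoid : Setoid Rep where
  r ρ σ := ∃ P : SL(2, ℝ), ∀ g : Pi1, σ.eval g = P * ρ.eval g * P⁻¹
  iseqv :=
    { refl := fun _ => ⟨1, fun g => by simp⟩
      symm := fun {_ _} ⟨P, h⟩ => ⟨P⁻¹, fun g => by rw [h g]; group⟩
      trans := fun {_ _ _} ⟨P, h⟩ ⟨Q, k⟩ => ⟨Q * P, fun g => by rw [k g, h g]; group⟩ }

/-- The character variety `Hom(π₁ T*, SL(2, ℝ)) / SL(2, ℝ)`, with the quotient topology. -/
def CharVar : Type := Quotient conjSetoid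

instance : TopologicalSpace CharVar := inferInstanceAs (TopologicalSpace (Quotient conjSetoid))

/-- The class of a representation in the character variety. -/
def Rep.cls (ρ : Rep) : CharVar := Quotient.mk conjSetoid ρ

/-- The relative character variety: classes of `ρ` with `tr ρ([a, b]) = c`. -/
def relCharVar (c : ℝ) : Set CharVar := {x | ∃ ρ : Rep, ρ.cls = x ∧ ρ.trace (genA * genB * genA⁻¹ * genB⁻¹) = c}

/-- The trace coordinates `(tr ρ(a), tr ρ(b), tr ρ(ab))`, which map the relative character variety
to the Markov surface `x² + y² + z² - xyz = c + 2` in `ℝ³`. -/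
def Rep.traceCoords (ρ : Rep) : Fin 3 → ℝ :=
  ![ρ.trace genA, ρ.trace genB, ρ.trace (genA * genB)]

/-- A parabolic matrix: trace `±2`, but not `±1`. -/
def IsParabolic (M : SL(2, ℝ)) : Prop :=
  |Matrix.trace (M : Matrix (Fin 2) (Fin 2) ℝ)| = 2 ∧ M ≠ 1 ∧ M ≠ -1

/-- An elliptic matrix of finite order (its angle is a rational multiple of `2π`). -/
def IsFiniteOrderRotation (M : SL(2, ℝ)) : Prop :=
  |Matrix.trace (M : Matrix (Fin 2) (Fin 2) ℝ)| < 2 ∧ IsOfFinOrder M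

/-- A generic representation: its image contains neither a parabolic element nor a rotation of
finite order. -/
def Rep.IsGeneric (ρ : Rep) : Prop :=
  ∀ g : Pi1, ¬ IsParabolic (ρ.eval g) ∧ ¬ IsFiniteOrderRotation (ρ.eval g)

/-! ### The spectrum

A measured lamination is a linear foliation of `ℝ² / ℤ²`, given by its direction, a point
`θ = (θ.re, θ.im)` of the unit circle. The flat bundle of `ρ` is trivialised over the unit square;
parallel transport across a vertical side is `ρ(a)^{±1}`, across a horizontal side `ρ(b)^{±1}`. -/

/-- `g` if `0 ≤ r`, and `g⁻¹` if `r < 0`. -/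
def signed (r : ℝ) (g : Pi1) : Pi1 := if 0 ≤ r then g else g⁻¹

/-- The times in `(0, t]` at which the unit speed line from `p` in direction `θ` crosses a
vertical side of the square tiling of the plane. -/
def vertCrossings (θ : Circle) (p : ℝ × ℝ) (t : ℝ) : Set ℝ :=
  {s | s ∈ Ioc 0 t ∧ (θ : ℂ).re ≠ 0 ∧ ∃ k : ℤ, p.1 + s * (θ : ℂ).re = k}

/-- The times in `(0, t]` at which this line crosses a horizontal side. -/
def horizCrossings (θ : Circle) (p : ℝ × ℝ) (t : ℝ) : Set ℝ :=
  {s | s ∈ Ioc 0 t ∧ (θ : ℂ).im ≠ 0 ∧ ∃ k : ℤ, p.2 + s * (θ : ℂ).im = k}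

theorem finite_crossings_aux (x r t : ℝ) :
    {s : ℝ | s ∈ Ioc 0 t ∧ r ≠ 0 ∧ ∃ k : ℤ, x + s * r = k}.Finite := by
  refine ((Set.finite_Icc (-⌈|x| + |t| * |r|⌉) ⌈|x| + |t| * |r|⌉).image
    (fun k : ℤ => ((k : ℝ) - x) / r)).subset ?_
  rintro s ⟨⟨h0, ht⟩, hr, k, hk⟩
  refine ⟨k, ?_, by simp only; field_simp; linarith⟩
  have h1 : |(k : ℝ)| ≤ |x| + |t| * |r| := by
    rw [← hk]
    refine (abs_add_le _ _).trans ?_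
    rw [abs_mul]
    have : |s| ≤ |t| := abs_le_abs_of_nonneg h0.le ht
    gcongr
  have h2 := h1.trans (Int.le_ceil _)
  have h3 : |k| ≤ ⌈|x| + |t| * |r|⌉ := by exact_mod_cast h2
  exact abs_le.mp h3

theorem finite_crossings (θ : Circle) (p : ℝ × ℝ) (t : ℝ) :
    (vertCrossings θ p t ∪ horizCrossings θ p t).Finite :=
  (finite_crossings_aux _ _ _).union (finite_crossings_aux _ _ _)

/-- The product of the generators met along the segment of length `t` from `p` in direction `θ`,
each new crossing being multiplied on the left. (Lines through the puncture form a null set.) -/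
def crossingWord (θ : Circle) (p : ℝ × ℝ) (t : ℝ) : Pi1 :=
  (((finite_crossings θ p t).toFinset.sort (· ≥ ·)).map fun s =>
    if s ∈ vertCrossings θ p t then signed (θ : ℂ).re genA else signed (θ : ℂ).im genB).prod

/-- The operator norm for the Euclidean norm on `ℝ²`. -/
def opNorm (M : SL(2, ℝ)) : ℝ :=
  ‖Matrix.toEuclideanCLM (n := Fin 2) (𝕜 := ℝ) (M : Matrix (Fin 2) (Fin 2) ℝ)‖

/-- `χ` is the Lyapunov exponent of `ρ` in direction `θ`: the limit of
`(1 / t) ∫ log ‖transport of p for time t‖ dp` over the torus, as `t → ∞`. The integrand is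
nonnegative, as the operator norm of a matrix of determinant `1` is at least `1`. -/
def HasLyapunovExponent (ρ : Rep) (θ : Circle) (χ : ℝ≥0∞) : Prop :=
  Tendsto
    (fun t : ℝ =>
      (∫⁻ p in Ico (0 : ℝ) 1 ×ˢ Ico (0 : ℝ) 1,
        ENNReal.ofReal (Real.log (opNorm (ρ.eval (crossingWord θ p t))))) / ENNReal.ofReal t)
    atTop (𝓝 χ)

/-- The spectrum of `ρ`: the laminations with zero Lyapunov exponent. -/
def spectrum (ρ : Rep) : Set Circle := {θ | HasLyapunovExponent ρ θ 0}

/-! ### The mapping class group and the trajectory of a lamination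

Mapping classes are represented by automorphisms of the free group; `f` acts on representations by
`f ρ = ρ ∘ f⁻¹`, and on the character variety this only depends on the outer class of `f`. -/

def act (f : MulAut Pi1) (ρ : Rep) : Rep :=
  (show Pi1 →* SL(2, ℝ) from ρ).comp (f⁻¹ : MulAut Pi1).toMonoidHom

/-- The Dehn twist along `a`, acting on `(A, B) = (ρ(a), ρ(b))` by `(A, B) ↦ (A, B A)`. -/
def dehnTwistA : MulAut Pi1 :=
  MonoidHom.toMulEquiv
    (FreeGroup.lift ![genA, genB * genA⁻¹]) (FreeGroup.lift ![genA, genB * genA])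
    (by ext i; fin_cases i <;> simp [genA, genB])
    (by ext i; fin_cases i <;> simp [genA, genB])

/-- The Dehn twist along `b`, acting on `(A, B) = (ρ(a), ρ(b))` by `(A, B) ↦ (B A, B)`. -/
def dehnTwistB : MulAut Pi1 :=
  MonoidHom.toMulEquiv
    (FreeGroup.lift ![genB⁻¹ * genA, genB]) (FreeGroup.lift ![genB * genA, genB])
    (by ext i; fin_cases i <;> simp [genA, genB])
    (by ext i; fin_cases i <;> simp [genA, genB])

/-- The change of generators `(a, b) ↦ (a^{±1}, b^{±1})`, with the signs of the coordinates of
`θ`: the first return map of the foliation has the cocycle `(ρ(a)^{±1}, ρ(b)^{±1})`. -/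
def signChange (θ : Circle) : MulAut Pi1 :=
  MonoidHom.toMulEquiv
    (FreeGroup.lift ![signed (θ : ℂ).re genA, signed (θ : ℂ).im genB])
    (FreeGroup.lift ![signed (θ : ℂ).re genA, signed (θ : ℂ).im genB])
    (by ext i; fin_cases i <;> simp [genA, genB, signed] <;> split_ifs <;> simp)
    (by ext i; fin_cases i <;> simp [genA, genB, signed] <;> split_ifs <;> simp)

/-- One step of Rauzy induction, on the lengths `(|I_a|, |I_b|)` of the intervals of a
2-interval exchange. -/
def rauzyStep (l : ℝ × ℝ) : ℝ × ℝ :=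
  if l.2 ≤ l.1 then (l.1 - l.2, l.2) else (l.1, l.2 - l.1)

/-- The (unnormalised) lengths after `n` steps. The first return map of the foliation of direction
`θ` to the closed curve `{x ± y = 0}` transverse to it is the 2-interval exchange with lengths
proportional to `(|θ.re|, |θ.im|)`. -/
def rauzyLengths (θ : Circle) (n : ℕ) : ℝ × ℝ := rauzyStep^[n] (|(θ : ℂ).re|, |(θ : ℂ).im|)

/-- The trajectory `(φ_n)` in the mapping class group: a twist along `a` when `I_a` is the longer
interval, and along `b` when `I_b` is. For a rational direction one equality of lengths occurs,
then one length is `0` and the same twist is repeated forever. -/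
def trajectory (θ : Circle) : ℕ → MulAut Pi1
  | 0 => 1
  | n + 1 =>
    signChange θ * (if (rauzyLengths θ n).2 ≤ (rauzyLengths θ n).1 then dehnTwistA else dehnTwistB)
      * (signChange θ)⁻¹ * trajectory θ n

/-! ### Continued fractions -/

/-- The angle `α` of the rotation which is the first return map: `α = |I_b| / (|I_a| + |I_b|)`.
It is rational if and only if the leaves are closed curves. -/
def rotationAngle (θ : Circle) : ℝ := |(θ : ℂ).im| / (|(θ : ℂ).re| + |(θ : ℂ).im|)

/-- `cfDigit α n` is the coefficient `a_{n+1}` of `α = 1 / (a₁ + 1 / (a₂ + ⋯))`. -/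
def cfDigit (α : ℝ) (n : ℕ) : ℕ := ⌊((fun x : ℝ => Int.fract x⁻¹)^[n] α)⁻¹⌋₊

/-- The denominators: `q₀ = 1`, `q₁ = a₁`, `q_n = a_n q_{n-1} + q_{n-2}`. -/
def cfDenom (α : ℝ) : ℕ → ℕ
  | 0 => 1
  | 1 => cfDigit α 0
  | n + 2 => cfDigit α (n + 1) * cfDenom α (n + 1) + cfDenom α n

/-- The acceleration times `k_n = a₁ + ⋯ + a_n`. -/
def accelTime (α : ℝ) (n : ℕ) : ℕ := ∑ i ∈ Finset.range n, cfDigit α i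

end PuncturedTorus

end

namespace PuncturedTorus

/-! ### Traces in `SL(2, ℝ)` -/

/-- The trace of an element of `SL(2, ℝ)`. -/
noncomputable def tr (M : SL(2, ℝ)) : ℝ := Matrix.trace (M : Matrix (Fin 2) (Fin 2) ℝ)

theorem tr_eq (M : SL(2, ℝ)) : tr M = M 0 0 + M 1 1 := Matrix.trace_fin_two _

theorem det_eq (M : SL(2, ℝ)) : M 0 0 * M 1 1 - M 0 1 * M 1 0 = 1 := by
  have := M.det_coe
  rwa [Matrix.det_fin_two] at this

theorem mul_entry (M N : SL(2, ℝ)) (i j : Fin 2) :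
    (M * N) i j = M i 0 * N 0 j + M i 1 * N 1 j := by
  rw [Matrix.SpecialLinearGroup.coe_mul, Matrix.mul_apply, Fin.sum_univ_two]

theorem inv_entries (M : SL(2, ℝ)) :
    M⁻¹ 0 0 = M 1 1 ∧ M⁻¹ 0 1 = -M 0 1 ∧ M⁻¹ 1 0 = -M 1 0 ∧ M⁻¹ 1 1 = M 0 0 := by
  rw [Matrix.SpecialLinearGroup.SL2_inv_expl]
  exact ⟨rfl, rfl, rfl, rfl⟩

theorem tr_mul_eq (M N : SL(2, ℝ)) :
    tr (M * N) = M 0 0 * N 0 0 + M 0 1 * N 1 0 + M 1 0 * N 0 1 + M 1 1 * N 1 1 := by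
  rw [tr_eq, mul_entry, mul_entry]; ring

theorem tr_inv (M : SL(2, ℝ)) : tr M⁻¹ = tr M := by
  obtain ⟨h0, -, -, h1⟩ := inv_entries M
  rw [tr_eq, tr_eq, h0, h1, add_comm]

theorem tr_one : tr 1 = 2 := by
  simp [tr]

theorem tr_neg (M : SL(2, ℝ)) : tr (-M) = -tr M := by
  simp [tr]

theorem tr_mul_comm (M N : SL(2, ℝ)) : tr (M * N) = tr (N * M) := by
  rw [tr_mul_eq, tr_mul_eq]; ring

theorem tr_conj (P M : SL(2, ℝ)) : tr (P * M * P⁻¹) = tr M := by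
  rw [tr_mul_comm]; simp

theorem tr_mul_inv (A B : SL(2, ℝ)) : tr (B * A⁻¹) = tr A * tr B - tr (B * A) := by
  obtain ⟨h0, h1, h2, h3⟩ := inv_entries A
  rw [tr_mul_eq, tr_mul_eq, tr_eq, tr_eq, h0, h1, h2, h3]; ring

theorem coe_mul_sq (A B : SL(2, ℝ)) :
    ((B * A * A : SL(2, ℝ)) : Matrix (Fin 2) (Fin 2) ℝ) =
      tr A • ((B * A : SL(2, ℝ)) : Matrix (Fin 2) (Fin 2) ℝ) - (B : Matrix (Fin 2) (Fin 2) ℝ) := by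
  have hd := det_eq A
  ext i j
  change (B * A * A) i j = tr A * (B * A) i j - B i j
  rw [mul_entry, mul_entry, mul_entry, tr_eq]
  fin_cases j
  · simp only [Fin.zero_eta, mul_entry]; linear_combination (-B i 0) * hd
  · simp only [Fin.mk_one, mul_entry]; linear_combination (-B i 1) * hd

theorem coe_sq_mul (A B : SL(2, ℝ)) :
    ((B * (B * A) : SL(2, ℝ)) : Matrix (Fin 2) (Fin 2) ℝ) =
      tr B • ((B * A : SL(2, ℝ)) : Matrix (Fin 2) (Fin 2) ℝ) - (A : Matrix (Fin 2) (Fin 2) ℝ) := by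
  have hd := det_eq B
  ext i j
  change (B * (B * A)) i j = tr B * (B * A) i j - A i j
  rw [mul_entry, mul_entry, mul_entry, tr_eq]
  fin_cases i
  · simp only [Fin.zero_eta, mul_entry]; linear_combination (-A 0 j) * hd
  · simp only [Fin.mk_one, mul_entry]; linear_combination (-A 1 j) * hd

theorem tr_mul_sq (A B : SL(2, ℝ)) : tr (B * A * A) = tr A * tr (B * A) - tr B := by
  have := congrArg Matrix.trace (coe_mul_sq A B)
  simpa [Matrix.trace_sub, Matrix.trace_smul, tr] using this

theorem tr_sq_mul (A B : SL(2, ℝ)) : tr (B * (B * A)) = tr B * tr (B * A) - tr A := by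
  have := congrArg Matrix.trace (coe_sq_mul A B)
  simpa [Matrix.trace_sub, Matrix.trace_smul, tr] using this

/-- Fricke's identity for the trace of a commutator. -/
theorem tr_commutator (A B : SL(2, ℝ)) :
    tr (A * B * A⁻¹ * B⁻¹) =
      tr A ^ 2 + tr B ^ 2 + tr (B * A) ^ 2 - tr A * tr B * tr (B * A) - 2 := by
  have hA := det_eq A
  have hB := det_eq B
  obtain ⟨a0, a1, a2, a3⟩ := inv_entries A
  obtain ⟨b0, b1, b2, b3⟩ := inv_entries B
  simp only [tr_eq, mul_entry, a0, a1, a2, a3, b0, b1, b2, b3]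
  generalize A 0 0 = a at *
  generalize A 0 1 = b at *
  generalize A 1 0 = c at *
  generalize A 1 1 = d at *
  generalize B 0 0 = p at *
  generalize B 0 1 = q at *
  generalize B 1 0 = r at *
  generalize B 1 1 = s at *
  linear_combination
    ((p + s) ^ 2 - 2 * (p * s - q * r)) * hA + ((a + d) ^ 2 - 2) * hB

/-- If `tr A` is elliptic or parabolic, the commutator has trace at least two. -/
theorem two_lt_abs_tr_of_tr_commutator_lt (A B : SL(2, ℝ)) (h : tr (A * B * A⁻¹ * B⁻¹) < 2) :
    2 < |tr A| := by
  by_contra! hA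
  obtain ⟨a0, a1, a2, a3⟩ := inv_entries A
  obtain ⟨b0, b1, b2, b3⟩ := inv_entries B
  have dA := det_eq A
  have dB := det_eq B
  have hA2 : (A 0 0 + A 1 1) ^ 2 ≤ 4 := by
    rw [tr_eq] at hA
    have := sq_le_sq' (abs_le.mp hA).1 (abs_le.mp hA).2
    linarith
  simp only [tr_eq, mul_entry, a0, a1, a2, a3, b0, b1, b2, b3] at h
  generalize A 0 0 = a at *
  generalize A 0 1 = b at *
  generalize A 1 0 = c at *
  generalize A 1 1 = d at *
  generalize B 0 0 = p at *
  generalize B 0 1 = q at *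
  generalize B 1 0 = r at *
  generalize B 1 1 = s at *
  have hN : (b * r - q * c) ^ 2 + (a * q + b * s - p * b - q * d) *
      (c * p + d * r - r * a - s * c) < 0 := by
    linear_combination h - 2 * (p * s - q * r) * dA - 2 * dB
  rcases eq_or_ne c 0 with rfl | hc
  · have : a = d := by nlinarith [sq_nonneg (a - d)]
    subst this
    nlinarith [sq_nonneg (b * r)]
  · have key : c ^ 2 * ((b * r - q * c) ^ 2 + (a * q + b * s - p * b - q * d) *
        (c * p + d * r - r * a - s * c)) =
        (c * (b * r - q * c) - (a - d) * (c * p + d * r - r * a - s * c) / 2) ^ 2 +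
          (c * p + d * r - r * a - s * c) ^ 2 * ((4 - (a + d) ^ 2) / 4) := by
      linear_combination (c * p + d * r - r * a - s * c) ^ 2 * dA
    have h1 := mul_neg_of_pos_of_neg (pow_pos (abs_pos.mpr hc) 2) hN
    rw [sq_abs, key] at h1
    have h2 := mul_nonneg (sq_nonneg (c * p + d * r - r * a - s * c))
      (show 0 ≤ (4 - (a + d) ^ 2) / 4 by linarith)
    linarith [sq_nonneg (c * (b * r - q * c) - (a - d) * (c * p + d * r - r * a - s * c) / 2)]

/-- An element of `SL(2, ℝ)` with trace zero has order four. -/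
theorem isOfFinOrder_of_tr_eq_zero (A : SL(2, ℝ)) (h : tr A = 0) : IsOfFinOrder A := by
  have h2 : A * A = -1 := by
    apply Subtype.ext
    have := coe_mul_sq A 1
    rw [h] at this
    simpa using this
  rw [isOfFinOrder_iff_pow_eq_one]
  refine ⟨4, by norm_num, ?_⟩
  have : A ^ 4 = (A * A) * (A * A) := by simp only [pow_succ, pow_zero, one_mul, mul_assoc]
  rw [this, h2]; simp

/-! ### The operator norm -/

theorem opNorm_mul_le (M N : SL(2, ℝ)) : opNorm (M * N) ≤ opNorm M * opNorm N := by
  unfold opNorm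
  rw [Matrix.SpecialLinearGroup.coe_mul, map_mul]
  exact norm_mul_le _ _

theorem opNorm_one : opNorm 1 = 1 := by
  unfold opNorm
  rw [Matrix.SpecialLinearGroup.coe_one, map_one]
  exact norm_one

theorem col_sq_le_opNorm_sq (M : SL(2, ℝ)) (j : Fin 2) :
    M 0 j ^ 2 + M 1 j ^ 2 ≤ opNorm M ^ 2 := by
  have h := (Matrix.toEuclideanCLM (n := Fin 2) (𝕜 := ℝ)
    (M : Matrix (Fin 2) (Fin 2) ℝ)).le_opNorm (EuclideanSpace.single j 1)
  rw [PiLp.norm_single, norm_one, mul_one] at h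
  have h2 := pow_le_pow_left₀ (norm_nonneg _) h 2
  rw [EuclideanSpace.norm_sq_eq, Fin.sum_univ_two] at h2
  unfold opNorm
  simpa [EuclideanSpace.single, Matrix.mulVec_single] using h2

theorem opNorm_nonneg (M : SL(2, ℝ)) : 0 ≤ opNorm M := norm_nonneg _

theorem abs_entry_le_opNorm (M : SL(2, ℝ)) (i j : Fin 2) : |M i j| ≤ opNorm M := by
  refine abs_le_of_sq_le_sq ?_ (opNorm_nonneg M)
  have h := col_sq_le_opNorm_sq M j
  fin_cases i
  · simp only [Fin.zero_eta]; nlinarith [sq_nonneg (M 1 j)]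
  · simp only [Fin.mk_one]; nlinarith [sq_nonneg (M 0 j)]

theorem abs_tr_le_two_mul_opNorm (M : SL(2, ℝ)) : |tr M| ≤ 2 * opNorm M := by
  rw [tr_eq]
  have := abs_add_le (M 0 0) (M 1 1)
  have h0 := abs_entry_le_opNorm M 0 0
  have h1 := abs_entry_le_opNorm M 1 1
  linarith

theorem one_le_opNorm (M : SL(2, ℝ)) : 1 ≤ opNorm M := by
  have hd := det_eq M
  have h0 := col_sq_le_opNorm_sq M 0
  have h1 := col_sq_le_opNorm_sq M 1
  nlinarith [opNorm_nonneg M, sq_nonneg (M 0 0 - M 1 1), sq_nonneg (M 0 1 + M 1 0)]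

theorem opNorm_le_of_coe_eq (M N N' : SL(2, ℝ)) (s : ℝ)
    (h : (M : Matrix (Fin 2) (Fin 2) ℝ) = s • (N : Matrix (Fin 2) (Fin 2) ℝ) - N') :
    opNorm M ≤ |s| * opNorm N + opNorm N' := by
  unfold opNorm
  rw [h, map_sub, map_smul]
  refine (norm_sub_le _ _).trans ?_
  rw [norm_smul, Real.norm_eq_abs]

/-- The logarithm of the operator norm. -/
noncomputable def logNorm (M : SL(2, ℝ)) : ℝ := Real.log (opNorm M)

theorem logNorm_nonneg (M : SL(2, ℝ)) : 0 ≤ logNorm M := Real.log_nonneg (one_le_opNorm M)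

theorem logNorm_one : logNorm 1 = 0 := by rw [logNorm, opNorm_one, Real.log_one]

theorem opNorm_pos (M : SL(2, ℝ)) : 0 < opNorm M := zero_lt_one.trans_le (one_le_opNorm M)

theorem logNorm_mul_le (M N : SL(2, ℝ)) : logNorm (M * N) ≤ logNorm M + logNorm N := by
  unfold logNorm
  rw [← Real.log_mul (opNorm_pos M).ne' (opNorm_pos N).ne']
  exact Real.log_le_log (opNorm_pos _) (opNorm_mul_le M N)

/-! ### Parallel transport along a line -/

/-- A predicate holding at `0` that propagates to the right, and to the left limit points of its
validity, holds at all nonnegative times. -/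
theorem real_induction {R : ℝ → Prop} (h0 : R 0)
    (hr : ∀ s, 0 ≤ s → R s → ∀ᶠ t in 𝓝[>] s, R t)
    (hl : ∀ s, 0 < s → (∀ t, 0 ≤ t → t < s → R t) → R s) : ∀ t, 0 ≤ t → R t := by
  by_contra! hcon
  obtain ⟨t₀, ht₀, hRt₀⟩ := hcon
  set S := {t : ℝ | 0 ≤ t ∧ ¬ R t} with hS
  have hbdd : BddBelow S := ⟨0, fun t ht => ht.1⟩
  have hne : S.Nonempty := ⟨t₀, ht₀, hRt₀⟩
  have hs0 : 0 ≤ sInf S := le_csInf hne fun t ht => ht.1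
  have hlt : ∀ t, 0 ≤ t → t < sInf S → R t := fun t ht hts => by
    by_contra h
    exact absurd (csInf_le hbdd ⟨ht, h⟩) (not_le.mpr hts)
  have hRs : R (sInf S) := by
    rcases hs0.eq_or_lt with h | h
    · rwa [← h]
    · exact hl _ h hlt
  obtain ⟨u, hu, hIoo⟩ := mem_nhdsGT_iff_exists_Ioo_subset.mp (hr _ hs0 hRs)
  obtain ⟨t, htS, htu⟩ := exists_lt_of_csInf_lt hne hu
  rcases (csInf_le hbdd htS).eq_or_lt with h | h
  · exact htS.2 (h ▸ hRs)
  · exact htS.2 (hIoo ⟨h, htu⟩)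

/-- `z` is an integer. -/
def IsInt (z : ℝ) : Prop := ∃ k : ℤ, z = k

theorem IsInt.sub {z w : ℝ} (hz : IsInt z) (hw : IsInt w) : IsInt (z - w) := by
  obtain ⟨k, rfl⟩ := hz
  obtain ⟨j, rfl⟩ := hw
  exact ⟨k - j, by push_cast; rfl⟩

theorem IsInt.add {z w : ℝ} (hz : IsInt z) (hw : IsInt w) : IsInt (z + w) := by
  obtain ⟨k, rfl⟩ := hz
  obtain ⟨j, rfl⟩ := hw
  exact ⟨k + j, by push_cast; rfl⟩

theorem IsInt.of_sub {z w : ℝ} (h : IsInt (z - w)) (hw : IsInt w) : IsInt z := by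
  simpa using h.add hw

theorem isInt_neg_iff {z : ℝ} : IsInt (-z) ↔ IsInt z := by
  constructor
  · rintro ⟨k, hk⟩; exact ⟨-k, by push_cast; linarith⟩
  · rintro ⟨k, hk⟩; exact ⟨-k, by push_cast; linarith⟩

theorem eventually_floor_right (x s : ℝ) {l : ℝ} (hl : 0 ≤ l) :
    ∀ᶠ t in 𝓝[>] s, ⌊x + t * l⌋ = ⌊x + s * l⌋ := by
  have hc : Tendsto (fun t : ℝ => x + t * l) (𝓝[>] s) (𝓝[≥] (x + s * l)) := by
    refine tendsto_nhdsWithin_of_tendsto_nhds_of_eventually_within _ ?_ ?_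
    · exact (Continuous.tendsto (by fun_prop) s).mono_left nhdsWithin_le_nhds
    · filter_upwards [self_mem_nhdsWithin] with t ht
      have := mul_le_mul_of_nonneg_right (le_of_lt (mem_Ioi.mp ht)) hl
      simp only [mem_Ici]; linarith
  exact tendsto_pure.mp ((tendsto_floor_right_pure_floor _).comp hc)

theorem eventually_floor_of_not_isInt {x s l : ℝ} (h : ¬ IsInt (x + s * l)) :
    ∀ᶠ t in 𝓝 s, ⌊x + t * l⌋ = ⌊x + s * l⌋ := by
  have hc : Tendsto (fun t : ℝ => x + t * l) (𝓝 s) (𝓝 (x + s * l)) :=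
    Continuous.tendsto (by fun_prop) s
  have hlt : (⌊x + s * l⌋ : ℝ) < x + s * l :=
    lt_of_le_of_ne (Int.floor_le _) fun h' => h ⟨_, h'.symm⟩
  filter_upwards [hc.eventually (Ioo_mem_nhds hlt (Int.lt_floor_add_one (x + s * l)))] with t ht
  exact Int.floor_eq_iff.mpr ⟨ht.1.le, ht.2⟩

theorem eventually_floor_left_of_isInt {x s l : ℝ} (hl : 0 < l) (h : IsInt (x + s * l)) :
    ∀ᶠ t in 𝓝[<] s, ⌊x + t * l⌋ = ⌊x + s * l⌋ - 1 := by
  obtain ⟨k, hk⟩ := h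
  have hc : Tendsto (fun t : ℝ => x + t * l) (𝓝[<] s) (𝓝[<] (x + s * l)) := by
    refine tendsto_nhdsWithin_of_tendsto_nhds_of_eventually_within _ ?_ ?_
    · exact (Continuous.tendsto (by fun_prop) s).mono_left nhdsWithin_le_nhds
    · filter_upwards [self_mem_nhdsWithin] with t ht
      have := mul_lt_mul_of_pos_right (mem_Iio.mp ht) hl
      simp only [mem_Iio]; linarith
  rw [hk] at hc ⊢
  rw [Int.floor_intCast]
  exact tendsto_pure.mp ((tendsto_floor_left_pure_sub_one k).comp hc)

/-- The line `s ↦ (x + s l, y + s m)` misses the integer points. -/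
def AvoidsLattice (x l y m : ℝ) : Prop := ∀ s : ℝ, ¬ (IsInt (x + s * l) ∧ IsInt (y + s * m))

theorem AvoidsLattice.swap {x l y m : ℝ} (h : AvoidsLattice x l y m) : AvoidsLattice y m x l :=
  fun s hs => h s ⟨hs.2, hs.1⟩

theorem AvoidsLattice.shear {x l y m : ℝ} (h : AvoidsLattice x l y m) :
    AvoidsLattice (x - y) (l - m) y m := fun s hs => by
  refine h s ⟨IsInt.of_sub (w := y + s * m) ?_ hs.2, hs.2⟩
  rw [show x + s * l - (y + s * m) = x - y + s * (l - m) by ring]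
  exact hs.1

theorem AvoidsLattice.pos {x l y m s : ℝ} (h : AvoidsLattice x l y m) (hl : 0 ≤ l)
    (hlm : 0 < l + m) (hs : IsInt (x + s * l)) : 0 < l := by
  rcases hl.eq_or_lt with rfl | h'
  · exfalso
    rw [zero_add] at hlm
    refine h (-y / m) ⟨by simpa using hs, ⟨0, ?_⟩⟩
    field_simp; simp
  · exact h'

/-- `Φ` is the parallel transport along the line `s ↦ (x + s l, y + s m)`: it is multiplied on the
left by `A` when the first coordinate crosses an integer, by `B` when the second one does. -/
structure IsTransport {G : Type*} [Group G] (x l y m : ℝ) (A B : G) (Φ : ℝ → G) : Prop where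
  right : ∀ s, 0 ≤ s → ∀ᶠ t in 𝓝[>] s, Φ t = Φ s
  left : ∀ s, 0 < s → ¬ IsInt (x + s * l) → ¬ IsInt (y + s * m) → ∀ᶠ t in 𝓝[<] s, Φ s = Φ t
  vert : ∀ s, 0 < s → IsInt (x + s * l) → ∀ᶠ t in 𝓝[<] s, Φ s = A * Φ t
  horiz : ∀ s, 0 < s → IsInt (y + s * m) → ∀ᶠ t in 𝓝[<] s, Φ s = B * Φ t

namespace IsTransport

variable {G : Type*} [Group G] {x l y m : ℝ} {A B : G} {Φ : ℝ → G}

theorem swap (h : IsTransport x l y m A B Φ) : IsTransport y m x l B A Φ :=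
  ⟨h.right, fun s hs h1 h2 => h.left s hs h2 h1, h.horiz, h.vert⟩

theorem map {H : Type*} [Group H] (f : G →* H) (h : IsTransport x l y m A B Φ) :
    IsTransport x l y m (f A) (f B) (fun t => f (Φ t)) where
  right s hs := (h.right s hs).mono fun t ht => by rw [ht]
  left s hs h1 h2 := (h.left s hs h1 h2).mono fun t ht => by rw [ht]
  vert s hs h1 := (h.vert s hs h1).mono fun t ht => by rw [ht, map_mul]
  horiz s hs h1 := (h.horiz s hs h1).mono fun t ht => by rw [ht, map_mul]

theorem induction (h : IsTransport x l y m A B Φ) (hg : AvoidsLattice x l y m) (hl : 0 ≤ l)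
    (hm : 0 ≤ m) (hlm : 0 < l + m) (S : ℤ → ℤ → G → Prop) (h0 : S ⌊x⌋ ⌊y⌋ (Φ 0))
    (hA : ∀ i j g, S i j g → S (i + 1) j (A * g)) (hB : ∀ i j g, S i j g → S i (j + 1) (B * g)) :
    ∀ t, 0 ≤ t → S ⌊x + t * l⌋ ⌊y + t * m⌋ (Φ t) := by
  refine real_induction (by simpa using h0) ?_ ?_
  · intro s hs hS
    filter_upwards [h.right s hs, eventually_floor_right x s hl, eventually_floor_right y s hm]
      with t h1 h2 h3
    rwa [h1, h2, h3]
  · intro s hs hS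
    have hpos : ∀ᶠ t in 𝓝[<] s, 0 ≤ t ∧ t < s := by
      filter_upwards [Ioo_mem_nhdsLT hs] with t ht using ⟨ht.1.le, ht.2⟩
    by_cases hX : IsInt (x + s * l)
    · have hY : ¬ IsInt (y + s * m) := fun h' => hg s ⟨hX, h'⟩
      obtain ⟨t, ⟨h1, h2⟩, h3, h4, h5⟩ := (hpos.and ((h.vert s hs hX).and
        ((eventually_floor_left_of_isInt (hg.pos hl hlm hX) hX).and
        ((eventually_floor_of_not_isInt hY).filter_mono nhdsWithin_le_nhds)))).exists
      have := hA _ _ _ (hS t h1 h2)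
      rwa [h4, h5, sub_add_cancel, ← h3] at this
    · by_cases hY : IsInt (y + s * m)
      · obtain ⟨t, ⟨h1, h2⟩, h3, h4, h5⟩ := (hpos.and ((h.horiz s hs hY).and
          ((eventually_floor_left_of_isInt (hg.swap.pos hm (by linarith) hY) hY).and
          ((eventually_floor_of_not_isInt hX).filter_mono nhdsWithin_le_nhds)))).exists
        have := hB _ _ _ (hS t h1 h2)
        rwa [h4, h5, sub_add_cancel, ← h3] at this
      · obtain ⟨t, ⟨h1, h2⟩, h3, h4, h5⟩ := (hpos.and ((h.left s hs hX hY).and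
          (((eventually_floor_of_not_isInt hX).filter_mono nhdsWithin_le_nhds).and
          ((eventually_floor_of_not_isInt hY).filter_mono nhdsWithin_le_nhds)))).exists
        have := hS t h1 h2
        rwa [h4, h5, ← h3] at this

end IsTransport

/-- `0` or `1` according to the side of the diagonal of its unit square on which a point lies. -/
noncomputable def side (X Y : ℝ) : ℤ := ⌊X⌋ - ⌊Y⌋ - ⌊X - Y⌋

theorem side_eq (X Y : ℝ) : side X Y = 0 ∨ side X Y = 1 := by
  have h1 := Int.floor_le X
  have h2 := Int.lt_floor_add_one X
  have h3 := Int.floor_le Y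
  have h4 := Int.lt_floor_add_one Y
  have h5 := Int.floor_le (X - Y)
  have h6 := Int.lt_floor_add_one (X - Y)
  have a : (side X Y : ℝ) < 2 := by rw [side]; push_cast; linarith
  have b : (-1 : ℝ) < side X Y := by rw [side]; push_cast; linarith
  have a' : side X Y < 2 := by exact_mod_cast a
  have b' : -1 < side X Y := by exact_mod_cast b
  omega

/-- The behaviour of `side` along a line: unchanged to the right, and changing on the left when one
of the two coordinates, or their difference, crosses an integer. -/
theorem side_eventually {x l y m : ℝ} (hg : AvoidsLattice x l y m) (hm : 0 ≤ m) (hml : m ≤ l)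
    (hlm : 0 < l + m) (s : ℝ) :
    (∀ᶠ t in 𝓝[>] s, side (x + t * l) (y + t * m) = side (x + s * l) (y + s * m)) ∧
    (¬ IsInt (x - y + s * (l - m)) → ¬ IsInt (y + s * m) → ¬ IsInt (x + s * l) →
      ∀ᶠ t in 𝓝[<] s, side (x + t * l) (y + t * m) = side (x + s * l) (y + s * m)) ∧
    (¬ IsInt (x - y + s * (l - m)) → ¬ IsInt (y + s * m) → IsInt (x + s * l) →
      ∀ᶠ t in 𝓝[<] s, side (x + s * l) (y + s * m) = side (x + t * l) (y + t * m) + 1) ∧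
    (IsInt (x - y + s * (l - m)) →
      ∀ᶠ t in 𝓝[<] s, side (x + t * l) (y + t * m) = side (x + s * l) (y + s * m) + 1) ∧
    (IsInt (y + s * m) →
      ∀ᶠ t in 𝓝[<] s, side (x + t * l) (y + t * m) = 1 ∧ side (x + s * l) (y + s * m) = 0) := by
  have hl : 0 ≤ l := hm.trans hml
  have e : ∀ t, x + t * l - (y + t * m) = x - y + t * (l - m) := fun t => by ring
  have hg' := hg.shear
  simp only [side, e]
  refine ⟨?_, ?_, ?_, ?_, ?_⟩
  · filter_upwards [eventually_floor_right x s hl, eventually_floor_right y s hm,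
      eventually_floor_right (x - y) s (sub_nonneg.mpr hml)] with t h1 h2 h3
    rw [h1, h2, h3]
  · intro hD hY hX
    filter_upwards [(eventually_floor_of_not_isInt hX).filter_mono nhdsWithin_le_nhds,
      (eventually_floor_of_not_isInt hY).filter_mono nhdsWithin_le_nhds,
      (eventually_floor_of_not_isInt hD).filter_mono nhdsWithin_le_nhds] with t h1 h2 h3
    rw [h1, h2, h3]
  · intro hD hY hX
    filter_upwards [eventually_floor_left_of_isInt (hg.pos hl hlm hX) hX,
      (eventually_floor_of_not_isInt hY).filter_mono nhdsWithin_le_nhds,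
      (eventually_floor_of_not_isInt hD).filter_mono nhdsWithin_le_nhds] with t h1 h2 h3
    rw [h1, h2, h3]; ring
  · intro hD
    have hY : ¬ IsInt (y + s * m) := fun h => hg' s ⟨hD, h⟩
    have hX : ¬ IsInt (x + s * l) := fun h => hY <| by
      have := h.sub hD
      rwa [show x + s * l - (x - y + s * (l - m)) = y + s * m by ring] at this
    have hpos : 0 < l - m := by
      refine hg'.pos (sub_nonneg.mpr hml) ?_ hD
      rcases hm.eq_or_lt with h | h <;> linarith
    filter_upwards [(eventually_floor_of_not_isInt hX).filter_mono nhdsWithin_le_nhds,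
      (eventually_floor_of_not_isInt hY).filter_mono nhdsWithin_le_nhds,
      eventually_floor_left_of_isInt hpos hD] with t h1 h2 h3
    rw [h1, h2, h3]; ring
  · intro hY
    have hD : ¬ IsInt (x - y + s * (l - m)) := fun h => hg' s ⟨h, hY⟩
    have hX : ¬ IsInt (x + s * l) := fun h => hg s ⟨h, hY⟩
    filter_upwards [(eventually_floor_of_not_isInt hX).filter_mono nhdsWithin_le_nhds,
      eventually_floor_left_of_isInt (hg.swap.pos hm (by linarith) hY) hY,
      (eventually_floor_of_not_isInt hD).filter_mono nhdsWithin_le_nhds] with t h1 h2 h3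
    have h4 := side_eq (x + t * l) (y + t * m)
    have h5 := side_eq (x + s * l) (y + s * m)
    simp only [side, e] at h4 h5
    omega

namespace IsTransport

variable {G : Type*} [Group G] {x l y m : ℝ} {A B : G} {Φ : ℝ → G}

/-- Cutting along the diagonals instead of the vertical sides turns `(A, B)` into `(A, B A)`. -/
theorem twistA (h : IsTransport x l y m A B Φ) (hg : AvoidsLattice x l y m) (hm : 0 ≤ m)
    (hml : m ≤ l) (hlm : 0 < l + m) :
    IsTransport (x - y) (l - m) y m A (B * A)
      (fun t => A ^ (-side (x + t * l) (y + t * m)) * Φ t) where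
  right s hs := by
    filter_upwards [h.right s hs, (side_eventually hg hm hml hlm s).1] with t h1 h2
    rw [h1, h2]
  left s hs hD hY := by
    by_cases hX : IsInt (x + s * l)
    · filter_upwards [h.vert s hs hX, (side_eventually hg hm hml hlm s).2.2.1 hD hY hX]
        with t h1 h2
      rw [h1, h2]; group
    · filter_upwards [h.left s hs hX hY, (side_eventually hg hm hml hlm s).2.1 hD hY hX]
        with t h1 h2
      rw [h1, h2]
  vert s hs hD := by
    have hY : ¬ IsInt (y + s * m) := fun h => hg.shear s ⟨hD, h⟩
    have hX : ¬ IsInt (x + s * l) := fun h => hY <| by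
      have := h.sub hD
      rwa [show x + s * l - (x - y + s * (l - m)) = y + s * m by ring] at this
    filter_upwards [h.left s hs hX hY, (side_eventually hg hm hml hlm s).2.2.2.1 hD] with t h1 h2
    rw [h1, h2]; group
  horiz s hs hY := by
    filter_upwards [h.horiz s hs hY, (side_eventually hg hm hml hlm s).2.2.2.2 hY]
      with t h1 h2
    rw [h1, h2.1, h2.2]; group

/-- Cutting along the diagonals instead of the horizontal sides turns `(A, B)` into `(B A, B)`. -/
theorem twistB (h : IsTransport x l y m A B Φ) (hg : AvoidsLattice x l y m) (hl : 0 ≤ l)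
    (hlm' : l ≤ m) (hlm : 0 < l + m) :
    IsTransport x l (y - x) (m - l) (B * A) B
      (fun t => B ^ (1 - side (y + t * m) (x + t * l)) * Φ t) := by
  have hml : 0 < m + l := by linarith
  refine swap ⟨?_, ?_, ?_, ?_⟩
  · intro s hs
    filter_upwards [h.right s hs, (side_eventually hg.swap hl hlm' hml s).1] with t h1 h2
    rw [h1, h2]
  · intro s hs hD hX
    by_cases hY : IsInt (y + s * m)
    · filter_upwards [h.horiz s hs hY, (side_eventually hg.swap hl hlm' hml s).2.2.1 hD hX hY]
        with t h1 h2
      rw [h1, h2]; group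
    · filter_upwards [h.left s hs hX hY, (side_eventually hg.swap hl hlm' hml s).2.1 hD hX hY]
        with t h1 h2
      rw [h1, h2]
  · intro s hs hD
    have hX : ¬ IsInt (x + s * l) := fun h => hg.swap.shear s ⟨hD, h⟩
    have hY : ¬ IsInt (y + s * m) := fun h => hX <| by
      have := h.sub hD
      rwa [show y + s * m - (y - x + s * (m - l)) = x + s * l by ring] at this
    filter_upwards [h.left s hs hX hY, (side_eventually hg.swap hl hlm' hml s).2.2.2.1 hD]
      with t h1 h2
    rw [h1, h2]; group
  · intro s hs hX
    filter_upwards [h.vert s hs hX, (side_eventually hg.swap hl hlm' hml s).2.2.2.2 hX]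
      with t h1 h2
    rw [h1, h2.1, h2.2]; group

end IsTransport

/-! ### The crossing word is a transport -/

/-- The absolute value of `r` is the velocity, and this is the starting point, after a reflection
that makes the velocity nonnegative. -/
noncomputable def reflect (r x : ℝ) : ℝ := if 0 ≤ r then x else -x

theorem isInt_reflect (r x s : ℝ) :
    IsInt (reflect r x + s * |r|) ↔ ∃ k : ℤ, x + s * r = k := by
  unfold reflect
  split_ifs with h
  · rw [abs_of_nonneg h]; rfl
  · rw [abs_of_neg (not_le.mp h), ← isInt_neg_iff]
    rw [show -(-x + s * -r) = x + s * r by ring]; rfl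

/-- The times in `(0, t]` at which `x + s l` is an integer. -/
def crossings (x l t : ℝ) : Set ℝ := {s | s ∈ Ioc 0 t ∧ l ≠ 0 ∧ IsInt (x + s * l)}

theorem vertCrossings_eq (θ : Circle) (p : ℝ × ℝ) (t : ℝ) :
    vertCrossings θ p t = crossings (reflect (θ : ℂ).re p.1) |(θ : ℂ).re| t := by
  ext s; simp only [vertCrossings, crossings, mem_ofPred_eq, isInt_reflect, ne_eq, abs_eq_zero]

theorem horizCrossings_eq (θ : Circle) (p : ℝ × ℝ) (t : ℝ) :
    horizCrossings θ p t = crossings (reflect (θ : ℂ).im p.2) |(θ : ℂ).im| t := by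
  ext s; simp only [horizCrossings, crossings, mem_ofPred_eq, isInt_reflect, ne_eq, abs_eq_zero]

theorem crossings_congr {x l s t : ℝ} (hl : 0 ≤ l) (hst : s ≤ t)
    (h : ⌊x + t * l⌋ = ⌊x + s * l⌋) : crossings x l t = crossings x l s := by
  ext r
  simp only [crossings, mem_ofPred_eq, mem_Ioc]
  refine ⟨fun ⟨⟨h0, hr⟩, hl0, hk⟩ => ⟨⟨h0, ?_⟩, hl0, hk⟩,
    fun ⟨⟨h0, hr⟩, hl0, hk⟩ => ⟨⟨h0, hr.trans hst⟩, hl0, hk⟩⟩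
  by_contra! hsr
  obtain ⟨k, hk⟩ := hk
  have hlp : 0 < l := lt_of_le_of_ne hl hl0.symm
  have h1 : x + s * l < k := by rw [← hk]; gcongr
  have h2 : (k : ℝ) ≤ x + t * l := by rw [← hk]; gcongr
  have h3 := Int.floor_lt.mpr h1
  have h4 := Int.le_floor.mpr h2
  omega

theorem crossings_insert {x l s t : ℝ} (hl : 0 < l) (h0 : 0 < t) (hts : t < s)
    (hs : IsInt (x + s * l)) (h : ⌊x + t * l⌋ = ⌊x + s * l⌋ - 1) :
    crossings x l s = insert s (crossings x l t) := by
  ext r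
  simp only [crossings, mem_ofPred_eq, mem_Ioc, mem_insert_iff]
  constructor
  · rintro ⟨⟨hr0, hr⟩, hl0, k, hk⟩
    by_cases hrs : r = s
    · exact Or.inl hrs
    · refine Or.inr ⟨⟨hr0, ?_⟩, hl0, k, hk⟩
      by_contra! htr
      have hrs' : r < s := lt_of_le_of_ne hr hrs
      obtain ⟨j, hj⟩ := hs
      have h1 : x + t * l < k := by rw [← hk]; gcongr
      have h2 : (k : ℝ) < j := by rw [← hk, ← hj]; gcongr
      have h3 := Int.floor_lt.mpr h1
      have h4 : k < j := by exact_mod_cast h2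
      rw [hj, Int.floor_intCast] at h
      omega
  · rintro (rfl | ⟨⟨hr0, hr⟩, hl0, hk⟩)
    · exact ⟨⟨h0.trans hts, le_rfl⟩, hl.ne', hs⟩
    · exact ⟨⟨hr0, hr.trans hts.le⟩, hl0, hk⟩

theorem crossingWord_congr {θ : Circle} {p : ℝ × ℝ} {s t : ℝ}
    (hv : vertCrossings θ p t = vertCrossings θ p s)
    (hh : horizCrossings θ p t = horizCrossings θ p s) :
    crossingWord θ p t = crossingWord θ p s := by
  unfold crossingWord
  have : (finite_crossings θ p t).toFinset = (finite_crossings θ p s).toFinset := by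
    ext; simp [hv, hh]
  rw [this, hv]

theorem crossingWord_insert {θ : Circle} {p : ℝ × ℝ} {s t : ℝ} (hts : t < s)
    (hu : vertCrossings θ p s ∪ horizCrossings θ p s =
      insert s (vertCrossings θ p t ∪ horizCrossings θ p t)) :
    crossingWord θ p s = (if s ∈ vertCrossings θ p s then signed (θ : ℂ).re genA
      else signed (θ : ℂ).im genB) * crossingWord θ p t := by
  unfold crossingWord
  have hle : ∀ r ∈ (finite_crossings θ p t).toFinset, r ≤ t := by
    intro r hr
    rw [Set.Finite.mem_toFinset] at hr
    rcases hr with hr | hr <;> exact hr.1.2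
  have : (finite_crossings θ p s).toFinset = insert s (finite_crossings θ p t).toFinset := by
    ext r
    rw [Set.Finite.mem_toFinset, Finset.mem_insert, Set.Finite.mem_toFinset, hu,
      Set.mem_insert_iff]
  rw [this, Finset.sort_insert, List.map_cons, List.prod_cons]
  · congr 2
    refine List.map_congr_left fun r hr => ?_
    have hrt := hle r ((Finset.mem_sort _).mp hr)
    have : r ∈ vertCrossings θ p s ↔ r ∈ vertCrossings θ p t := by
      simp only [vertCrossings, mem_ofPred_eq, mem_Ioc]
      constructor
      · rintro ⟨⟨h1, -⟩, h2⟩; exact ⟨⟨h1, hrt⟩, h2⟩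
      · rintro ⟨⟨h1, h3⟩, h2⟩; exact ⟨⟨h1, by linarith⟩, h2⟩
    simp only [this]
  · intro r hr; exact (hle r hr).trans hts.le
  · intro h; exact absurd (hle s h) (not_le.mpr hts)

theorem crossingWord_zero (θ : Circle) (p : ℝ × ℝ) : crossingWord θ p 0 = 1 := by
  have : (finite_crossings θ p 0).toFinset = ∅ := by
    ext r; simp [vertCrossings, horizCrossings]
  unfold crossingWord
  rw [this]; simp

theorem circle_abs_add_pos (θ : Circle) : 0 < |(θ : ℂ).re| + |(θ : ℂ).im| := by
  by_contra! h
  have h1 := abs_nonneg (θ : ℂ).re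
  have h2 := abs_nonneg (θ : ℂ).im
  have hz : (θ : ℂ) = 0 := Complex.ext (abs_eq_zero.mp (by linarith)) (abs_eq_zero.mp (by linarith))
  exact Circle.coe_ne_zero θ hz

theorem isTransport_crossingWord (θ : Circle) (p : ℝ × ℝ)
    (hg : AvoidsLattice (reflect (θ : ℂ).re p.1) |(θ : ℂ).re| (reflect (θ : ℂ).im p.2)
      |(θ : ℂ).im|) :
    IsTransport (reflect (θ : ℂ).re p.1) |(θ : ℂ).re| (reflect (θ : ℂ).im p.2) |(θ : ℂ).im|
      (signed (θ : ℂ).re genA) (signed (θ : ℂ).im genB) (crossingWord θ p) := by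
  have hθ := circle_abs_add_pos θ
  have hl := abs_nonneg (θ : ℂ).re
  have hm := abs_nonneg (θ : ℂ).im
  have hpos : ∀ s : ℝ, 0 < s → ∀ᶠ t in 𝓝[<] s, 0 < t ∧ t < s := fun s hs => by
    filter_upwards [Ioo_mem_nhdsLT hs] with t ht using ht
  refine ⟨?_, ?_, ?_, ?_⟩
  · intro s _
    filter_upwards [self_mem_nhdsWithin, eventually_floor_right (reflect (θ : ℂ).re p.1) s hl,
      eventually_floor_right (reflect (θ : ℂ).im p.2) s hm] with t ht h1 h2
    apply crossingWord_congr
    · rw [vertCrossings_eq, vertCrossings_eq, crossings_congr hl (le_of_lt ht) h1]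
    · rw [horizCrossings_eq, horizCrossings_eq, crossings_congr hm (le_of_lt ht) h2]
  · intro s hs hX hY
    filter_upwards [hpos s hs, (eventually_floor_of_not_isInt hX).filter_mono nhdsWithin_le_nhds,
      (eventually_floor_of_not_isInt hY).filter_mono nhdsWithin_le_nhds] with t ht h1 h2
    apply crossingWord_congr
    · rw [vertCrossings_eq, vertCrossings_eq, crossings_congr hl ht.2.le h1.symm]
    · rw [horizCrossings_eq, horizCrossings_eq, crossings_congr hm ht.2.le h2.symm]
  · intro s hs hX
    have hY := fun h => hg s ⟨hX, h⟩
    have hl' := hg.pos hl hθ hX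
    filter_upwards [hpos s hs, eventually_floor_left_of_isInt hl' hX,
      (eventually_floor_of_not_isInt hY).filter_mono nhdsWithin_le_nhds] with t ht h1 h2
    rw [crossingWord_insert (t := t) ht.2, if_pos]
    · rw [vertCrossings_eq]
      exact ⟨⟨hs, le_rfl⟩, hl'.ne', hX⟩
    · rw [vertCrossings_eq, horizCrossings_eq, vertCrossings_eq, horizCrossings_eq,
        crossings_congr hm ht.2.le h2.symm, crossings_insert hl' ht.1 ht.2 hX h1,
        Set.insert_union]
  · intro s hs hY
    have hX := fun h => hg s ⟨h, hY⟩
    have hm' := hg.swap.pos hm (by linarith) hY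
    filter_upwards [hpos s hs, eventually_floor_left_of_isInt hm' hY,
      (eventually_floor_of_not_isInt hX).filter_mono nhdsWithin_le_nhds] with t ht h1 h2
    rw [crossingWord_insert (t := t) ht.2, if_neg]
    · rw [vertCrossings_eq]
      exact fun h => hX h.2.2
    · rw [vertCrossings_eq, horizCrossings_eq, vertCrossings_eq, horizCrossings_eq,
        crossings_congr hl ht.2.le h2.symm, crossings_insert hm' ht.1 ht.2 hY h1,
        Set.union_insert]

theorem volume_line_eq_zero {a b : ℝ} (hab : a ≠ 0 ∨ b ≠ 0) (c : ℝ) :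
    volume {p : ℝ × ℝ | p.1 * b - p.2 * a = c} = 0 := by
  have hmeas : MeasurableSet {p : ℝ × ℝ | p.1 * b - p.2 * a = c} :=
    measurableSet_eq_fun (by fun_prop) (by fun_prop)
  rw [Measure.volume_eq_prod, Measure.measure_prod_null hmeas]
  by_cases ha : a = 0
  · have hb : b ≠ 0 := by tauto
    have hne : ∀ᵐ x : ℝ, x ≠ c / b := by simp [ae_iff]
    filter_upwards [hne] with x hx
    have : Prod.mk x ⁻¹' {p : ℝ × ℝ | p.1 * b - p.2 * a = c} = ∅ := by
      ext y
      simp only [mem_preimage, mem_ofPred_eq, mem_empty_iff_false, iff_false, ha]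
      intro h
      exact hx (by field_simp; linarith)
    rw [this]; simp
  · filter_upwards with x
    refine Set.Subsingleton.measure_zero (fun y hy z hz => ?_) _
    simp only [mem_preimage, mem_ofPred_eq] at hy hz
    exact mul_right_cancel₀ ha (by linarith)

/-- Almost every line avoids the lattice. -/
theorem ae_avoidsLattice (θ : Circle) :
    ∀ᵐ p : ℝ × ℝ, AvoidsLattice (reflect (θ : ℂ).re p.1) |(θ : ℂ).re| (reflect (θ : ℂ).im p.2)
      |(θ : ℂ).im| := by
  have hab : (θ : ℂ).re ≠ 0 ∨ (θ : ℂ).im ≠ 0 := by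
    by_contra! h
    exact Circle.coe_ne_zero θ (Complex.ext h.1 h.2)
  have hall : ∀ᵐ p : ℝ × ℝ, ∀ k : ℤ × ℤ,
      ¬ (p.1 * (θ : ℂ).im - p.2 * (θ : ℂ).re = k.1 * (θ : ℂ).im - k.2 * (θ : ℂ).re) := by
    rw [ae_all_iff]
    intro k
    rw [ae_iff]
    simpa using volume_line_eq_zero hab (k.1 * (θ : ℂ).im - k.2 * (θ : ℂ).re)
  filter_upwards [hall] with p hp s hs
  rw [isInt_reflect, isInt_reflect] at hs
  obtain ⟨⟨i, hi⟩, ⟨j, hj⟩⟩ := hs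
  exact hp (i, j) (by simp only; rw [← hi, ← hj]; ring)

/-! ### Dynamics of the twists on the Markov surface -/

/-- The escape region, for the traces `x, y, z` of `A, B, BA`. -/
def Escaping (x y z : ℝ) : Prop := 2 < |x| ∧ 2 < |y| ∧ 0 < x * y * z ∧ max |x| |y| ≤ |z|

theorem Escaping.swap {x y z : ℝ} (h : Escaping x y z) : Escaping y x z :=
  ⟨h.2.1, h.1, by linarith [h.2.2.1, mul_comm x y, congrArg (· * z) (mul_comm x y)], by
    rw [max_comm]; exact h.2.2.2⟩

theorem escaping_of_abs_le {x y z : ℝ} (hx : 2 < |x|) (hz : 2 < |z|)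
    (h : |y| ≤ 2 ∨ x * y * z ≤ 0 ∨ |y| ≤ |x|) : Escaping x z (x * z - y) := by
  have hxz : |x * z| = |x| * |z| := abs_mul x z
  have hsq : (x * z) ^ 2 = (|x| * |z|) ^ 2 := by rw [← hxz, sq_abs]
  have hlo : |x| * |z| - |y| ≤ |x * z - y| := by
    rw [← hxz]; exact abs_sub_abs_le_abs_sub _ _
  have hle : x * y * z ≤ |x| * |z| * |y| := by
    calc x * y * z ≤ |x * y * z| := le_abs_self _
      _ = |x| * |z| * |y| := by rw [abs_mul, abs_mul]; ring
  have hy0 := abs_nonneg y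
  refine ⟨hx, hz, ?_, ?_⟩
  · have e : x * z * (x * z - y) = (|x| * |z|) ^ 2 - x * y * z := by rw [← hsq]; ring
    rw [e]
    rcases h with h | h | h
    · nlinarith [mul_pos (sub_pos.mpr hx) (sub_pos.mpr hz)]
    · nlinarith [mul_pos (sub_pos.mpr hx) (sub_pos.mpr hz)]
    · nlinarith [mul_pos (sub_pos.mpr hx) (sub_pos.mpr hz), mul_pos (show 0 < |x| by linarith)
        (show 0 < |z| by linarith)]
  · rcases h with h | h | h
    · refine le_trans (max_le ?_ ?_) hlo <;> nlinarith
    · have : |x| * |z| ≤ |x * z - y| := by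
        rw [← hxz]
        apply sq_le_sq.mp
        nlinarith [sq_nonneg y]
      refine le_trans (max_le ?_ ?_) this <;> nlinarith
    · refine le_trans (max_le ?_ ?_) hlo <;> nlinarith

/-- As long as a configuration of large traces does not escape, the larger one drops. -/
theorem max_le_sub_sqrt {x y z κ : ℝ} (hκ : x ^ 2 + y ^ 2 + z ^ 2 - x * y * z - 4 = κ)
    (hx : 2 < |x|) (hy : 2 < |y|) (hz : 2 < |z|) (hE : ¬ Escaping x y z)
    (hE' : ¬ Escaping x z (x * z - y)) : max |x| |z| ≤ max |x| |y| - √κ := by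
  have hpos : 0 < x * y * z := by
    by_contra! h
    exact hE' (escaping_of_abs_le hx hz (Or.inr (Or.inl h)))
  have hyx : |x| < |y| := by
    by_contra! h
    exact hE' (escaping_of_abs_le hx hz (Or.inr (Or.inr h)))
  have hzy : |z| < |y| := by
    by_contra! h
    exact hE ⟨hx, hy, hpos, max_le (hyx.le.trans h) h⟩
  have hκ' : |x| ^ 2 + |y| ^ 2 + |z| ^ 2 - |x| * |y| * |z| - 4 = κ := by
    rw [← abs_mul, ← abs_mul, abs_of_pos hpos, sq_abs, sq_abs, sq_abs]; exact hκ
  rw [max_eq_right hyx.le]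
  have key : ∀ u v w : ℝ, 2 < u → 2 < v → 2 < w → u ≤ v → v < w →
      u ^ 2 + v ^ 2 + w ^ 2 - u * v * w - 4 = κ → √κ ≤ w - v := by
    intro u v w hu hv hw huv hvw h
    apply Real.sqrt_le_iff.mpr ⟨by linarith, ?_⟩
    nlinarith [mul_nonneg (show 0 ≤ u - 2 by linarith)
      (show 0 ≤ v * w - (u + 2) by nlinarith)]
  rcases le_total |x| |z| with h | h
  · rw [max_eq_right h]
    linarith [key |x| |z| |y| hx hz hy h hzy (by linarith)]
  · rw [max_eq_left h]
    linarith [key |z| |x| |y| hz hx hy h hyx (by linarith)]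

theorem abs_le_of_fricke {x y z κ : ℝ} (hκ : x ^ 2 + y ^ 2 + z ^ 2 - x * y * z - 4 = κ)
    (hy : |y| ≤ 2) (hz : |z| ≤ 2) : |x| ≤ 2 + √(4 + κ) := by
  have hy2 : y ^ 2 ≤ 4 := by nlinarith [abs_le.mp hy]
  have hz2 : z ^ 2 ≤ 4 := by nlinarith [abs_le.mp hz]
  have h1 : |x - y * z / 2| ≤ √(4 + κ) := by
    apply Real.abs_le_sqrt
    nlinarith [mul_nonneg (sub_nonneg.mpr hy2) (sub_nonneg.mpr hz2),
      mul_nonneg (sq_nonneg y) (sq_nonneg z), mul_nonneg (sub_nonneg.mpr hy2) (sq_nonneg z)]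
  have h2 : |y * z / 2| ≤ 2 := by
    rw [abs_div, abs_mul, abs_two]
    nlinarith [abs_nonneg y, abs_nonneg z]
  calc |x| = |(x - y * z / 2) + y * z / 2| := by ring_nf
    _ ≤ _ := abs_add_le _ _
    _ ≤ _ := by linarith

/-- A sequence of twists, acting on the traces of `A, B, BA` (a twist along `a` at the times in
`T`, along `b` at the others). -/
structure TwistOrbit (κ : ℝ) (T : ℕ → Prop) (x y z : ℕ → ℝ) : Prop where
  fricke : ∀ n, x n ^ 2 + y n ^ 2 + z n ^ 2 - x n * y n * z n - 4 = κ
  stepA : ∀ n, T n → x (n + 1) = x n ∧ y (n + 1) = z n ∧ z (n + 1) = x n * z n - y n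
  stepB : ∀ n, ¬ T n → x (n + 1) = z n ∧ y (n + 1) = y n ∧ z (n + 1) = y n * z n - x n

namespace TwistOrbit

variable {κ : ℝ} {T : ℕ → Prop} {x y z : ℕ → ℝ}

theorem swap (h : TwistOrbit κ T x y z) : TwistOrbit κ (fun n => ¬ T n) y x z where
  fricke n := by linear_combination h.fricke n
  stepA n hn := by obtain ⟨h1, h2, h3⟩ := h.stepB n hn; exact ⟨h2, h1, h3⟩
  stepB n hn := by obtain ⟨h1, h2, h3⟩ := h.stepA n (not_not.mp hn); exact ⟨h2, h1, h3⟩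

/-- All three traces are hyperbolic. -/
def Large (x y z : ℝ) : Prop := 2 < |x| ∧ 2 < |y| ∧ 2 < |z|

theorem large_of_large_succ (h : TwistOrbit κ T x y z)
    (hE : ∀ n, ¬ Escaping (x n) (y n) (z n)) (n : ℕ)
    (hL : Large (x (n + 1)) (y (n + 1)) (z (n + 1))) : Large (x n) (y n) (z n) := by
  by_cases hT : T n
  · obtain ⟨h1, h2, h3⟩ := h.stepA n hT
    have hE' := hE (n + 1)
    rw [h1, h2, h3] at hL hE'
    refine ⟨hL.1, ?_, hL.2.1⟩
    by_contra! hy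
    exact hE' (escaping_of_abs_le hL.1 hL.2.1 (Or.inl hy))
  · obtain ⟨h1, h2, h3⟩ := h.stepB n hT
    have hE' := hE (n + 1)
    rw [h1, h2, h3] at hL hE'
    refine ⟨?_, hL.2.1, hL.1⟩
    by_contra! hy
    exact hE' (escaping_of_abs_le hL.2.1 hL.1 (Or.inl hy)).swap

theorem max_succ_le (h : TwistOrbit κ T x y z) (hE : ∀ n, ¬ Escaping (x n) (y n) (z n)) (n : ℕ)
    (hL : Large (x n) (y n) (z n)) :
    max |x (n + 1)| |y (n + 1)| ≤ max |x n| |y n| - √κ := by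
  have hE' := hE (n + 1)
  by_cases hT : T n
  · obtain ⟨h1, h2, h3⟩ := h.stepA n hT
    rw [h1, h2, h3] at hE'
    rw [h1, h2]
    exact max_le_sub_sqrt (h.fricke n) hL.1 hL.2.1 hL.2.2 (hE n) hE'
  · obtain ⟨h1, h2, h3⟩ := h.stepB n hT
    rw [h1, h2, h3] at hE'
    rw [h1, h2, max_comm, max_comm |x n|]
    exact max_le_sub_sqrt (h.swap.fricke n) hL.2.1 hL.1 hL.2.2 (fun h => hE n h.swap)
      (fun h => hE' h.swap)

theorem eventually_not_large (h : TwistOrbit κ T x y z) (hκ : 0 < κ)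
    (hE : ∀ n, ¬ Escaping (x n) (y n) (z n)) :
    ∃ n₀, ∀ n ≥ n₀, ¬ Large (x n) (y n) (z n) := by
  have hex : ∃ n, ¬ Large (x n) (y n) (z n) := by
    by_contra! hall
    have hle : ∀ n : ℕ, max |x n| |y n| ≤ max |x 0| |y 0| - n * √κ := by
      intro n
      induction n with
      | zero => simp
      | succ n ih => push_cast; linarith [h.max_succ_le hE n (hall n)]
    obtain ⟨n, hn⟩ := exists_nat_gt (max |x 0| |y 0| / √κ)
    have h1 := (div_lt_iff₀ (Real.sqrt_pos.mpr hκ)).mp hn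
    have h2 := hle n
    have h3 := le_max_left |x n| |y n|
    linarith [abs_nonneg (x n)]
  obtain ⟨n₀, hn₀⟩ := hex
  refine ⟨n₀, fun n hn => ?_⟩
  induction n, hn using Nat.le_induction with
  | base => exact hn₀
  | succ n _ ih => exact fun hL => ih (h.large_of_large_succ hE n hL)

theorem abs_le_of_change (h : TwistOrbit κ T x y z) (hE : ∀ n, ¬ Escaping (x n) (y n) (z n))
    (m : ℕ) (hL : ¬ Large (x m) (y m) (z m)) (hm : ¬ T m) (hm' : T (m + 1)) :
    |x (m + 1)| ≤ 2 + √(4 + κ) := by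
  obtain ⟨h1, h2, h3⟩ := h.stepB m hm
  obtain ⟨h4, h5, h6⟩ := h.stepA (m + 1) hm'
  by_cases hx : |x (m + 1)| ≤ 2
  · linarith [Real.sqrt_nonneg (4 + κ)]
  push Not at hx
  have hy : |y (m + 1)| ≤ 2 := by
    by_contra! hy
    have hxm : |x m| ≤ 2 := by
      by_contra! hxm
      exact hL ⟨hxm, by rwa [← h2], by rwa [← h1]⟩
    have := (escaping_of_abs_le (x := y m) (y := x m) (z := z m) (by rwa [← h2])
      (by rwa [← h1]) (Or.inl hxm)).swap
    rw [← h3, ← h1] at this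
    exact hE (m + 1) (by rwa [h2])
  have hz : |z (m + 1)| ≤ 2 := by
    by_contra! hz
    have := escaping_of_abs_le (x := x (m + 1)) (y := y (m + 1)) (z := z (m + 1)) hx hz (Or.inl hy)
    exact hE (m + 2) (by rwa [h4, h5, h6])
  exact abs_le_of_fricke (h.fricke (m + 1)) hy hz

/-- The trace of the generator along which the `n`-th twist is made. -/
noncomputable def coeff (T : ℕ → Prop) (x y : ℕ → ℝ) (n : ℕ) : ℝ := if T n then x n else y n

theorem eventually_abs_coeff_le (h : TwistOrbit κ T x y z) (hκ : 0 < κ)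
    (hE : ∀ n, ¬ Escaping (x n) (y n) (z n)) (hT : ∀ n, ∃ m ≥ n, ¬ (T m ↔ T (m + 1))) :
    ∃ n₁, ∀ n ≥ n₁, |coeff T x y n| ≤ 2 + √(4 + κ) := by
  obtain ⟨n₀, hn₀⟩ := h.eventually_not_large hκ hE
  have hch : ∀ m ≥ n₀, ¬ (T m ↔ T (m + 1)) → |coeff T x y (m + 1)| ≤ 2 + √(4 + κ) := by
    intro m hm hne
    unfold coeff
    by_cases hT1 : T (m + 1)
    · rw [if_pos hT1]
      exact h.abs_le_of_change hE m (hn₀ m hm) (by tauto) hT1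
    · rw [if_neg hT1]
      refine h.swap.abs_le_of_change (fun n hn => hE n hn.swap) m ?_ (by tauto) hT1
      exact fun hL => hn₀ m hm ⟨hL.2.1, hL.1, hL.2.2⟩
  obtain ⟨m, hm, hne⟩ := hT n₀
  refine ⟨m + 1, fun n hn => ?_⟩
  induction n, hn using Nat.le_induction with
  | base => exact hch m hm hne
  | succ n hmn ih =>
    by_cases hc : T n ↔ T (n + 1)
    · have : coeff T x y (n + 1) = coeff T x y n := by
        unfold coeff
        by_cases hn : T n
        · rw [if_pos hn, if_pos (hc.mp hn), (h.stepA n hn).1]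
        · rw [if_neg hn, if_neg (fun h' => hn (hc.mpr h')), (h.stepB n hn).2.1]
      rwa [this]
    · exact hch n (by omega) hc

theorem abs_z_le (h : TwistOrbit κ T x y z) {R : ℝ} (hR : 2 ≤ R) (n : ℕ)
    (hx : |x n| ≤ R) (hy : |y n| ≤ R) : |z n| ≤ R ^ 2 + √(R ^ 4 + κ) := by
  have hf := h.fricke n
  have hx2 : x n ^ 2 ≤ R ^ 2 := sq_le_sq' (abs_le.mp hx).1 (abs_le.mp hx).2
  have hy2 : y n ^ 2 ≤ R ^ 2 := sq_le_sq' (abs_le.mp hy).1 (abs_le.mp hy).2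
  have h1 : |z n - x n * y n / 2| ≤ √(R ^ 4 + κ) := by
    apply Real.abs_le_sqrt
    have e : (z n - x n * y n / 2) ^ 2 = (x n ^ 2 - 4) * (y n ^ 2 - 4) / 4 + κ := by
      linear_combination hf
    rw [e]
    have ha : |x n ^ 2 - 4| ≤ R ^ 2 := abs_le.mpr ⟨by nlinarith [sq_nonneg (x n)], by linarith⟩
    have hb : |y n ^ 2 - 4| ≤ R ^ 2 := abs_le.mpr ⟨by nlinarith [sq_nonneg (y n)], by linarith⟩
    have hab := mul_le_mul ha hb (abs_nonneg _) (sq_nonneg R)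
    rw [← abs_mul] at hab
    nlinarith [le_abs_self ((x n ^ 2 - 4) * (y n ^ 2 - 4)), sq_nonneg (R ^ 2)]
  have h2 : |x n * y n / 2| ≤ R ^ 2 := by
    rw [abs_div, abs_mul, abs_two]
    nlinarith [abs_nonneg (x n), abs_nonneg (y n)]
  calc |z n| = |(z n - x n * y n / 2) + x n * y n / 2| := by ring_nf
    _ ≤ _ := abs_add_le _ _
    _ ≤ _ := by linarith

/-- Where the direction of the twists changes, both generators have bounded trace. -/
theorem eventually_bounded_at_change (h : TwistOrbit κ T x y z) (hκ : 0 < κ)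
    (hE : ∀ n, ¬ Escaping (x n) (y n) (z n)) (hT : ∀ n, ∃ m ≥ n, ¬ (T m ↔ T (m + 1))) :
    ∃ n₁, ∀ n ≥ n₁, ¬ (T n ↔ T (n + 1)) →
      |x (n + 1)| ≤ 2 + √(4 + κ) ∧ |y (n + 1)| ≤ 2 + √(4 + κ) := by
  obtain ⟨n₁, hn₁⟩ := h.eventually_abs_coeff_le hκ hE hT
  refine ⟨n₁, fun n hn hc => ?_⟩
  have h1 := hn₁ n hn
  have h2 := hn₁ (n + 1) (by omega)
  unfold coeff at h1 h2
  by_cases hn' : T n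
  · rw [if_pos hn'] at h1
    rw [if_neg (by tauto)] at h2
    rw [(h.stepA n hn').1]
    exact ⟨h1, h2⟩
  · rw [if_neg hn'] at h1
    rw [if_pos (by tauto)] at h2
    rw [(h.stepB n hn').2.1]
    exact ⟨h2, h1⟩

end TwistOrbit

/-! ### Lengths under Rauzy induction -/

theorem rauzyStep_of_le {l : ℝ × ℝ} (h : l.2 ≤ l.1) : rauzyStep l = (l.1 - l.2, l.2) := if_pos h

theorem rauzyStep_of_not_le {l : ℝ × ℝ} (h : ¬ l.2 ≤ l.1) : rauzyStep l = (l.1, l.2 - l.1) :=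
  if_neg h

/-- The `n`-th twist is made along `a`. -/
def IsTwistA (θ : Circle) (n : ℕ) : Prop := (rauzyLengths θ n).2 ≤ (rauzyLengths θ n).1

theorem rauzyLengths_succ (θ : Circle) (n : ℕ) :
    rauzyLengths θ (n + 1) = rauzyStep (rauzyLengths θ n) :=
  Function.iterate_succ_apply' _ _ _

theorem rauzyLengths_succ_of_isTwistA {θ : Circle} {n : ℕ} (h : IsTwistA θ n) :
    rauzyLengths θ (n + 1) =
      ((rauzyLengths θ n).1 - (rauzyLengths θ n).2, (rauzyLengths θ n).2) := by
  rw [rauzyLengths_succ, rauzyStep_of_le h]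

theorem rauzyLengths_succ_of_not {θ : Circle} {n : ℕ} (h : ¬ IsTwistA θ n) :
    rauzyLengths θ (n + 1) =
      ((rauzyLengths θ n).1, (rauzyLengths θ n).2 - (rauzyLengths θ n).1) := by
  rw [rauzyLengths_succ, rauzyStep_of_not_le h]

theorem rauzyLengths_nonneg_pos (θ : Circle) (n : ℕ) :
    0 ≤ (rauzyLengths θ n).1 ∧ 0 ≤ (rauzyLengths θ n).2 ∧
      0 < (rauzyLengths θ n).1 + (rauzyLengths θ n).2 := by
  induction n with
  | zero => exact ⟨abs_nonneg _, abs_nonneg _, circle_abs_add_pos θ⟩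
  | succ n ih =>
    obtain ⟨h1, h2, h3⟩ := ih
    by_cases h : IsTwistA θ n
    · have h' := h
      rw [IsTwistA] at h'
      rw [rauzyLengths_succ_of_isTwistA h]
      exact ⟨by simp only; linarith, h2, by simp only; linarith⟩
    · have h' := h
      rw [IsTwistA] at h'
      rw [rauzyLengths_succ_of_not h]
      exact ⟨h1, by simp only; linarith, by simp only; linarith⟩

/-- If the direction of the twists changes infinitely often, the total length at time `n` is
smaller than any multiple of `1 / n`, infinitely often. -/
theorem exists_mul_length_le (θ : Circle) (hT : ∀ n, ∃ m ≥ n, ¬ (IsTwistA θ m ↔ IsTwistA θ (m + 1)))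
    {ε : ℝ} (hε : 0 < ε) (n₀ : ℕ) :
    ∃ n ≥ n₀, (n : ℝ) * ((rauzyLengths θ n).1 + (rauzyLengths θ n).2) ≤ ε := by
  set L : ℕ → ℝ := fun n => (rauzyLengths θ n).1 + (rauzyLengths θ n).2 with hL
  set μ : ℕ → ℝ := fun n => min (rauzyLengths θ n).1 (rauzyLengths θ n).2 with hμ
  have hμ0 : ∀ n, 0 ≤ μ n := fun n =>
    le_min (rauzyLengths_nonneg_pos θ n).1 (rauzyLengths_nonneg_pos θ n).2.1
  have hstep : ∀ n, L (n + 1) = L n - μ n ∧ μ (n + 1) ≤ μ n ∧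
      (¬ (IsTwistA θ n ↔ IsTwistA θ (n + 1)) → L (n + 1) ≤ 2 * μ n) := by
    intro n
    simp only [hL, hμ]
    by_cases h : IsTwistA θ n
    · have h' := h
      rw [IsTwistA] at h'
      have e := rauzyLengths_succ_of_isTwistA h
      refine ⟨?_, ?_, ?_⟩
      · rw [e, min_eq_right h']; ring
      · rw [e, min_eq_right h']; exact min_le_right _ _
      · intro hc
        have h'' : ¬ IsTwistA θ (n + 1) := by tauto
        rw [IsTwistA, e] at h''
        rw [e, min_eq_right h']
        simp only at h'' ⊢
        linarith
    · have h' := h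
      rw [IsTwistA] at h'
      have e := rauzyLengths_succ_of_not h
      refine ⟨?_, ?_, ?_⟩
      · rw [e, min_eq_left (by linarith)]; ring
      · rw [e, min_eq_left (b := (rauzyLengths θ n).2) (by linarith)]; exact min_le_left _ _
      · intro hc
        have h'' : IsTwistA θ (n + 1) := by tauto
        rw [IsTwistA, e] at h''
        rw [e, min_eq_left (by linarith)]
        simp only at h'' ⊢
        linarith
  have hμanti : Antitone μ := antitone_nat_of_succ_le fun n => (hstep n).2.1
  have hLanti : Antitone L := antitone_nat_of_succ_le fun n => by
    rw [(hstep n).1]; linarith [hμ0 n]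
  have hsum : ∀ m j : ℕ, (j : ℝ) * μ (m + j) ≤ L m - L (m + j) := by
    intro m j
    induction j with
    | zero => simp
    | succ j ih =>
      have h1 := hstep (m + j)
      have h2 : (j : ℝ) * μ (m + (j + 1)) ≤ j * μ (m + j) :=
        mul_le_mul_of_nonneg_left h1.2.1 (Nat.cast_nonneg _)
      have h3 := h1.2.1
      have h4 := h1.1
      rw [← add_assoc] at *
      push_cast
      linarith
  have hbdd : BddBelow (Set.range L) := ⟨0, by
    rintro _ ⟨n, rfl⟩; exact (rauzyLengths_nonneg_pos θ n).2.2.le⟩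
  have hlim := tendsto_atTop_ciInf hLanti hbdd
  obtain ⟨m, hm⟩ := (hlim.eventually (gt_mem_nhds (show iInf L < iInf L + ε / 8 by linarith))).exists
  obtain ⟨n, hn, hc⟩ := hT (n₀ + 2 * m + 1)
  refine ⟨n + 1, by omega, ?_⟩
  have h1 := hsum m (n - m)
  rw [show m + (n - m) = n by omega, Nat.cast_sub (by omega)] at h1
  have h2 := ciInf_le hbdd n
  have h3 := (hstep n).2.2 hc
  have h4 : (n₀ : ℝ) + 2 * m + 1 ≤ n := by exact_mod_cast hn
  have h5 : (0 : ℝ) ≤ n₀ := Nat.cast_nonneg _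
  have h6 : (0 : ℝ) ≤ m := Nat.cast_nonneg _
  have h7 := hμ0 n
  have h8 : ((n : ℝ) - m) * μ n ≤ ε / 8 := by linarith
  have h9 : ((n : ℝ) + 1) * μ n ≤ 4 * (((n : ℝ) - m) * μ n) := by
    rw [← mul_assoc]
    exact mul_le_mul_of_nonneg_right (by linarith) h7
  push_cast
  have h10 : ((n : ℝ) + 1) * L (n + 1) ≤ ((n : ℝ) + 1) * (2 * μ n) :=
    mul_le_mul_of_nonneg_left h3 (by linarith)
  linarith

/-! ### Rauzy induction and continued fractions -/

theorem rauzyStep_iterate {L β : ℝ} (hL : 0 < L) (j : ℕ) (hj : j * β ≤ 1) (hβ : 0 < β) :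
    rauzyStep^[j] (L, β * L) = (L - j * (β * L), β * L) := by
  induction j with
  | zero => simp
  | succ j ih =>
    push_cast at hj
    rw [Function.iterate_succ_apply', ih (by nlinarith), rauzyStep_of_le]
    · push_cast; ext <;> simp only; ring
    · simp only; nlinarith

theorem rauzyStep_iterate' {L β : ℝ} (hL : 0 < L) (j : ℕ) (hj : j * β < 1) (hβ : 0 < β) :
    rauzyStep^[j] (β * L, L) = (β * L, L - j * (β * L)) := by
  induction j with
  | zero => simp
  | succ j ih =>
    push_cast at hj
    rw [Function.iterate_succ_apply', ih (by nlinarith), rauzyStep_of_not_le]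
    · push_cast; ext <;> simp only; ring
    · simp only; nlinarith

/-- The iterates of the Gauss map. -/
noncomputable def gaussIter (α : ℝ) (n : ℕ) : ℝ := (fun x : ℝ => Int.fract x⁻¹)^[n] α

theorem gaussIter_succ (α : ℝ) (n : ℕ) : gaussIter α (n + 1) = Int.fract (gaussIter α n)⁻¹ :=
  Function.iterate_succ_apply' _ _ _

theorem gaussIter_mem {α : ℝ} (hα : Irrational α) (h0 : 0 < α) (h1 : α < 1) (n : ℕ) :
    Irrational (gaussIter α n) ∧ 0 < gaussIter α n ∧ gaussIter α n < 1 := by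
  induction n with
  | zero => exact ⟨hα, h0, h1⟩
  | succ n ih =>
    rw [gaussIter_succ]
    have hirr : Irrational (Int.fract (gaussIter α n)⁻¹) := by
      rw [Int.fract]; exact ih.1.inv.sub_intCast _
    exact ⟨hirr, lt_of_le_of_ne (Int.fract_nonneg _) hirr.ne_zero.symm, Int.fract_lt_one _⟩

theorem cfDigit_spec {α : ℝ} (hα : Irrational α) (h0 : 0 < α) (h1 : α < 1) (n : ℕ) :
    0 < cfDigit α n ∧ cfDigit α n * gaussIter α n < 1 ∧
      gaussIter α n * gaussIter α (n + 1) = 1 - cfDigit α n * gaussIter α n := by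
  obtain ⟨hirr, hpos, hlt⟩ := gaussIter_mem hα h0 h1 n
  have hd : cfDigit α n = ⌊(gaussIter α n)⁻¹⌋₊ := rfl
  have hinv : 1 < (gaussIter α n)⁻¹ := (one_lt_inv₀ hpos).mpr hlt
  have hfl : ((cfDigit α n : ℕ) : ℝ) = (⌊(gaussIter α n)⁻¹⌋ : ℝ) := by
    rw [hd, ← Int.natCast_floor_eq_floor (by linarith)]; simp
  have e : gaussIter α n * gaussIter α (n + 1) = 1 - cfDigit α n * gaussIter α n := by
    rw [gaussIter_succ, Int.fract, hfl]; field_simp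
  refine ⟨?_, ?_, e⟩
  · rw [hd]; exact Nat.floor_pos.mpr hinv.le
  · have := mul_pos hpos (gaussIter_mem hα h0 h1 (n + 1)).2.1
    linarith

theorem accelTime_succ (α : ℝ) (n : ℕ) : accelTime α (n + 1) = accelTime α n + cfDigit α n :=
  Finset.sum_range_succ _ _

theorem rauzyStep_accelTime {α S : ℝ} (hα : Irrational α) (h0 : 0 < α) (h1 : α < 1) (hS : 0 < S)
    (m : ℕ) : ∃ L : ℝ, 0 < L ∧ rauzyStep^[accelTime α m] (S, α * S) =
      if Even m then (L, gaussIter α m * L) else (gaussIter α m * L, L) := by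
  induction m with
  | zero => exact ⟨S, hS, by simp [accelTime, gaussIter]⟩
  | succ m ih =>
    obtain ⟨L, hL, e⟩ := ih
    obtain ⟨-, hlt, hmul⟩ := cfDigit_spec hα h0 h1 m
    obtain ⟨-, hpos, -⟩ := gaussIter_mem hα h0 h1 m
    refine ⟨gaussIter α m * L, mul_pos hpos hL, ?_⟩
    have e2 : gaussIter α (m + 1) * (gaussIter α m * L) =
        L - cfDigit α m * (gaussIter α m * L) := by linear_combination L * hmul
    rw [accelTime_succ, add_comm, Function.iterate_add_apply, e, e2]
    by_cases hm : Even m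
    · rw [if_pos hm, if_neg (by simpa [Nat.even_add_one] using hm),
        rauzyStep_iterate hL _ hlt.le hpos]
    · rw [if_neg hm, if_pos (by simpa [Nat.even_add_one] using hm),
        rauzyStep_iterate' hL _ hlt hpos]

theorem rauzyStep_type {α S : ℝ} (hα : Irrational α) (h0 : 0 < α) (h1 : α < 1) (hS : 0 < S)
    (m j : ℕ) (hj : j < cfDigit α m) :
    (rauzyStep^[accelTime α m + j] (S, α * S)).2 ≤ (rauzyStep^[accelTime α m + j] (S, α * S)).1 ↔
      Even m := by
  obtain ⟨L, hL, e⟩ := rauzyStep_accelTime hα h0 h1 hS m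
  obtain ⟨-, hlt, -⟩ := cfDigit_spec hα h0 h1 m
  obtain ⟨-, hpos, -⟩ := gaussIter_mem hα h0 h1 m
  have hj1 : ((j : ℝ) + 1) * gaussIter α m < 1 := by
    have : ((j : ℝ) + 1) ≤ cfDigit α m := by exact_mod_cast hj
    nlinarith
  rw [add_comm, Function.iterate_add_apply, e]
  by_cases hm : Even m
  · rw [if_pos hm, rauzyStep_iterate hL _ (by nlinarith) hpos]
    simp only [hm, iff_true]
    nlinarith
  · rw [if_neg hm, rauzyStep_iterate' hL _ (by nlinarith) hpos]
    simp only [hm, iff_false]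
    nlinarith

theorem rotationAngle_mem {θ : Circle} (h : Irrational (rotationAngle θ)) :
    0 < rotationAngle θ ∧ rotationAngle θ < 1 := by
  have hs := circle_abs_add_pos θ
  have h0 : 0 ≤ rotationAngle θ := div_nonneg (abs_nonneg _) hs.le
  have h1 : rotationAngle θ ≤ 1 :=
    (div_le_one hs).mpr (le_add_of_nonneg_left (abs_nonneg _))
  exact ⟨lt_of_le_of_ne h0 h.ne_zero.symm, lt_of_le_of_ne h1 h.ne_one⟩

theorem rauzyLengths_eq_iterate (θ : Circle) (n : ℕ) :
    rauzyLengths θ n = rauzyStep^[n + 1] (|(θ : ℂ).re| + |(θ : ℂ).im|,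
      rotationAngle θ * (|(θ : ℂ).re| + |(θ : ℂ).im|)) := by
  have e : rotationAngle θ * (|(θ : ℂ).re| + |(θ : ℂ).im|) = |(θ : ℂ).im| :=
    div_mul_cancel₀ _ (circle_abs_add_pos θ).ne'
  rw [Function.iterate_succ_apply, rauzyStep_of_le, e]
  · simp [rauzyLengths]
  · rw [e]; simp

theorem isTwistA_iff_even {θ : Circle} (h : Irrational (rotationAngle θ)) {m n : ℕ}
    (h1 : accelTime (rotationAngle θ) m ≤ n + 1) (h2 : n + 1 < accelTime (rotationAngle θ) (m + 1)) :
    IsTwistA θ n ↔ Even m := by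
  obtain ⟨j, hj⟩ := Nat.exists_eq_add_of_le h1
  rw [IsTwistA, rauzyLengths_eq_iterate, hj]
  rw [accelTime_succ] at h2
  exact rauzyStep_type h (rotationAngle_mem h).1 (rotationAngle_mem h).2 (circle_abs_add_pos θ) m j
    (by omega)

theorem cfDigit_pos {θ : Circle} (h : Irrational (rotationAngle θ)) (m : ℕ) :
    0 < cfDigit (rotationAngle θ) m :=
  (cfDigit_spec h (rotationAngle_mem h).1 (rotationAngle_mem h).2 m).1

theorem le_accelTime {θ : Circle} (h : Irrational (rotationAngle θ)) (m : ℕ) :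
    m ≤ accelTime (rotationAngle θ) m := by
  induction m with
  | zero => exact Nat.zero_le _
  | succ m ih =>
    rw [accelTime_succ]
    have := cfDigit_pos h m
    omega

/-- The direction of the twists changes just before the acceleration times. -/
theorem not_isTwistA_iff_of_accelTime {θ : Circle} (h : Irrational (rotationAngle θ)) {m n : ℕ}
    (hn : accelTime (rotationAngle θ) (m + 1) = n + 2) :
    ¬ (IsTwistA θ n ↔ IsTwistA θ (n + 1)) := by
  have h1 := accelTime_succ (rotationAngle θ) m
  have h2 := accelTime_succ (rotationAngle θ) (m + 1)
  have h3 := cfDigit_pos h m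
  have h4 := cfDigit_pos h (m + 1)
  rw [isTwistA_iff_even h (m := m) (by omega) (by omega),
    isTwistA_iff_even h (m := m + 1) (by omega) (by omega), Nat.even_add_one]
  tauto

theorem exists_change {θ : Circle} (h : Irrational (rotationAngle θ)) (n : ℕ) :
    ∃ m ≥ n, ¬ (IsTwistA θ m ↔ IsTwistA θ (m + 1)) := by
  have h1 := le_accelTime h (n + 1 + 1)
  obtain ⟨j, hj⟩ := Nat.exists_eq_add_of_le
    (show 2 ≤ accelTime (rotationAngle θ) (n + 1 + 1) by omega)
  exact ⟨j, by omega, not_isTwistA_iff_of_accelTime h (m := n + 1) (by omega)⟩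

/-- The word lengths of the two generators in terms of the original ones. -/
noncomputable def wordLength (θ : Circle) : ℕ → ℕ × ℕ
  | 0 => (1, 1)
  | n + 1 => if IsTwistA θ n then ((wordLength θ n).1, (wordLength θ n).1 + (wordLength θ n).2)
      else ((wordLength θ n).1 + (wordLength θ n).2, (wordLength θ n).2)

/-- The denominators of the convergents, starting with `q₋₁ = 0`. -/
noncomputable def cfDenomPred (α : ℝ) : ℕ → ℕ
  | 0 => 0
  | n + 1 => cfDenom α n

theorem cfDenom_succ (α : ℝ) (n : ℕ) :
    cfDenom α (n + 1) = cfDigit α n * cfDenom α n + cfDenomPred α n := by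
  cases n with
  | zero => simp [cfDenom, cfDenomPred]
  | succ n => rfl

theorem wordLength_of_accelTime {θ : Circle} (h : Irrational (rotationAngle θ)) (m j n : ℕ)
    (hj : j < cfDigit (rotationAngle θ) m) (hn : accelTime (rotationAngle θ) m + j = n) :
    wordLength θ n = if Even m then (cfDenom (rotationAngle θ) m,
        cfDenomPred (rotationAngle θ) m + (j + 1) * cfDenom (rotationAngle θ) m)
      else (cfDenomPred (rotationAngle θ) m + (j + 1) * cfDenom (rotationAngle θ) m,
        cfDenom (rotationAngle θ) m) := by
  induction m generalizing j n with
  | zero =>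
    simp only [Even.zero, if_true]
    induction j generalizing n with
    | zero =>
      have : n = 0 := by rw [← hn]; simp [accelTime]
      subst this
      simp [wordLength, cfDenom, cfDenomPred]
    | succ j ihj =>
      obtain ⟨n, rfl⟩ : ∃ n', n = n' + 1 := ⟨accelTime (rotationAngle θ) 0 + j, by omega⟩
      have hA : IsTwistA θ n := (isTwistA_iff_even h (m := 0) (by omega)
        (by rw [accelTime_succ]; omega)).mpr Even.zero
      rw [wordLength, if_pos hA, ihj n (by omega) (by omega)]
      ext <;> simp only; ring
  | succ m ihm =>
    have hd := cfDigit_pos h m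
    have hs := accelTime_succ (rotationAngle θ) m
    have hpar : Even (m + 1) ↔ ¬ Even m := Nat.even_add_one
    have hstep : ∀ n', n = n' + 1 → (IsTwistA θ n' ↔ Even (m + 1)) := fun n' hn' =>
      isTwistA_iff_even h (by omega) (by rw [accelTime_succ]; omega)
    induction j generalizing n with
    | zero =>
      obtain ⟨n, rfl⟩ : ∃ n', n = n' + 1 := ⟨accelTime (rotationAngle θ) (m + 1) - 1, by omega⟩
      have hA := hstep n rfl
      have ih := ihm (cfDigit (rotationAngle θ) m - 1) n (by omega) (by omega)
      rw [Nat.sub_add_cancel hd, add_comm, ← cfDenom_succ] at ih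
      rw [wordLength, ih]
      by_cases hm : Even m
      · rw [if_pos hm, if_neg (by tauto), if_neg (by tauto)]
        ext <;> simp only [cfDenomPred]; ring
      · rw [if_neg hm, if_pos (by tauto), if_pos (by tauto)]
        ext <;> simp only [cfDenomPred]; ring
    | succ j ihj =>
      obtain ⟨n, rfl⟩ : ∃ n', n = n' + 1 :=
        ⟨accelTime (rotationAngle θ) (m + 1) + j, by omega⟩
      have hA := hstep n rfl
      have ih := ihj n (by omega) (by omega) fun n' hn' =>
        isTwistA_iff_even h (by omega) (by rw [accelTime_succ]; omega)
      rw [wordLength, ih]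
      by_cases hm : Even m
      · rw [if_neg (by tauto), if_neg (by tauto), if_neg (by tauto)]
        ext <;> simp only; ring
      · rw [if_pos (by tauto), if_pos (by tauto), if_pos (by tauto)]
        ext <;> simp only; ring

theorem cfDenom_le_wordLength {θ : Circle} (h : Irrational (rotationAngle θ)) (m : ℕ) :
    cfDenom (rotationAngle θ) m ≤ max (wordLength θ (accelTime (rotationAngle θ) m)).1
      (wordLength θ (accelTime (rotationAngle θ) m)).2 := by
  rw [wordLength_of_accelTime h m 0 (accelTime (rotationAngle θ) m) (cfDigit_pos h m)
    (add_zero _)]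
  split_ifs
  · exact le_max_left _ _
  · exact le_max_right _ _

/-! ### Positive configurations -/

theorem trace_eq_of_mul_eq_mul {M P N : Matrix (Fin 2) (Fin 2) ℝ} (hP : P.det ≠ 0)
    (h : M * P = P * N) : M.trace = N.trace := by
  have hu : IsUnit P.det := isUnit_iff_ne_zero.mpr hP
  have e : M = P * N * P⁻¹ := by
    rw [← h, Matrix.mul_assoc, Matrix.mul_nonsing_inv _ hu, Matrix.mul_one]
  rw [e, Matrix.trace_mul_comm, ← Matrix.mul_assoc, Matrix.nonsing_inv_mul _ hu, Matrix.one_mul]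

/-- Up to sign, `M` is nonnegative in the basis given by the columns of `P`, and the permanent of
its matrix is at least `τ`. -/
def Grows (P : Matrix (Fin 2) (Fin 2) ℝ) (τ : ℝ) (M : SL(2, ℝ)) : Prop :=
  ∃ N : Matrix (Fin 2) (Fin 2) ℝ, (∀ i j, 0 ≤ N i j) ∧ τ ≤ N 0 0 * N 1 1 + N 0 1 * N 1 0 ∧
    ((M : Matrix (Fin 2) (Fin 2) ℝ) * P = P * N ∨ (M : Matrix (Fin 2) (Fin 2) ℝ) * P = -(P * N))

namespace Grows

variable {P : Matrix (Fin 2) (Fin 2) ℝ} {τ τ' : ℝ} {M M' : SL(2, ℝ)}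

theorem mono (h : Grows P τ M) (hle : τ' ≤ τ) : Grows P τ' M := by
  obtain ⟨N, h1, h2, h3⟩ := h
  exact ⟨N, h1, hle.trans h2, h3⟩

theorem one (P : Matrix (Fin 2) (Fin 2) ℝ) : Grows P 1 1 :=
  ⟨1, fun i j => by fin_cases i <;> fin_cases j <;> simp, by simp, Or.inl (by simp)⟩

theorem neg (h : Grows P τ M) : Grows P τ (-M) := by
  obtain ⟨N, h1, h2, h3⟩ := h
  refine ⟨N, h1, h2, ?_⟩
  rw [Matrix.SpecialLinearGroup.coe_neg, neg_mul]
  rcases h3 with h3 | h3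
  · exact Or.inr (by rw [h3])
  · exact Or.inl (by rw [h3, neg_neg])

theorem mul (h : Grows P τ M) (h' : Grows P τ' M') (hτ' : 0 ≤ τ') :
    Grows P (τ * τ') (M * M') := by
  obtain ⟨N, h1, h2, h3⟩ := h
  obtain ⟨N', h1', h2', h3'⟩ := h'
  refine ⟨N * N', fun i j => ?_, ?_, ?_⟩
  · rw [Matrix.mul_apply]
    exact Finset.sum_nonneg fun k _ => mul_nonneg (h1 i k) (h1' k j)
  · have hN : 0 ≤ N 0 0 * N 1 1 + N 0 1 * N 1 0 :=
      add_nonneg (mul_nonneg (h1 _ _) (h1 _ _)) (mul_nonneg (h1 _ _) (h1 _ _))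
    refine (mul_le_mul h2 h2' hτ' hN).trans ?_
    simp only [Matrix.mul_apply, Fin.sum_univ_two]
    have e1 := mul_nonneg (mul_nonneg (h1 0 0) (h1 1 0)) (mul_nonneg (h1' 0 0) (h1' 0 1))
    have e2 := mul_nonneg (mul_nonneg (h1 0 1) (h1 1 1)) (mul_nonneg (h1' 1 0) (h1' 1 1))
    linarith
  · have e : ((M * M' : SL(2, ℝ)) : Matrix (Fin 2) (Fin 2) ℝ) * P =
        (M : Matrix (Fin 2) (Fin 2) ℝ) * ((M' : Matrix (Fin 2) (Fin 2) ℝ) * P) := by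
      rw [Matrix.SpecialLinearGroup.coe_mul, Matrix.mul_assoc]
    rw [e, ← Matrix.mul_assoc P]
    rcases h3 with h3 | h3 <;> rcases h3' with h3' | h3' <;>
      simp [h3', ← Matrix.mul_assoc, h3]

theorem le_tr_sq (hP : P.det ≠ 0) (h : Grows P τ M) : τ ≤ tr M ^ 2 := by
  obtain ⟨N, h1, h2, h3⟩ := h
  have key : N.det = 1 ∧ tr M ^ 2 = (N 0 0 + N 1 1) ^ 2 := by
    have hconj : ∀ N' : Matrix (Fin 2) (Fin 2) ℝ, (M : Matrix (Fin 2) (Fin 2) ℝ) * P = P * N' →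
        N'.det = 1 ∧ tr M = N'.trace := by
      intro N' h'
      constructor
      · have := congrArg Matrix.det h'
        rw [Matrix.det_mul, Matrix.det_mul, M.det_coe, one_mul] at this
        exact mul_left_cancel₀ hP (by rw [← this, mul_one])
      · exact trace_eq_of_mul_eq_mul hP h'
    rcases h3 with h3 | h3
    · obtain ⟨h4, h5⟩ := hconj N h3
      exact ⟨h4, by rw [h5, Matrix.trace_fin_two]⟩
    · obtain ⟨h4, h5⟩ := hconj (-N) (by rw [h3, Matrix.mul_neg])
      refine ⟨?_, ?_⟩
      · rw [Matrix.det_fin_two] at h4 ⊢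
        simpa using h4
      · rw [h5, Matrix.trace_fin_two]; simp only [Matrix.neg_apply]; ring
  rw [key.2]
  have hd := key.1
  rw [Matrix.det_fin_two] at hd
  nlinarith [mul_nonneg (h1 0 0) (h1 1 1), sq_nonneg (N 0 0 - N 1 1)]

end Grows

theorem exists_add_inv_eq {x : ℝ} (hx : 2 < x) : ∃ t : ℝ, 1 < t ∧ t + t⁻¹ = x := by
  have hs : 0 < √(x ^ 2 - 4) := Real.sqrt_pos.mpr (by nlinarith)
  have hsq : √(x ^ 2 - 4) ^ 2 = x ^ 2 - 4 := Real.sq_sqrt (by nlinarith)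
  refine ⟨(x + √(x ^ 2 - 4)) / 2, by linarith, ?_⟩
  have hne : x + √(x ^ 2 - 4) ≠ 0 := by linarith
  field_simp
  linear_combination hsq

theorem exists_eigenvector_of_char {a b c d w : ℝ} (h : w ^ 2 + (a * d - b * c) = w * (a + d)) :
    ∃ e₀ e₁ : ℝ, (e₀ ≠ 0 ∨ e₁ ≠ 0) ∧ a * e₀ + b * e₁ = w * e₀ ∧ c * e₀ + d * e₁ = w * e₁ := by
  by_cases hb : b = 0
  · by_cases hc : w = d
    · exact ⟨0, 1, Or.inr one_ne_zero, by rw [hb]; ring, by rw [hc]; ring⟩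
    · refine ⟨w - d, c, Or.inl (sub_ne_zero.mpr hc), ?_, by ring⟩
      linear_combination -h
  · refine ⟨b, w - a, Or.inl hb, by ring, ?_⟩
    linear_combination -h

theorem exists_eigenvector (A : SL(2, ℝ)) {t : ℝ} (ht : t ≠ 0) (h : t + t⁻¹ = tr A) :
    ∃ e₀ e₁ : ℝ, (e₀ ≠ 0 ∨ e₁ ≠ 0) ∧ A 0 0 * e₀ + A 0 1 * e₁ = t * e₀ ∧
      A 1 0 * e₀ + A 1 1 * e₁ = t * e₁ := by
  refine exists_eigenvector_of_char ?_
  rw [det_eq, ← tr_eq, ← h]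
  field_simp

theorem sq_add_one_of_eigenvector (M : SL(2, ℝ)) {w e₀ e₁ : ℝ} (he : e₀ ≠ 0 ∨ e₁ ≠ 0)
    (h0 : M 0 0 * e₀ + M 0 1 * e₁ = w * e₀) (h1 : M 1 0 * e₀ + M 1 1 * e₁ = w * e₁) :
    w ^ 2 + 1 = w * tr M := by
  have hd := det_eq M
  rw [tr_eq]
  rcases he with he | he
  · apply mul_right_cancel₀ he
    linear_combination (M 1 1 - w) * h0 - M 0 1 * h1 - e₀ * hd
  · apply mul_right_cancel₀ he
    linear_combination (M 0 0 - w) * h1 - M 1 0 * h0 - e₁ * hd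

theorem exists_grows_of_eigenvectors (A B : SL(2, ℝ)) {t u e₀ e₁ f₀ f₁ : ℝ} (ht : 1 < t)
    (hu : 1 < u) (htA : t + t⁻¹ = tr A) (huB : u + u⁻¹ = tr B)
    (hz : t * u⁻¹ + u * t⁻¹ < tr (B * A)) (hΔ : e₀ * f₁ - e₁ * f₀ ≠ 0)
    (hA0 : A 0 0 * e₀ + A 0 1 * e₁ = t * e₀) (hA1 : A 1 0 * e₀ + A 1 1 * e₁ = t * e₁)
    (hB0 : B 0 0 * f₀ + B 0 1 * f₁ = u * f₀) (hB1 : B 1 0 * f₀ + B 1 1 * f₁ = u * f₁)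
    (hs : 0 ≤ ((A 0 0 * f₀ + A 0 1 * f₁) * f₁ - (A 1 0 * f₀ + A 1 1 * f₁) * f₀) /
      (e₀ * f₁ - e₁ * f₀)) :
    ∃ (P : Matrix (Fin 2) (Fin 2) ℝ) (η : ℝ), P.det ≠ 0 ∧ 1 < η ∧ Grows P 1 A ∧ Grows P 1 B ∧
      Grows P η (B * A) := by
  set Δ := e₀ * f₁ - e₁ * f₀ with hΔdef
  set s := ((A 0 0 * f₀ + A 0 1 * f₁) * f₁ - (A 1 0 * f₀ + A 1 1 * f₁) * f₀) / Δ with hsdef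
  set r := (e₀ * (B 1 0 * e₀ + B 1 1 * e₁) - e₁ * (B 0 0 * e₀ + B 0 1 * e₁)) / Δ with hrdef
  have hsΔ : s * Δ = (A 0 0 * f₀ + A 0 1 * f₁) * f₁ - (A 1 0 * f₀ + A 1 1 * f₁) * f₀ :=
    div_mul_cancel₀ _ hΔ
  have hrΔ : r * Δ = e₀ * (B 1 0 * e₀ + B 1 1 * e₁) - e₁ * (B 0 0 * e₀ + B 0 1 * e₁) :=
    div_mul_cancel₀ _ hΔ
  rw [tr_eq] at htA huB
  have hAf0 : A 0 0 * f₀ + A 0 1 * f₁ = s * e₀ + t⁻¹ * f₀ := by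
    apply mul_right_cancel₀ hΔ
    linear_combination (-e₀) * hsΔ - f₀ * Δ * htA - f₀ * f₁ * hA0 + f₀ * f₀ * hA1
  have hAf1 : A 1 0 * f₀ + A 1 1 * f₁ = s * e₁ + t⁻¹ * f₁ := by
    apply mul_right_cancel₀ hΔ
    linear_combination (-e₁) * hsΔ - f₁ * Δ * htA - f₁ * f₁ * hA0 + f₀ * f₁ * hA1
  have hBe0 : B 0 0 * e₀ + B 0 1 * e₁ = u⁻¹ * e₀ + r * f₀ := by
    apply mul_right_cancel₀ hΔ
    linear_combination (-f₀) * hrΔ - e₀ * Δ * huB + e₀ * e₁ * hB0 - e₀ * e₀ * hB1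
  have hBe1 : B 1 0 * e₀ + B 1 1 * e₁ = u⁻¹ * e₁ + r * f₁ := by
    apply mul_right_cancel₀ hΔ
    linear_combination (-f₁) * hrΔ - e₁ * Δ * huB + e₁ * e₁ * hB0 - e₀ * e₁ * hB1
  have ht0 : 0 < t⁻¹ := by positivity
  have hu0 : 0 < u⁻¹ := by positivity
  have htt : t * t⁻¹ = 1 := mul_inv_cancel₀ (by positivity)
  have huu : u * u⁻¹ = 1 := mul_inv_cancel₀ (by positivity)
  let P : Matrix (Fin 2) (Fin 2) ℝ := !![e₀, f₀; e₁, f₁]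
  have hAP : (A : Matrix (Fin 2) (Fin 2) ℝ) * P = P * !![t, s; 0, t⁻¹] := by
    ext i j
    fin_cases i <;> fin_cases j <;>
      simp [P, Matrix.mul_apply, Fin.sum_univ_two] <;> linarith
  have hBP : (B : Matrix (Fin 2) (Fin 2) ℝ) * P = P * !![u⁻¹, 0; r, u] := by
    ext i j
    fin_cases i <;> fin_cases j <;>
      simp [P, Matrix.mul_apply, Fin.sum_univ_two] <;> linarith
  have hBAP : ((B * A : SL(2, ℝ)) : Matrix (Fin 2) (Fin 2) ℝ) * P =
      P * (!![u⁻¹, 0; r, u] * !![t, s; 0, t⁻¹]) := by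
    rw [Matrix.SpecialLinearGroup.coe_mul, Matrix.mul_assoc, hAP, ← Matrix.mul_assoc, hBP,
      Matrix.mul_assoc]
  have hP : P.det ≠ 0 := by
    rw [Matrix.det_fin_two]; simp only [P]; simpa [mul_comm f₀] using hΔ
  have hrs : r * s = tr (B * A) - (t * u⁻¹ + u * t⁻¹) := by
    have := trace_eq_of_mul_eq_mul hP hBAP
    rw [tr, this]
    simp [Matrix.trace_fin_two]
    ring
  have hrs0 : 0 < r * s := by linarith
  have hs0 : 0 < s := lt_of_le_of_ne hs fun h => by rw [← h] at hrs0; simp at hrs0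
  have hr0 : 0 < r := (pos_iff_pos_of_mul_pos hrs0).mpr hs0
  refine ⟨P, 1 + 2 * (r * s * t * u⁻¹), hP, ?_, ?_, ?_, ?_⟩
  · have : 0 < r * s * t * u⁻¹ := by positivity
    linarith
  · refine ⟨_, ?_, ?_, Or.inl hAP⟩
    · intro i j; fin_cases i <;> fin_cases j <;> simp <;> linarith
    · simp [htt]
  · refine ⟨_, ?_, ?_, Or.inl hBP⟩
    · intro i j; fin_cases i <;> fin_cases j <;> simp <;> linarith
    · simp; rw [mul_comm, huu]
  · refine ⟨_, ?_, ?_, Or.inl hBAP⟩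
    · intro i j
      fin_cases i <;> fin_cases j <;> simp [Matrix.mul_apply, Fin.sum_univ_two] <;> positivity
    · simp [Matrix.mul_apply, Fin.sum_univ_two]
      apply le_of_eq
      linear_combination (-u * u⁻¹) * htt - huu

theorem exists_grows_of_two_lt (A B : SL(2, ℝ)) (hc : tr (A * B * A⁻¹ * B⁻¹) ≠ 2)
    (hx : 2 < tr A) (hy : 2 < tr B)
    (hz : max (tr A) (tr B) ≤ tr (B * A) ∨ tr (A * B * A⁻¹ * B⁻¹) < 2) :
    ∃ (P : Matrix (Fin 2) (Fin 2) ℝ) (η : ℝ), P.det ≠ 0 ∧ 1 < η ∧ Grows P 1 A ∧ Grows P 1 B ∧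
      Grows P η (B * A) := by
  obtain ⟨t, ht, htA⟩ := exists_add_inv_eq hx
  obtain ⟨u, hu, huB⟩ := exists_add_inv_eq hy
  have ht0 : 0 < t⁻¹ := by positivity
  have hu0 : 0 < u⁻¹ := by positivity
  have htt : t * t⁻¹ = 1 := mul_inv_cancel₀ (by positivity)
  have huu : u * u⁻¹ = 1 := mul_inv_cancel₀ (by positivity)
  have ht1 : t⁻¹ < 1 := inv_lt_one_of_one_lt₀ ht
  have hu1 : u⁻¹ < 1 := inv_lt_one_of_one_lt₀ hu
  have hfac : (tr (B * A) - (t * u + t⁻¹ * u⁻¹)) * (tr (B * A) - (t * u⁻¹ + u * t⁻¹)) =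
      tr (A * B * A⁻¹ * B⁻¹) - 2 := by
    rw [tr_commutator, ← htA, ← huB]
    linear_combination (u ^ 2 + u⁻¹ ^ 2 - 2) * htt + (t ^ 2 + t⁻¹ ^ 2 - 2) * huu
  have hz' : t * u⁻¹ + u * t⁻¹ < tr (B * A) := by
    rcases hz with hz | hz
    · have h1 := (le_max_left _ _).trans hz
      have h2 := (le_max_right _ _).trans hz
      have h3 : 0 < (u - 1) * (t - t⁻¹) * u⁻¹ := by
        have : 0 < (u - 1) * (t - t⁻¹) := mul_pos (by linarith) (by linarith)
        positivity
      have h4 : 0 < (t - 1) * (u - u⁻¹) * t⁻¹ := by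
        have : 0 < (t - 1) * (u - u⁻¹) := mul_pos (by linarith) (by linarith)
        positivity
      rcases le_total t u with h | h
      · have h5 : 0 ≤ (t - 1) * (u * t⁻¹ - u⁻¹) := by
          apply mul_nonneg (by linarith)
          have : 1 ≤ u * t⁻¹ := by
            rw [← htt]; exact mul_le_mul_of_nonneg_right h ht0.le
          linarith
        nlinarith
      · have h5 : 0 ≤ (u - 1) * (t * u⁻¹ - t⁻¹) := by
          apply mul_nonneg (by linarith)
          have : 1 ≤ t * u⁻¹ := by
            rw [← huu]; exact mul_le_mul_of_nonneg_right h hu0.le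
          linarith
        nlinarith
    · by_contra! hle
      have h1 : t * u⁻¹ + u * t⁻¹ ≤ t * u + t⁻¹ * u⁻¹ := by
        nlinarith [mul_pos (sub_pos.mpr (ht1.trans ht)) (sub_pos.mpr (hu1.trans hu))]
      nlinarith [mul_nonneg (show 0 ≤ t * u + t⁻¹ * u⁻¹ - tr (B * A) by linarith)
        (show 0 ≤ t * u⁻¹ + u * t⁻¹ - tr (B * A) by linarith)]
  obtain ⟨e₀, e₁, he, hA0, hA1⟩ := exists_eigenvector A (by positivity) htA
  obtain ⟨f₀, f₁, hf, hB0, hB1⟩ := exists_eigenvector B (by positivity) huB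
  have hΔ : e₀ * f₁ - e₁ * f₀ ≠ 0 := by
    intro hΔ
    obtain ⟨k, hk0, hk1⟩ : ∃ k : ℝ, e₀ = k * f₀ ∧ e₁ = k * f₁ := by
      by_cases h : f₀ = 0
      · have h' : f₁ ≠ 0 := by tauto
        refine ⟨e₁ / f₁, ?_, by field_simp⟩
        rw [h] at hΔ ⊢
        have : e₀ * f₁ = 0 := by linarith
        simpa [h'] using this
      · refine ⟨e₀ / f₀, by field_simp, ?_⟩
        field_simp
        linarith
    have hBe0 : B 0 0 * e₀ + B 0 1 * e₁ = u * e₀ := by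
      rw [hk0, hk1]; linear_combination k * hB0
    have hBe1 : B 1 0 * e₀ + B 1 1 * e₁ = u * e₁ := by
      rw [hk0, hk1]; linear_combination k * hB1
    have hchar := sq_add_one_of_eigenvector (B * A) (w := u * t) he
      (by rw [mul_entry, mul_entry]; linear_combination B 0 0 * hA0 + B 0 1 * hA1 + t * hBe0)
      (by rw [mul_entry, mul_entry]; linear_combination B 1 0 * hA0 + B 1 1 * hA1 + t * hBe1)
    have hzero : tr (B * A) - (t * u + t⁻¹ * u⁻¹) = 0 := by
      have hut : u * t ≠ 0 := by positivity
      apply mul_left_cancel₀ hut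
      linear_combination -hchar - u * u⁻¹ * htt - huu
    rw [hzero, zero_mul] at hfac
    exact hc (by linarith)
  by_cases hs : 0 ≤ ((A 0 0 * f₀ + A 0 1 * f₁) * f₁ - (A 1 0 * f₀ + A 1 1 * f₁) * f₀) /
      (e₀ * f₁ - e₁ * f₀)
  · exact exists_grows_of_eigenvectors A B ht hu htA huB hz' hΔ hA0 hA1 hB0 hB1 hs
  · refine exists_grows_of_eigenvectors A B (f₀ := -f₀) (f₁ := -f₁) ht hu htA huB hz'
      (fun h => hΔ (by linarith)) hA0 hA1 (by linarith) (by linarith) ?_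
    push Not at hs
    rw [show e₀ * -f₁ - e₁ * -f₀ = -(e₀ * f₁ - e₁ * f₀) by ring, div_neg]
    rw [show (A 0 0 * -f₀ + A 0 1 * -f₁) * -f₁ - (A 1 0 * -f₀ + A 1 1 * -f₁) * -f₀ =
      (A 0 0 * f₀ + A 0 1 * f₁) * f₁ - (A 1 0 * f₀ + A 1 1 * f₁) * f₀ by ring]
    linarith

theorem exists_grows (A B : SL(2, ℝ)) (hc : tr (A * B * A⁻¹ * B⁻¹) ≠ 2)
    (h : Escaping (tr A) (tr B) (tr (B * A)) ∨ tr (A * B * A⁻¹ * B⁻¹) < 2) :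
    ∃ (P : Matrix (Fin 2) (Fin 2) ℝ) (η : ℝ), P.det ≠ 0 ∧ 1 < η ∧ Grows P 1 A ∧ Grows P 1 B ∧
      Grows P η (B * A) := by
  have hbig : 2 < |tr A| ∧ 2 < |tr B| ∧ 0 < tr A * tr B * tr (B * A) ∧
      (max |tr A| |tr B| ≤ |tr (B * A)| ∨ tr (A * B * A⁻¹ * B⁻¹) < 2) := by
    rcases h with h | h
    · exact ⟨h.1, h.2.1, h.2.2.1, Or.inl h.2.2.2⟩
    · have hA := two_lt_abs_tr_of_tr_commutator_lt A B h
      have hB := two_lt_abs_tr_of_tr_commutator_lt B A (by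
        rw [tr_commutator] at h ⊢
        rw [tr_mul_comm A B]; linarith)
      refine ⟨hA, hB, ?_, Or.inr h⟩
      rw [tr_commutator] at h
      nlinarith [sq_abs (tr A), sq_abs (tr B), sq_nonneg (tr (B * A))]
  obtain ⟨hA, hB, hpos, hz⟩ := hbig
  have hcc : ∀ A B A' B' : SL(2, ℝ), (A' = A ∨ A' = -A) → (B' = B ∨ B' = -B) →
      tr (A' * B' * A'⁻¹ * B'⁻¹) = tr (A * B * A⁻¹ * B⁻¹) := by
    intro A B A' B' h1 h2
    rcases h1 with rfl | rfl <;> rcases h2 with rfl | rfl <;>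
      simp [tr_commutator]
  have main : ∀ A' B' : SL(2, ℝ), (A' = A ∨ A' = -A) → (B' = B ∨ B' = -B) →
      tr A' = |tr A| → tr B' = |tr B| → tr (B' * A') = |tr (B * A)| →
      ∃ (P : Matrix (Fin 2) (Fin 2) ℝ) (η : ℝ), P.det ≠ 0 ∧ 1 < η ∧ Grows P 1 A' ∧
        Grows P 1 B' ∧ Grows P η (B' * A') := by
    intro A' B' h1 h2 h3 h4 h5
    refine exists_grows_of_two_lt A' B' ?_ ?_ ?_ ?_
    · rwa [hcc A B A' B' h1 h2]
    · rwa [h3]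
    · rwa [h4]
    · rwa [h3, h4, h5, hcc A B A' B' h1 h2]
  rcases le_or_gt 0 (tr A) with ha | ha <;> rcases le_or_gt 0 (tr B) with hb | hb
  · refine main A B (Or.inl rfl) (Or.inl rfl) (abs_of_nonneg ha).symm (abs_of_nonneg hb).symm ?_
    rw [abs_of_nonneg]
    by_contra! hneg
    nlinarith [mul_nonneg ha hb]
  · obtain ⟨P, η, h1, h2, h3, h4, h5⟩ := main A (-B) (Or.inl rfl) (Or.inr rfl)
      (abs_of_nonneg ha).symm (by rw [tr_neg, abs_of_neg hb]) (by
        rw [neg_mul, tr_neg, abs_of_nonpos]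
        by_contra! hneg
        nlinarith [mul_nonneg ha (neg_nonneg.mpr hb.le)])
    exact ⟨P, η, h1, h2, h3, by simpa using h4.neg, by simpa using h5.neg⟩
  · obtain ⟨P, η, h1, h2, h3, h4, h5⟩ := main (-A) B (Or.inr rfl) (Or.inl rfl)
      (by rw [tr_neg, abs_of_neg ha]) (abs_of_nonneg hb).symm (by
        rw [mul_neg, tr_neg, abs_of_nonpos]
        by_contra! hneg
        nlinarith [mul_nonneg hb (neg_nonneg.mpr ha.le)])
    exact ⟨P, η, h1, h2, by simpa using h3.neg, h4, by simpa using h5.neg⟩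
  · obtain ⟨P, η, h1, h2, h3, h4, h5⟩ := main (-A) (-B) (Or.inr rfl) (Or.inr rfl)
      (by rw [tr_neg, abs_of_neg ha]) (by rw [tr_neg, abs_of_neg hb]) (by
        rw [neg_mul_neg, abs_of_nonneg]
        by_contra! hneg
        nlinarith [mul_pos_of_neg_of_neg ha hb])
    exact ⟨P, η, h1, h2, by simpa using h3.neg, by simpa using h4.neg, by simpa using h5⟩

/-! ### Bounded traces are a compact condition -/

theorem conj_col (Q N : SL(2, ℝ)) :
    (Q⁻¹ * N * Q) 0 0 = Q 1 1 * (N 0 0 * Q 0 0 + N 0 1 * Q 1 0) -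
        Q 0 1 * (N 1 0 * Q 0 0 + N 1 1 * Q 1 0) ∧
      (Q⁻¹ * N * Q) 1 0 = Q 0 0 * (N 1 0 * Q 0 0 + N 1 1 * Q 1 0) -
        Q 1 0 * (N 0 0 * Q 0 0 + N 0 1 * Q 1 0) := by
  obtain ⟨h0, h1, h2, h3⟩ := inv_entries Q
  constructor <;> simp only [mul_entry, h0, h1, h2, h3] <;> ring

/-- If `v` is not an eigenvector of `M`, a multiple of `(v, ± M v)` is a unimodular basis. -/
theorem exists_frame (M : SL(2, ℝ)) {v₀ v₁ : ℝ}
    (h : v₀ * (M 1 0 * v₀ + M 1 1 * v₁) - v₁ * (M 0 0 * v₀ + M 0 1 * v₁) ≠ 0) :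
    ∃ (Q : SL(2, ℝ)) (σ k : ℝ), (σ = 1 ∨ σ = -1) ∧ Q 0 0 = k * v₀ ∧ Q 1 0 = k * v₁ ∧
      Q 0 1 = σ * (M 0 0 * Q 0 0 + M 0 1 * Q 1 0) ∧
      Q 1 1 = σ * (M 1 0 * Q 0 0 + M 1 1 * Q 1 0) := by
  set d := v₀ * (M 1 0 * v₀ + M 1 1 * v₁) - v₁ * (M 0 0 * v₀ + M 0 1 * v₁) with hd
  have hd0 : 0 < |d| := abs_pos.mpr h
  set k := (√|d|)⁻¹ with hk
  have hk2 : k ^ 2 * |d| = 1 := by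
    rw [hk, inv_pow, Real.sq_sqrt hd0.le, inv_mul_cancel₀ hd0.ne']
  obtain ⟨σ, hσ, hσd⟩ : ∃ σ : ℝ, (σ = 1 ∨ σ = -1) ∧ σ * d = |d| := by
    rcases le_or_gt 0 d with h' | h'
    · exact ⟨1, Or.inl rfl, by rw [abs_of_nonneg h', one_mul]⟩
    · exact ⟨-1, Or.inr rfl, by rw [abs_of_neg h']; ring⟩
  refine ⟨⟨!![k * v₀, σ * (M 0 0 * (k * v₀) + M 0 1 * (k * v₁));
    k * v₁, σ * (M 1 0 * (k * v₀) + M 1 1 * (k * v₁))], ?_⟩, σ, k, hσ, rfl, rfl, rfl, rfl⟩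
  rw [Matrix.det_fin_two_of]
  linear_combination hk2 + k ^ 2 * hσd - k ^ 2 * σ * hd

/-- A direction in which the discriminant of a member of the pencil of `A B` and `B` is large. -/
theorem exists_direction {κ R : ℝ} (hκ : 0 < κ) (hR : 0 ≤ R) :
    ∃ δ U : ℝ, 0 < δ ∧ 0 ≤ U ∧ ∀ x y z : ℝ, |x| ≤ R → |y| ≤ R → |z| ≤ R →
      x ^ 2 + y ^ 2 + z ^ 2 - x * y * z - 4 = κ → ∃ u w : ℝ, |u| ≤ U ∧ |w| ≤ U ∧
        δ ≤ (w * z - u * y) ^ 2 - 4 * (u ^ 2 - x * u * w + w ^ 2) := by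
  set s := √κ with hs
  have hs0 : 0 < s := Real.sqrt_pos.mpr hκ
  have hss : s ^ 2 = κ := Real.sq_sqrt hκ.le
  refine ⟨min s (4 * s * κ), 5 + 2 * R + R ^ 2, by positivity, by positivity, ?_⟩
  intro x y z hx hy hz hf
  have hy2 : y ^ 2 ≤ R ^ 2 := sq_le_sq' (abs_le.mp hy).1 (abs_le.mp hy).2
  have hz2 : z ^ 2 ≤ R ^ 2 := sq_le_sq' (abs_le.mp hz).1 (abs_le.mp hz).2
  have hb : |2 * x - y * z| ≤ 5 + 2 * R + R ^ 2 := by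
    have h1 : |2 * x - y * z| ≤ |2 * x| + |y * z| := abs_sub _ _
    rw [abs_mul, abs_mul, abs_two] at h1
    have h2 := mul_le_mul hy hz (abs_nonneg _) hR
    nlinarith
  have hone : |(1 : ℝ)| ≤ 5 + 2 * R + R ^ 2 := by rw [abs_one]; nlinarith
  have hzero : |(0 : ℝ)| ≤ 5 + 2 * R + R ^ 2 := by rw [abs_zero]; positivity
  have hdisc : (2 * x - y * z) ^ 2 - (y ^ 2 - 4) * (z ^ 2 - 4) = 4 * κ := by
    linear_combination 4 * hf
  by_cases ha : s ≤ y ^ 2 - 4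
  · exact ⟨1, 0, hone, hzero, (min_le_left _ _).trans (by linarith)⟩
  by_cases hd : s ≤ z ^ 2 - 4
  · exact ⟨0, 1, hzero, hone, (min_le_left _ _).trans (by linarith)⟩
  push Not at ha hd
  by_cases ha' : y ^ 2 - 4 ≤ -s
  · refine ⟨2 * x - y * z, -(y ^ 2 - 4), hb, abs_le.mpr ⟨?_, ?_⟩,
      (min_le_right _ _).trans ?_⟩
    · nlinarith
    · nlinarith [sq_nonneg y]
    · have e : (-(y ^ 2 - 4) * z - (2 * x - y * z) * y) ^ 2 - 4 * ((2 * x - y * z) ^ 2 -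
          x * (2 * x - y * z) * -(y ^ 2 - 4) + (-(y ^ 2 - 4)) ^ 2) = -(y ^ 2 - 4) * (4 * κ) := by
        rw [← hdisc]; ring
      rw [e]; nlinarith
  by_cases hd' : z ^ 2 - 4 ≤ -s
  · refine ⟨-(z ^ 2 - 4), 2 * x - y * z, abs_le.mpr ⟨?_, ?_⟩, hb,
      (min_le_right _ _).trans ?_⟩
    · nlinarith
    · nlinarith [sq_nonneg z]
    · have e : ((2 * x - y * z) * z - -(z ^ 2 - 4) * y) ^ 2 - 4 * ((-(z ^ 2 - 4)) ^ 2 -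
          x * -(z ^ 2 - 4) * (2 * x - y * z) + (2 * x - y * z) ^ 2) =
          -(z ^ 2 - 4) * (4 * κ) := by
        rw [← hdisc]; ring
      rw [e]; nlinarith
  push Not at ha' hd'
  have had : -(s ^ 2) ≤ (y ^ 2 - 4) * (z ^ 2 - 4) := by
    have h1 : |y ^ 2 - 4| ≤ s := abs_le.mpr ⟨ha'.le, ha.le⟩
    have h2 : |z ^ 2 - 4| ≤ s := abs_le.mpr ⟨hd'.le, hd.le⟩
    have h3 := mul_le_mul h1 h2 (abs_nonneg _) hs0.le
    rw [← abs_mul] at h3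
    nlinarith [neg_abs_le ((y ^ 2 - 4) * (z ^ 2 - 4))]
  have hbig : 3 / 2 * s ≤ |2 * x - y * z| := by
    apply le_of_sq_le_sq _ (abs_nonneg _)
    rw [sq_abs]
    nlinarith
  rcases le_or_gt 0 (2 * x - y * z) with hsgn | hsgn
  · rw [abs_of_nonneg hsgn] at hbig
    exact ⟨1, 1, hone, hone, (min_le_left _ _).trans (by linarith)⟩
  · rw [abs_of_neg hsgn] at hbig
    exact ⟨1, -1, hone, by rwa [abs_neg], (min_le_left _ _).trans (by linarith)⟩

theorem exists_root_abs_ge {L q δ : ℝ} (hδ : 0 ≤ δ) (h : δ ≤ L ^ 2 - 4 * q) :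
    ∃ ν : ℝ, ν ^ 2 + q = ν * L ∧ √δ / 2 ≤ |ν| := by
  have hsq : √(L ^ 2 - 4 * q) ^ 2 = L ^ 2 - 4 * q := Real.sq_sqrt (hδ.trans h)
  have hle : √δ ≤ √(L ^ 2 - 4 * q) := Real.sqrt_le_sqrt h
  have h0 := Real.sqrt_nonneg δ
  rcases le_or_gt 0 L with hL | hL
  · refine ⟨(L + √(L ^ 2 - 4 * q)) / 2, by linear_combination hsq / 4, ?_⟩
    rw [abs_of_nonneg (by linarith)]; linarith
  · refine ⟨(L - √(L ^ 2 - 4 * q)) / 2, by linear_combination hsq / 4, ?_⟩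
    rw [abs_of_neg (by linarith)]; linarith

/-- All entries of `M` are at most `C` in absolute value. -/
def EntriesLE (M : SL(2, ℝ)) (C : ℝ) : Prop := ∀ i j, |M i j| ≤ C

theorem exists_eigenvalue (M : SL(2, ℝ)) {e₀ e₁ : ℝ} (he : e₀ ≠ 0 ∨ e₁ ≠ 0)
    (h : e₀ * (M 1 0 * e₀ + M 1 1 * e₁) - e₁ * (M 0 0 * e₀ + M 0 1 * e₁) = 0) :
    ∃ u, M 0 0 * e₀ + M 0 1 * e₁ = u * e₀ ∧ M 1 0 * e₀ + M 1 1 * e₁ = u * e₁ := by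
  by_cases h0 : e₀ = 0
  · have h' : e₁ ≠ 0 := by tauto
    refine ⟨(M 1 0 * e₀ + M 1 1 * e₁) / e₁, ?_, by field_simp⟩
    rw [h0] at h ⊢
    have : e₁ * (M 0 0 * 0 + M 0 1 * e₁) = 0 := by linarith
    rw [(mul_eq_zero.mp this).resolve_left h', mul_zero]
  · refine ⟨(M 0 0 * e₀ + M 0 1 * e₁) / e₀, by field_simp, ?_⟩
    field_simp
    linarith

theorem tr_commutator_eq_two_of_eigenvector (A B : SL(2, ℝ)) {t e₀ e₁ : ℝ}
    (he : e₀ ≠ 0 ∨ e₁ ≠ 0) (hA0 : A 0 0 * e₀ + A 0 1 * e₁ = t * e₀)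
    (hA1 : A 1 0 * e₀ + A 1 1 * e₁ = t * e₁)
    (hB : e₀ * (B 1 0 * e₀ + B 1 1 * e₁) - e₁ * (B 0 0 * e₀ + B 0 1 * e₁) = 0) :
    tr (A * B * A⁻¹ * B⁻¹) = 2 := by
  obtain ⟨u, hB0, hB1⟩ := exists_eigenvalue B he hB
  have hA := sq_add_one_of_eigenvector A he hA0 hA1
  have hB' := sq_add_one_of_eigenvector B he hB0 hB1
  have hBA := sq_add_one_of_eigenvector (B * A) (w := u * t) he
    (by rw [mul_entry, mul_entry]; linear_combination B 0 0 * hA0 + B 0 1 * hA1 + t * hB0)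
    (by rw [mul_entry, mul_entry]; linear_combination B 1 0 * hA0 + B 1 1 * hA1 + t * hB1)
  have ht : t ≠ 0 := fun h => by rw [h] at hA; norm_num at hA
  have hu : u ≠ 0 := fun h => by rw [h] at hB'; norm_num at hB'
  have eA : tr A = (t ^ 2 + 1) / t := by rw [hA]; field_simp
  have eB : tr B = (u ^ 2 + 1) / u := by rw [hB']; field_simp
  have eBA : tr (B * A) = ((u * t) ^ 2 + 1) / (u * t) := by rw [hBA]; field_simp
  rw [tr_commutator, eA, eB, eBA]
  field_simp
  ring

theorem tr_inv_conj (Q M : SL(2, ℝ)) : tr (Q⁻¹ * M * Q) = tr M := by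
  simpa using tr_conj Q⁻¹ M

theorem exists_conj_entriesLE_of_two_le (A B : SL(2, ℝ)) (hc : tr (A * B * A⁻¹ * B⁻¹) ≠ 2)
    {R : ℝ} (hR : 0 ≤ R) (hA : |tr A| ≤ R) (hB : |tr B| ≤ R) (hBA : |tr (B * A)| ≤ R)
    (hx : 2 ≤ |tr A|) :
    ∃ Q : SL(2, ℝ), EntriesLE (Q⁻¹ * A * Q) (10 + 10 * R + 10 * R ^ 2) ∧
      EntriesLE (Q⁻¹ * B * Q) (10 + 10 * R + 10 * R ^ 2) := by
  have hR2 := sq_nonneg R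
  obtain ⟨t, ht, htR⟩ : ∃ t : ℝ, t ^ 2 + 1 = t * tr A ∧ |t| ≤ R := by
    have h4 : 4 ≤ tr A ^ 2 := by nlinarith [sq_abs (tr A)]
    have hsq : √(tr A ^ 2 - 4) ^ 2 = tr A ^ 2 - 4 := Real.sq_sqrt (by linarith)
    refine ⟨(tr A + √(tr A ^ 2 - 4)) / 2, by linear_combination hsq / 4, ?_⟩
    have h5 : √(tr A ^ 2 - 4) ≤ |tr A| := by
      rw [← Real.sqrt_sq_eq_abs]; exact Real.sqrt_le_sqrt (by linarith)
    have h6 := abs_add_le (tr A) √(tr A ^ 2 - 4)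
    rw [abs_of_nonneg (Real.sqrt_nonneg _)] at h6
    rw [abs_div, abs_two]
    linarith
  obtain ⟨e₀, e₁, he, hA0, hA1⟩ := exists_eigenvector_of_char
    (a := A 0 0) (b := A 0 1) (c := A 1 0) (d := A 1 1) (w := t)
    (by rw [det_eq, ← tr_eq]; exact ht)
  obtain ⟨Q, σ, k, hσ, hQ0, hQ1, hQ2, hQ3⟩ := exists_frame B 
    (fun h => hc (tr_commutator_eq_two_of_eigenvector A B he hA0 hA1 h))
  have hσ2 : σ * σ = 1 := by rcases hσ with rfl | rfl <;> norm_num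
  have hQd := det_eq Q
  obtain ⟨a0, a1⟩ := conj_col Q A
  obtain ⟨b0, b1⟩ := conj_col Q B
  have hAQ0 : A 0 0 * Q 0 0 + A 0 1 * Q 1 0 = t * Q 0 0 := by
    rw [hQ0, hQ1]; linear_combination k * hA0
  have hAQ1 : A 1 0 * Q 0 0 + A 1 1 * Q 1 0 = t * Q 1 0 := by
    rw [hQ0, hQ1]; linear_combination k * hA1
  have a0' : (Q⁻¹ * A * Q) 0 0 = t := by
    rw [a0, hAQ0, hAQ1]; linear_combination t * hQd
  have a1' : (Q⁻¹ * A * Q) 1 0 = 0 := by rw [a1, hAQ0, hAQ1]; ring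
  have hBQ0 : B 0 0 * Q 0 0 + B 0 1 * Q 1 0 = σ * Q 0 1 := by
    rw [hQ2]; linear_combination (-(B 0 0 * Q 0 0 + B 0 1 * Q 1 0)) * hσ2
  have hBQ1 : B 1 0 * Q 0 0 + B 1 1 * Q 1 0 = σ * Q 1 1 := by
    rw [hQ3]; linear_combination (-(B 1 0 * Q 0 0 + B 1 1 * Q 1 0)) * hσ2
  have b0' : (Q⁻¹ * B * Q) 0 0 = 0 := by rw [b0, hBQ0, hBQ1]; ring
  have b1' : (Q⁻¹ * B * Q) 1 0 = σ := by
    rw [b1, hBQ0, hBQ1]; linear_combination σ * hQd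
  have tA := tr_inv_conj Q A
  have tB := tr_inv_conj Q B
  have tBA := tr_inv_conj Q (B * A)
  rw [show Q⁻¹ * (B * A) * Q = Q⁻¹ * B * Q * (Q⁻¹ * A * Q) by group] at tBA
  rw [tr_mul_eq] at tBA
  rw [tr_eq] at tA tB
  have dB := det_eq (Q⁻¹ * B * Q)
  refine ⟨Q, ?_⟩
  generalize Q⁻¹ * A * Q = A' at *
  generalize Q⁻¹ * B * Q = B' at *
  have a3 : A' 1 1 = tr A - t := by linarith
  have b3 : B' 1 1 = tr B := by linarith
  have b2 : B' 0 1 = -σ := by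
    rw [b0', b1'] at dB
    linear_combination (-σ) * dB - B' 0 1 * hσ2
  have a2 : A' 0 1 = σ * (tr (B * A) - tr B * (tr A - t)) := by
    rw [b0', b1', b3, a1', a3] at tBA
    linear_combination σ * tBA - A' 0 1 * hσ2
  have hσ1 : |σ| = 1 := by rcases hσ with rfl | rfl <;> simp
  have hxt : |tr A - t| ≤ 2 * R := (abs_sub _ _).trans (by linarith)
  constructor
  · intro i j
    fin_cases i <;> fin_cases j <;> simp only [Fin.zero_eta, Fin.mk_one]
    · rw [a0']; linarith
    · rw [a2, abs_mul, hσ1, one_mul]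
      refine (abs_sub _ _).trans ?_
      rw [abs_mul]
      have h1 := mul_le_mul hB hxt (abs_nonneg _) hR
      have h2 : R * (2 * R) = 2 * R ^ 2 := by ring
      linarith
    · rw [a1', abs_zero]; linarith
    · rw [a3]; linarith
  · intro i j
    fin_cases i <;> fin_cases j <;> simp only [Fin.zero_eta, Fin.mk_one]
    · rw [b0', abs_zero]; linarith
    · rw [b2, abs_neg, hσ1]; linarith
    · rw [b1', hσ1]; linarith
    · rw [b3]; linarith

theorem exists_conj_entriesLE_of_lt_two (A B : SL(2, ℝ)) {R V u w ν : ℝ} (hR : 0 ≤ R)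
    (hV0 : 0 ≤ V) (hA : |tr A| ≤ R) (hB : |tr B| ≤ R) (hBA : |tr (B * A)| ≤ R)
    (hx : |tr A| < 2) (hν0 : ν ≠ 0) (hu : |u / ν| ≤ V) (hw : |w / ν| ≤ V)
    (hν : ν ^ 2 + (u ^ 2 - tr A * u * w + w ^ 2) = ν * (w * tr (B * A) - u * tr B)) :
    ∃ Q : SL(2, ℝ), EntriesLE (Q⁻¹ * A * Q) (10 + 10 * R + 10 * V + 10 * (V * R)) ∧
      EntriesLE (Q⁻¹ * B * Q) (10 + 10 * R + 10 * V + 10 * (V * R)) := by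
  have hVR := mul_nonneg hV0 hR
  have dA := det_eq A
  have dB := det_eq B
  obtain ⟨e₀, e₁, he, hM0, hM1⟩ := exists_eigenvector_of_char
    (a := w * (B * A) 0 0 - u * B 0 0) (b := w * (B * A) 0 1 - u * B 0 1)
    (c := w * (B * A) 1 0 - u * B 1 0) (d := w * (B * A) 1 1 - u * B 1 1) (w := ν) (by
      rw [tr_eq, tr_eq, tr_eq] at hν
      simp only [mul_entry] at hν ⊢
      linear_combination hν + w ^ 2 * dA + (w ^ 2 * (A 0 0 * A 1 1 - A 0 1 * A 1 0) -
        w * u * (A 0 0 + A 1 1) + u ^ 2) * dB)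
  have hne : e₀ * (A 1 0 * e₀ + A 1 1 * e₁) - e₁ * (A 0 0 * e₀ + A 0 1 * e₁) ≠ 0 := by
    intro h
    obtain ⟨t, h0, h1⟩ := exists_eigenvalue A he h
    have h2 := sq_add_one_of_eigenvector A he h0 h1
    have h3 : |t| ^ 2 + 1 = |t| * |tr A| := by
      rw [← abs_mul, ← h2, sq_abs, abs_of_pos (by positivity)]
    have h4 : 0 < |t| := abs_pos.mpr fun h => by rw [h] at h2; norm_num at h2
    nlinarith [mul_pos h4 (sub_pos.mpr hx), sq_nonneg (|t| - 1)]
  obtain ⟨Q, σ, k, hσ, hQ0, hQ1, hQ2, hQ3⟩ := exists_frame A hne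
  have hσ2 : σ * σ = 1 := by rcases hσ with rfl | rfl <;> norm_num
  have hσ1 : |σ| = 1 := by rcases hσ with rfl | rfl <;> simp
  have hQd := det_eq Q
  have hAQ0 : A 0 0 * Q 0 0 + A 0 1 * Q 1 0 = σ * Q 0 1 := by
    rw [hQ2]; linear_combination (-(A 0 0 * Q 0 0 + A 0 1 * Q 1 0)) * hσ2
  have hAQ1 : A 1 0 * Q 0 0 + A 1 1 * Q 1 0 = σ * Q 1 1 := by
    rw [hQ3]; linear_combination (-(A 1 0 * Q 0 0 + A 1 1 * Q 1 0)) * hσ2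
  have hX0 : B 0 0 * (w / ν * (σ * Q 0 1) - u / ν * Q 0 0) +
      B 0 1 * (w / ν * (σ * Q 1 1) - u / ν * Q 1 0) = Q 0 0 := by
    rw [← hAQ0, ← hAQ1, hQ0, hQ1]
    simp only [mul_entry] at hM0
    field_simp
    linear_combination k * hM0
  have hX1 : B 1 0 * (w / ν * (σ * Q 0 1) - u / ν * Q 0 0) +
      B 1 1 * (w / ν * (σ * Q 1 1) - u / ν * Q 1 0) = Q 1 0 := by
    rw [← hAQ0, ← hAQ1, hQ0, hQ1]
    simp only [mul_entry] at hM1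
    field_simp
    linear_combination k * hM1
  obtain ⟨a0, a1⟩ := conj_col Q A
  obtain ⟨b0, b1⟩ := conj_col Q B⁻¹
  obtain ⟨i0, i1, i2, i3⟩ := inv_entries B
  have a0' : (Q⁻¹ * A * Q) 0 0 = 0 := by rw [a0, hAQ0, hAQ1]; ring
  have a1' : (Q⁻¹ * A * Q) 1 0 = σ := by
    rw [a1, hAQ0, hAQ1]; linear_combination σ * hQd
  have y0 : B⁻¹ 0 0 * Q 0 0 + B⁻¹ 0 1 * Q 1 0 = w / ν * (σ * Q 0 1) - u / ν * Q 0 0 := by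
    rw [i0, i1]
    linear_combination (w / ν * (σ * Q 0 1) - u / ν * Q 0 0) * dB - B 1 1 * hX0 + B 0 1 * hX1
  have y1 : B⁻¹ 1 0 * Q 0 0 + B⁻¹ 1 1 * Q 1 0 = w / ν * (σ * Q 1 1) - u / ν * Q 1 0 := by
    rw [i2, i3]
    linear_combination (w / ν * (σ * Q 1 1) - u / ν * Q 1 0) * dB + B 1 0 * hX0 - B 0 0 * hX1
  rw [y0, y1] at b0 b1
  rw [show Q⁻¹ * B⁻¹ * Q = (Q⁻¹ * B * Q)⁻¹ by group] at b0 b1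
  have tA := tr_inv_conj Q A
  have tB := tr_inv_conj Q B
  have tBA := tr_inv_conj Q (B * A)
  rw [show Q⁻¹ * (B * A) * Q = Q⁻¹ * B * Q * (Q⁻¹ * A * Q) by group] at tBA
  rw [tr_mul_eq] at tBA
  rw [tr_eq] at tA tB
  have dA' := det_eq (Q⁻¹ * A * Q)
  obtain ⟨j0, j1, j2, j3⟩ := inv_entries (Q⁻¹ * B * Q)
  rw [j0] at b0
  rw [j2] at b1
  refine ⟨Q, ?_⟩
  generalize Q⁻¹ * A * Q = A' at *
  generalize Q⁻¹ * B * Q = B' at *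
  have a3 : A' 1 1 = tr A := by linarith
  have a2 : A' 0 1 = -σ := by
    rw [a0', a1'] at dA'
    linear_combination (-σ) * dA' - A' 0 1 * hσ2
  have b3 : B' 1 1 = -(u / ν) := by rw [b0]; linear_combination (-(u / ν)) * hQd
  have b2 : B' 1 0 = -(σ * (w / ν)) := by linear_combination (-1) * b1 - σ * (w / ν) * hQd
  have b0' : B' 0 0 = tr B + u / ν := by linarith
  have b1' : B' 0 1 = σ * (tr (B * A) - w / ν + u / ν * tr A) := by
    rw [a0', a1', a2, a3, b2, b3] at tBA
    linear_combination σ * tBA - (B' 0 1 + σ * (w / ν)) * hσ2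
  constructor
  · intro i j
    fin_cases i <;> fin_cases j <;> simp only [Fin.zero_eta, Fin.mk_one]
    · rw [a0', abs_zero]; linarith
    · rw [a2, abs_neg, hσ1]; linarith
    · rw [a1', hσ1]; linarith
    · rw [a3]; linarith
  · intro i j
    fin_cases i <;> fin_cases j <;> simp only [Fin.zero_eta, Fin.mk_one]
    · rw [b0']
      exact (abs_add_le _ _).trans (by linarith)
    · rw [b1', abs_mul, hσ1, one_mul]
      have h1 := abs_add_le (tr (B * A) - w / ν) (u / ν * tr A)
      have h2 := abs_sub (tr (B * A)) (w / ν)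
      rw [abs_mul] at h1
      have h3 := mul_le_mul hu hA (abs_nonneg _) hV0
      linarith
    · rw [b2, abs_neg, abs_mul, hσ1]; linarith
    · rw [b3, abs_neg]; linarith

/-- A pair with bounded traces and an irreducible commutator trace is conjugate to a bounded
pair. -/
theorem exists_conj_entriesLE {c : ℝ} (hc : c ≠ 2) {R : ℝ} (hR : 0 ≤ R) :
    ∃ C : ℝ, ∀ A B : SL(2, ℝ), tr (A * B * A⁻¹ * B⁻¹) = c → |tr A| ≤ R → |tr B| ≤ R →
      |tr (B * A)| ≤ R → ∃ Q : SL(2, ℝ), EntriesLE (Q⁻¹ * A * Q) C ∧ EntriesLE (Q⁻¹ * B * Q) C := by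
  obtain ⟨V, hV0, hV⟩ : ∃ V : ℝ, 0 ≤ V ∧ ∀ A B : SL(2, ℝ), tr (A * B * A⁻¹ * B⁻¹) = c →
      |tr A| < 2 → |tr A| ≤ R → |tr B| ≤ R → |tr (B * A)| ≤ R →
      ∃ u w ν : ℝ, ν ≠ 0 ∧ |u / ν| ≤ V ∧ |w / ν| ≤ V ∧
        ν ^ 2 + (u ^ 2 - tr A * u * w + w ^ 2) = ν * (w * tr (B * A) - u * tr B) := by
    rcases lt_or_gt_of_ne hc with h | h
    · refine ⟨0, le_rfl, fun A B hAB hA => ?_⟩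
      have := two_lt_abs_tr_of_tr_commutator_lt A B (hAB ▸ h)
      linarith
    · obtain ⟨δ, U, hδ, hU, hdir⟩ := exists_direction (sub_pos.mpr h) hR
      have hsδ := Real.sqrt_pos.mpr hδ
      refine ⟨U / (√δ / 2), by positivity, fun A B hAB _ hA hB hBA => ?_⟩
      obtain ⟨u, w, hu, hw, huw⟩ := hdir (tr A) (tr B) (tr (B * A)) hA hB hBA
        (by rw [tr_commutator] at hAB; linarith)
      obtain ⟨ν, hν, hνδ⟩ := exists_root_abs_ge hδ.le huw
      have hν0 : 0 < |ν| := lt_of_lt_of_le (by positivity) hνδ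
      refine ⟨u, w, ν, abs_pos.mp hν0, ?_, ?_, hν⟩
      · rw [abs_div]; gcongr
      · rw [abs_div]; gcongr
  have hR2 := sq_nonneg R
  have hVR := mul_nonneg hV0 hR
  have hmono : ∀ (M : SL(2, ℝ)) (C C' : ℝ), C ≤ C' → EntriesLE M C → EntriesLE M C' :=
    fun M C C' h hM i j => (hM i j).trans h
  refine ⟨10 + 10 * R + 10 * R ^ 2 + 10 * V + 10 * (V * R), fun A B hAB hA hB hBA => ?_⟩
  by_cases hx : 2 ≤ |tr A|
  · obtain ⟨Q, h1, h2⟩ :=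
      exists_conj_entriesLE_of_two_le A B (hAB ▸ hc) hR hA hB hBA hx
    exact ⟨Q, hmono _ _ _ (by linarith) h1, hmono _ _ _ (by linarith) h2⟩
  · push Not at hx
    obtain ⟨u, w, ν, hν0, hu, hw, hν⟩ := hV A B hAB hx hA hB hBA
    obtain ⟨Q, h1, h2⟩ :=
      exists_conj_entriesLE_of_lt_two A B hR hV0 hA hB hBA hx hν0 hu hw hν
    exact ⟨Q, hmono _ _ _ (by linarith) h1, hmono _ _ _ (by linarith) h2⟩

/-! ### Compact sets in the character variety -/

theorem isCompact_entriesLE (C : ℝ) : IsCompact {M : SL(2, ℝ) | EntriesLE M C} := by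
  have hcl := Matrix.SpecialLinearGroup.isClosedEmbedding_val (n := Fin 2) (R := ℝ)
  have hK : IsCompact (Set.pi univ fun _ : Fin 2 => Set.pi univ fun _ : Fin 2 => Icc (-C) C) :=
    isCompact_univ_pi fun _ => isCompact_univ_pi fun _ => isCompact_Icc
  refine (hcl.isCompact_preimage hK).of_isClosed_subset ?_ ?_
  · simp only [EntriesLE, Set.ofPred_forall]
    refine isClosed_iInter fun i => isClosed_iInter fun j => ?_
    refine isClosed_le (continuous_abs.comp ?_) continuous_const
    exact (continuous_apply j).comp (Matrix.SpecialLinearGroup.continuous_apply _ continuous_id i)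
  · intro M hM i _ j _
    exact abs_le.mp (hM i j)

/-- The representation with prescribed images of the generators. -/
def repOfPair (p : SL(2, ℝ) × SL(2, ℝ)) : Rep :=
  (FreeGroup.lift ![p.1, p.2] : Pi1 →* SL(2, ℝ))

theorem continuous_repOfPair : Continuous repOfPair := by
  refine continuous_induced_rng.mpr (continuous_pi fun g => ?_)
  change Continuous fun p : SL(2, ℝ) × SL(2, ℝ) => FreeGroup.lift ![p.1, p.2] g
  induction g using FreeGroup.induction_on with
  | C1 => simpa using continuous_const
  | of i => fin_cases i <;> simp <;> fun_prop
  | inv_of i h => simp only [map_inv]; exact h.inv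
  | mul x y hx hy => simp only [map_mul]; exact hx.mul hy

theorem continuous_cls : Continuous Rep.cls := continuous_quotient_mk'

theorem cls_eq_of_conj (ρ : Rep) (Q : SL(2, ℝ)) :
    (repOfPair (Q⁻¹ * ρ.eval genA * Q, Q⁻¹ * ρ.eval genB * Q)).cls = ρ.cls := by
  symm
  apply Quotient.sound
  refine ⟨Q⁻¹, fun g => ?_⟩
  have hg : (MulAut.conj Q⁻¹).toMonoidHom.comp (show Pi1 →* SL(2, ℝ) from ρ) =
      FreeGroup.lift ![Q⁻¹ * ρ.eval genA * Q, Q⁻¹ * ρ.eval genB * Q] := by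
    ext1 i
    rw [FreeGroup.lift_apply_of]
    fin_cases i
    · change Q⁻¹ * ρ.eval genA * (Q⁻¹)⁻¹ = Q⁻¹ * ρ.eval genA * Q
      rw [inv_inv]
    · change Q⁻¹ * ρ.eval genB * (Q⁻¹)⁻¹ = Q⁻¹ * ρ.eval genB * Q
      rw [inv_inv]
  exact (DFunLike.congr_fun hg g).symm

theorem Rep.eval_mul (ρ : Rep) (g h : Pi1) : ρ.eval (g * h) = ρ.eval g * ρ.eval h :=
  map_mul (show Pi1 →* SL(2, ℝ) from ρ) g h

theorem Rep.eval_inv (ρ : Rep) (g : Pi1) : ρ.eval g⁻¹ = (ρ.eval g)⁻¹ :=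
  map_inv (show Pi1 →* SL(2, ℝ) from ρ) g

theorem Rep.trace_eq_tr (ρ : Rep) (g : Pi1) : ρ.trace g = tr (ρ.eval g) := rfl

theorem Rep.trace_commutator (ρ : Rep) : ρ.trace (genA * genB * genA⁻¹ * genB⁻¹) =
    tr (ρ.eval genA * ρ.eval genB * (ρ.eval genA)⁻¹ * (ρ.eval genB)⁻¹) := by
  simp only [Rep.trace_eq_tr, Rep.eval_mul, Rep.eval_inv]

/-- Representations with bounded trace coordinates lie in a compact subset of the character
variety. -/
theorem exists_isCompact_of_traceCoords_le {c : ℝ} (hc : c ≠ 2) (R : ℝ) :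
    ∃ K : Set CharVar, IsCompact K ∧ ∀ ρ : Rep,
      ρ.trace (genA * genB * genA⁻¹ * genB⁻¹) = c → (∀ i, |ρ.traceCoords i| ≤ R) → ρ.cls ∈ K := by
  obtain ⟨C, hC⟩ := exists_conj_entriesLE hc (le_max_right R 0)
  refine ⟨(fun p => (repOfPair p).cls) '' ({M | EntriesLE M C} ×ˢ {M | EntriesLE M C}),
    ((isCompact_entriesLE C).prod (isCompact_entriesLE C)).image
      (continuous_cls.comp continuous_repOfPair), fun ρ hρ hR => ?_⟩
  have h0 := (hR 0).trans (le_max_left R 0)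
  have h1 := (hR 1).trans (le_max_left R 0)
  have h2 := (hR 2).trans (le_max_left R 0)
  obtain ⟨Q, hQA, hQB⟩ := hC (ρ.eval genA) (ρ.eval genB) (by rw [← ρ.trace_commutator, hρ]) h0 h1
    (by rw [tr_mul_comm, ← Rep.eval_mul]; exact h2)
  exact ⟨(Q⁻¹ * ρ.eval genA * Q, Q⁻¹ * ρ.eval genB * Q), ⟨hQA, hQB⟩, cls_eq_of_conj ρ Q⟩

theorem continuous_trace (g : Pi1) : Continuous fun ρ : Rep => ρ.trace g := by
  have h1 : Continuous fun ρ : Rep => ρ.eval g :=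
    (continuous_apply g).comp continuous_induced_dom
  have h2 : Continuous fun ρ : Rep => (ρ.eval g : Matrix (Fin 2) (Fin 2) ℝ) :=
    Matrix.SpecialLinearGroup.isClosedEmbedding_val.continuous.comp h1
  exact h2.matrix_trace

/-- Traces are bounded on compact subsets of the character variety. -/
theorem exists_trace_le_of_isCompact {K : Set CharVar} (hK : IsCompact K) (g : Pi1) :
    ∃ R : ℝ, ∀ ρ : Rep, ρ.cls ∈ K → |ρ.trace g| ≤ R := by
  let f : CharVar → ℝ := Quotient.lift (fun ρ : Rep => ρ.trace g) (by
    rintro ρ σ ⟨P, hP⟩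
    change tr (ρ.eval g) = tr (σ.eval g)
    rw [hP, tr_conj])
  have hf : Continuous f := (continuous_trace g).quotient_lift _
  obtain ⟨R, hR⟩ := (hK.image hf).isBounded.exists_norm_le
  exact ⟨R, fun ρ hρ => hR _ ⟨ρ.cls, hρ, rfl⟩⟩

theorem not_tendsto_cocompact_of_mem {x : ℕ → CharVar} {K : Set CharVar} (hK : IsCompact K)
    (h : ∃ᶠ n in atTop, x n ∈ K) : ¬ Tendsto x atTop (cocompact CharVar) := fun ht =>
  h (ht.eventually hK.compl_mem_cocompact)

/-! ### The pair of generators along a trajectory -/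

theorem act_eval (f : MulAut Pi1) (ρ : Rep) (g : Pi1) : (act f ρ).eval g = ρ.eval (f⁻¹ g) := rfl

/-- The image of the first generator, with the sign of the direction, at the `n`-th step. -/
noncomputable def pairA (θ : Circle) (ρ : Rep) (n : ℕ) : SL(2, ℝ) :=
  (act (trajectory θ n) ρ).eval (signed (θ : ℂ).re genA)

/-- The image of the second generator, with the sign of the direction, at the `n`-th step. -/
noncomputable def pairB (θ : Circle) (ρ : Rep) (n : ℕ) : SL(2, ℝ) :=
  (act (trajectory θ n) ρ).eval (signed (θ : ℂ).im genB)

theorem signChange_genA (θ : Circle) : signChange θ genA = signed (θ : ℂ).re genA := by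
  change FreeGroup.lift _ (FreeGroup.of 0) = _
  rw [FreeGroup.lift_apply_of]; rfl

theorem signChange_genB (θ : Circle) : signChange θ genB = signed (θ : ℂ).im genB := by
  change FreeGroup.lift _ (FreeGroup.of 1) = _
  rw [FreeGroup.lift_apply_of]; rfl

theorem dehnTwistA_inv_genA : dehnTwistA⁻¹ genA = genA := by
  change FreeGroup.lift ![genA, genB * genA] (FreeGroup.of 0 : Pi1) = _
  rw [FreeGroup.lift_apply_of]; rfl

theorem dehnTwistA_inv_genB : dehnTwistA⁻¹ genB = genB * genA := by
  change FreeGroup.lift ![genA, genB * genA] (FreeGroup.of 1 : Pi1) = _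
  rw [FreeGroup.lift_apply_of]; rfl

theorem dehnTwistB_inv_genA : dehnTwistB⁻¹ genA = genB * genA := by
  change FreeGroup.lift ![genB * genA, genB] (FreeGroup.of 0 : Pi1) = _
  rw [FreeGroup.lift_apply_of]; rfl

theorem dehnTwistB_inv_genB : dehnTwistB⁻¹ genB = genB := by
  change FreeGroup.lift ![genB * genA, genB] (FreeGroup.of 1 : Pi1) = _
  rw [FreeGroup.lift_apply_of]; rfl

theorem conj_signChange_inv_apply (θ : Circle) (τ ψ : MulAut Pi1) (ρ : Rep) (g : Pi1) :
    (act (signChange θ * τ * (signChange θ)⁻¹ * ψ) ρ).eval (signChange θ g) =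
      (act ψ ρ).eval (signChange θ (τ⁻¹ g)) := by
  rw [act_eval, act_eval]
  congr 1
  rw [mul_inv_rev, mul_inv_rev, mul_inv_rev, inv_inv]
  simp only [MulAut.mul_apply, MulAut.inv_apply_self]

theorem pair_succ_of_isTwistA {θ : Circle} (ρ : Rep) {n : ℕ} (h : IsTwistA θ n) :
    pairA θ ρ (n + 1) = pairA θ ρ n ∧ pairB θ ρ (n + 1) = pairB θ ρ n * pairA θ ρ n := by
  have ht : trajectory θ (n + 1) =
      signChange θ * dehnTwistA * (signChange θ)⁻¹ * trajectory θ n := by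
    rw [trajectory, if_pos (show (rauzyLengths θ n).2 ≤ (rauzyLengths θ n).1 from h)]
  simp only [pairA, pairB, ht, ← signChange_genA, ← signChange_genB,
    conj_signChange_inv_apply, dehnTwistA_inv_genA, dehnTwistA_inv_genB, map_mul, Rep.eval_mul,
    and_self]

theorem pair_succ_of_not {θ : Circle} (ρ : Rep) {n : ℕ} (h : ¬ IsTwistA θ n) :
    pairA θ ρ (n + 1) = pairB θ ρ n * pairA θ ρ n ∧ pairB θ ρ (n + 1) = pairB θ ρ n := by
  have ht : trajectory θ (n + 1) =
      signChange θ * dehnTwistB * (signChange θ)⁻¹ * trajectory θ n := by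
    rw [trajectory, if_neg (show ¬ (rauzyLengths θ n).2 ≤ (rauzyLengths θ n).1 from h)]
  simp only [pairA, pairB, ht, ← signChange_genA, ← signChange_genB,
    conj_signChange_inv_apply, dehnTwistB_inv_genA, dehnTwistB_inv_genB, map_mul, Rep.eval_mul,
    and_self]

/-- The traces of the pair and of its product. -/
noncomputable def trA (θ : Circle) (ρ : Rep) (n : ℕ) : ℝ := tr (pairA θ ρ n)

noncomputable def trB (θ : Circle) (ρ : Rep) (n : ℕ) : ℝ := tr (pairB θ ρ n)

noncomputable def trBA (θ : Circle) (ρ : Rep) (n : ℕ) : ℝ := tr (pairB θ ρ n * pairA θ ρ n)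

theorem eval_signed (ρ : Rep) (r : ℝ) (g : Pi1) :
    ρ.eval (signed r g) = ρ.eval g ∨ ρ.eval (signed r g) = (ρ.eval g)⁻¹ := by
  unfold signed
  split_ifs
  · exact Or.inl rfl
  · exact Or.inr (ρ.eval_inv g)

theorem trace_act_genA (θ : Circle) (ρ : Rep) (n : ℕ) :
    (act (trajectory θ n) ρ).trace genA = trA θ ρ n := by
  rw [Rep.trace_eq_tr, trA, pairA]
  rcases eval_signed (act (trajectory θ n) ρ) (θ : ℂ).re genA with h | h <;> rw [h]
  rw [tr_inv]

theorem trace_act_genB (θ : Circle) (ρ : Rep) (n : ℕ) :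
    (act (trajectory θ n) ρ).trace genB = trB θ ρ n := by
  rw [Rep.trace_eq_tr, trB, pairB]
  rcases eval_signed (act (trajectory θ n) ρ) (θ : ℂ).im genB with h | h <;> rw [h]
  rw [tr_inv]

theorem trace_act_mul (θ : Circle) (ρ : Rep) (n : ℕ) :
    (act (trajectory θ n) ρ).trace (genA * genB) = trBA θ ρ n ∨
      (act (trajectory θ n) ρ).trace (genA * genB) =
        trA θ ρ n * trB θ ρ n - trBA θ ρ n := by
  rw [Rep.trace_eq_tr, Rep.eval_mul, tr_mul_comm, trA, trB, trBA, pairA, pairB]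
  generalize act (trajectory θ n) ρ = ρ'
  rcases eval_signed ρ' (θ : ℂ).re genA with h | h <;>
    rcases eval_signed ρ' (θ : ℂ).im genB with h' | h' <;> rw [h, h']
  · exact Or.inl rfl
  · right
    rw [tr_mul_comm (ρ'.eval genB)⁻¹ (ρ'.eval genA), tr_mul_inv, tr_inv,
      tr_mul_comm (ρ'.eval genB) (ρ'.eval genA)]; ring
  · right
    rw [tr_mul_inv, tr_inv]; ring
  · left
    rw [← mul_inv_rev, tr_inv, tr_mul_comm]

theorem trace_commutator_act (θ : Circle) (ρ : Rep) (n : ℕ) :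
    (act (trajectory θ n) ρ).trace (genA * genB * genA⁻¹ * genB⁻¹) =
      trA θ ρ n ^ 2 + trB θ ρ n ^ 2 + trBA θ ρ n ^ 2 - trA θ ρ n * trB θ ρ n * trBA θ ρ n - 2 := by
  rw [Rep.trace_commutator, tr_commutator, ← Rep.eval_mul, ← Rep.trace_eq_tr, ← Rep.trace_eq_tr,
    trace_act_genA, trace_act_genB, Rep.eval_mul, tr_mul_comm, ← Rep.eval_mul, ← Rep.trace_eq_tr]
  rcases trace_act_mul θ ρ n with h | h <;> rw [h]
  ring

theorem trace_commutator_of_mem {ρ : Rep} {c : ℝ} (h : ρ.cls ∈ relCharVar c) :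
    ρ.trace (genA * genB * genA⁻¹ * genB⁻¹) = c := by
  obtain ⟨σ, hσ, hc⟩ := h
  obtain ⟨P, hP⟩ := Quotient.exact hσ
  rw [Rep.trace_eq_tr, hP, tr_conj]
  exact hc

theorem twistOrbit_tr (θ : Circle) {ρ : Rep} {c : ℝ} (h : ρ.cls ∈ relCharVar c) :
    TwistOrbit (c - 2) (IsTwistA θ) (trA θ ρ) (trB θ ρ) (trBA θ ρ) := by
  have hA : ∀ n, IsTwistA θ n → trA θ ρ (n + 1) = trA θ ρ n ∧ trB θ ρ (n + 1) = trBA θ ρ n ∧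
      trBA θ ρ (n + 1) = trA θ ρ n * trBA θ ρ n - trB θ ρ n := by
    intro n hn
    obtain ⟨h1, h2⟩ := pair_succ_of_isTwistA ρ hn
    simp only [trA, trB, trBA, h1, h2, tr_mul_sq, and_self]
  have hB : ∀ n, ¬ IsTwistA θ n → trA θ ρ (n + 1) = trBA θ ρ n ∧ trB θ ρ (n + 1) = trB θ ρ n ∧
      trBA θ ρ (n + 1) = trB θ ρ n * trBA θ ρ n - trA θ ρ n := by
    intro n hn
    obtain ⟨h1, h2⟩ := pair_succ_of_not ρ hn
    simp only [trA, trB, trBA, h1, h2, tr_sq_mul, and_self]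
  refine ⟨fun n => ?_, hA, hB⟩
  induction n with
  | zero =>
    have h0 := trace_commutator_act θ ρ 0
    have e : act (trajectory θ 0) ρ = ρ := rfl
    rw [e, trace_commutator_of_mem h] at h0
    linarith
  | succ n ih =>
    by_cases hn : IsTwistA θ n
    · obtain ⟨h1, h2, h3⟩ := hA n hn
      rw [h1, h2, h3]; linear_combination ih
    · obtain ⟨h1, h2, h3⟩ := hB n hn
      rw [h1, h2, h3]; linear_combination ih

theorem trace_commutator_act_eq (θ : Circle) {ρ : Rep} {c : ℝ} (h : ρ.cls ∈ relCharVar c) (n : ℕ) :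
    (act (trajectory θ n) ρ).trace (genA * genB * genA⁻¹ * genB⁻¹) = c := by
  rw [trace_commutator_act]
  linarith [(twistOrbit_tr θ h).fricke n]

theorem tr_commutator_pair (θ : Circle) {ρ : Rep} {c : ℝ} (h : ρ.cls ∈ relCharVar c) (n : ℕ) :
    tr (pairA θ ρ n * pairB θ ρ n * (pairA θ ρ n)⁻¹ * (pairB θ ρ n)⁻¹) = c := by
  rw [tr_commutator]
  have := (twistOrbit_tr θ h).fricke n
  simp only [trA, trB, trBA] at this
  linarith

/-- Bounds on the traces of the pair give bounds on the trace coordinates. -/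
theorem abs_traceCoords_act_le (θ : Circle) (ρ : Rep) (n : ℕ) {R : ℝ} (hA : |trA θ ρ n| ≤ R)
    (hB : |trB θ ρ n| ≤ R) (hBA : |trBA θ ρ n| ≤ R) (i : Fin 3) :
    |(act (trajectory θ n) ρ).traceCoords i| ≤ R + R ^ 2 := by
  have hR : 0 ≤ R := (abs_nonneg _).trans hA
  have hR2 := sq_nonneg R
  fin_cases i
  · change |(act (trajectory θ n) ρ).trace genA| ≤ _
    rw [trace_act_genA]; linarith
  · change |(act (trajectory θ n) ρ).trace genB| ≤ _
    rw [trace_act_genB]; linarith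
  · change |(act (trajectory θ n) ρ).trace (genA * genB)| ≤ _
    rcases trace_act_mul θ ρ n with h | h <;> rw [h]
    · linarith
    · have h1 := mul_le_mul hA hB (abs_nonneg _) hR
      rw [← abs_mul] at h1
      have h2 := abs_sub (trA θ ρ n * trB θ ρ n) (trBA θ ρ n)
      nlinarith

theorem tendsto_cocompact_of_tr {θ : Circle} {ρ : Rep}
    (h : Tendsto (fun n => |trA θ ρ n| + |trB θ ρ n| + |trBA θ ρ n|) atTop atTop) :
    Tendsto (fun n => (act (trajectory θ n) ρ).cls) atTop (cocompact CharVar) := by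
  rw [hasBasis_cocompact.tendsto_right_iff]
  intro K hK
  obtain ⟨R₁, h1⟩ := exists_trace_le_of_isCompact hK genA
  obtain ⟨R₂, h2⟩ := exists_trace_le_of_isCompact hK genB
  obtain ⟨R₃, h3⟩ := exists_trace_le_of_isCompact hK (genA * genB)
  filter_upwards [h.eventually_gt_atTop (R₁ + R₂ + (R₃ + R₁ * R₂))] with n hn hmem
  have h1 := h1 _ hmem
  have h2 := h2 _ hmem
  have h3 := h3 _ hmem
  rw [trace_act_genA] at h1
  rw [trace_act_genB] at h2
  have h4 := mul_le_mul h1 h2 (abs_nonneg _) ((abs_nonneg _).trans h1)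
  have h5 : 0 ≤ R₁ * R₂ := mul_nonneg ((abs_nonneg _).trans h1) ((abs_nonneg _).trans h2)
  rw [← abs_mul] at h4
  rcases trace_act_mul θ ρ n with h | h <;> rw [h] at h3
  · linarith
  · have h6 := abs_sub (trA θ ρ n * trB θ ρ n) (trA θ ρ n * trB θ ρ n - trBA θ ρ n)
    rw [sub_sub_cancel] at h6
    linarith

/-! ### Transport and Lyapunov exponents -/

/-- The line from `p` in direction `θ`, made to have nonnegative velocity, avoids the lattice. -/
def IsGenericPoint (θ : Circle) (p : ℝ × ℝ) : Prop :=
  AvoidsLattice (reflect (θ : ℂ).re p.1) |(θ : ℂ).re| (reflect (θ : ℂ).im p.2) |(θ : ℂ).im|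

theorem logNorm_zpow_le (A : SL(2, ℝ)) {k : ℤ} (hk : k = 0 ∨ k = 1 ∨ k = -1) :
    logNorm (A ^ k) ≤ logNorm A + logNorm A⁻¹ := by
  have h1 := logNorm_nonneg A
  have h2 := logNorm_nonneg A⁻¹
  rcases hk with rfl | rfl | rfl
  · rw [zpow_zero, logNorm_one]; linarith
  · rw [zpow_one]; linarith
  · rw [zpow_neg_one]; linarith

/-- At each step of the trajectory the parallel transport is, up to a bounded factor, a transport
for the corresponding pair. -/
theorem exists_transport (θ : Circle) (ρ : Rep) (n : ℕ) : ∃ R : ℝ, ∀ p, IsGenericPoint θ p →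
    ∃ (x y : ℝ) (Φ h : ℝ → SL(2, ℝ)),
      AvoidsLattice x (rauzyLengths θ n).1 y (rauzyLengths θ n).2 ∧
      IsTransport x (rauzyLengths θ n).1 y (rauzyLengths θ n).2 (pairA θ ρ n) (pairB θ ρ n) Φ ∧
      ∀ t, ρ.eval (crossingWord θ p t) = h t * Φ t ∧ logNorm (h t) ≤ R ∧
        logNorm (h t)⁻¹ ≤ R := by
  induction n with
  | zero =>
    refine ⟨0, fun p hp => ⟨_, _, fun t => ρ.eval (crossingWord θ p t), fun _ => 1, hp,
      (isTransport_crossingWord θ p hp).map (show Pi1 →* SL(2, ℝ) from ρ), fun t => ?_⟩⟩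
    simp [logNorm_one]
  | succ n ih =>
    obtain ⟨R, hR⟩ := ih
    obtain ⟨hl, hm, hlm⟩ := rauzyLengths_nonneg_pos θ n
    have key : ∀ (A h Φ : SL(2, ℝ)) (k : ℤ), (k = 0 ∨ k = 1 ∨ k = -1) →
        (∀ g, g = h * Φ → g = h * A ^ (-k) * (A ^ k * Φ)) ∧
        (logNorm h ≤ R → logNorm (h * A ^ (-k)) ≤ R + (logNorm A + logNorm A⁻¹)) ∧
        (logNorm h⁻¹ ≤ R → logNorm (h * A ^ (-k))⁻¹ ≤ R + (logNorm A + logNorm A⁻¹)) := by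
      intro A h Φ k hk
      refine ⟨fun g hg => by rw [hg]; group, fun hh => ?_, fun hh => ?_⟩
      · have := logNorm_mul_le h (A ^ (-k))
        have h2 := logNorm_zpow_le A (k := -k) (by omega)
        linarith
      · rw [mul_inv_rev, zpow_neg, inv_inv]
        have := logNorm_mul_le (A ^ k) h⁻¹
        have h2 := logNorm_zpow_le A hk
        linarith
    by_cases hT : IsTwistA θ n
    · obtain ⟨e1, e2⟩ := pair_succ_of_isTwistA ρ hT
      rw [rauzyLengths_succ_of_isTwistA hT, e1, e2]
      refine ⟨R + (logNorm (pairA θ ρ n) + logNorm (pairA θ ρ n)⁻¹), fun p hp => ?_⟩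
      obtain ⟨x, y, Φ, h, hg, htr, hΦ⟩ := hR p hp
      refine ⟨_, _, _, fun t => h t * pairA θ ρ n ^ (-(-side (x + t * (rauzyLengths θ n).1)
        (y + t * (rauzyLengths θ n).2))), hg.shear, htr.twistA hg hm hT hlm, fun t => ?_⟩
      obtain ⟨h1, h2, h3⟩ := hΦ t
      obtain ⟨k1, k2, k3⟩ := key (pairA θ ρ n) (h t) (Φ t) (-side (x + t * (rauzyLengths θ n).1)
        (y + t * (rauzyLengths θ n).2)) (by
          have := side_eq (x + t * (rauzyLengths θ n).1) (y + t * (rauzyLengths θ n).2)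
          omega)
      exact ⟨k1 _ h1, k2 h2, k3 h3⟩
    · obtain ⟨e1, e2⟩ := pair_succ_of_not ρ hT
      rw [rauzyLengths_succ_of_not hT, e1, e2]
      have hT' : (rauzyLengths θ n).1 ≤ (rauzyLengths θ n).2 := (not_le.mp hT).le
      refine ⟨R + (logNorm (pairB θ ρ n) + logNorm (pairB θ ρ n)⁻¹), fun p hp => ?_⟩
      obtain ⟨x, y, Φ, h, hg, htr, hΦ⟩ := hR p hp
      refine ⟨_, _, _, fun t => h t * pairB θ ρ n ^ (-(1 - side (y + t * (rauzyLengths θ n).2)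
        (x + t * (rauzyLengths θ n).1))), hg.swap.shear.swap, htr.twistB hg hl hT' hlm,
        fun t => ?_⟩
      obtain ⟨h1, h2, h3⟩ := hΦ t
      obtain ⟨k1, k2, k3⟩ := key (pairB θ ρ n) (h t) (Φ t)
        (1 - side (y + t * (rauzyLengths θ n).2) (x + t * (rauzyLengths θ n).1)) (by
          have := side_eq (y + t * (rauzyLengths θ n).2) (x + t * (rauzyLengths θ n).1)
          omega)
      exact ⟨k1 _ h1, k2 h2, k3 h3⟩

theorem lintegral_unitSquare_const (C : ℝ≥0∞) :
    ∫⁻ _ in Ico (0 : ℝ) 1 ×ˢ Ico (0 : ℝ) 1, C = C := by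
  rw [setLIntegral_const, Measure.volume_eq_prod, Measure.prod_prod]
  simp

theorem mem_spectrum_of_forall_le {θ : Circle} {ρ : Rep}
    (h : ∀ ε : ℝ, 0 < ε → ∃ C : ℝ, ∀ p, IsGenericPoint θ p → ∀ t, 0 ≤ t →
      logNorm (ρ.eval (crossingWord θ p t)) ≤ C + ε * t) : θ ∈ spectrum ρ := by
  change Tendsto _ _ _
  rw [ENNReal.tendsto_nhds_zero]
  intro ε hε
  obtain ⟨ε', hε', hle⟩ : ∃ ε' : ℝ, 0 < ε' ∧ ENNReal.ofReal (2 * ε') ≤ ε := by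
    rcases eq_or_ne ε ⊤ with rfl | htop
    · exact ⟨1, one_pos, le_top⟩
    · refine ⟨ε.toReal / 2, half_pos (ENNReal.toReal_pos hε.ne' htop), ?_⟩
      rw [mul_div_cancel₀ _ two_ne_zero, ENNReal.ofReal_toReal htop]
  obtain ⟨C, hC⟩ := h ε' hε'
  filter_upwards [eventually_gt_atTop 0, eventually_ge_atTop (C / ε')] with t ht0 htC
  refine le_trans ?_ hle
  have hint : ∫⁻ p in Ico (0 : ℝ) 1 ×ˢ Ico (0 : ℝ) 1,
      ENNReal.ofReal (Real.log (opNorm (ρ.eval (crossingWord θ p t)))) ≤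
      ENNReal.ofReal (C + ε' * t) := by
    rw [← lintegral_unitSquare_const (ENNReal.ofReal (C + ε' * t))]
    refine lintegral_mono_ae (ae_restrict_of_ae ?_)
    filter_upwards [ae_avoidsLattice θ] with p hp
    exact ENNReal.ofReal_le_ofReal (hC p hp t ht0.le)
  refine (ENNReal.div_le_div_right hint _).trans ?_
  rw [← ENNReal.ofReal_div_of_pos ht0]
  apply ENNReal.ofReal_le_ofReal
  rw [div_le_iff₀ ht0]
  have := (div_le_iff₀ hε').mp htC
  linarith

theorem not_mem_spectrum_of_le {θ : Circle} {ρ : Rep} {ε C : ℝ} (hε : 0 < ε)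
    (h : ∀ p, IsGenericPoint θ p → ∀ t, 0 ≤ t →
      ε * t - C ≤ logNorm (ρ.eval (crossingWord θ p t))) : θ ∉ spectrum ρ := by
  intro hmem
  change Tendsto _ _ _ at hmem
  have hpos : (0 : ℝ≥0∞) < ENNReal.ofReal (ε / 2) := ENNReal.ofReal_pos.mpr (half_pos hε)
  obtain ⟨t, ⟨ht0, htC⟩, hlt⟩ := (((eventually_gt_atTop 0).and
    (eventually_ge_atTop (2 * C / ε))).and (hmem.eventually (gt_mem_nhds hpos))).exists
  have hint : ENNReal.ofReal (ε * t - C) ≤ ∫⁻ p in Ico (0 : ℝ) 1 ×ˢ Ico (0 : ℝ) 1,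
      ENNReal.ofReal (Real.log (opNorm (ρ.eval (crossingWord θ p t)))) := by
    rw [← lintegral_unitSquare_const (ENNReal.ofReal (ε * t - C))]
    refine lintegral_mono_ae (ae_restrict_of_ae ?_)
    filter_upwards [ae_avoidsLattice θ] with p hp
    exact ENNReal.ofReal_le_ofReal (h p hp t ht0.le)
  refine absurd hlt (not_lt.mpr (le_trans ?_ (ENNReal.div_le_div_right hint _)))
  rw [← ENNReal.ofReal_div_of_pos ht0]
  apply ENNReal.ofReal_le_ofReal
  rw [le_div_iff₀ ht0]
  have := (div_le_iff₀ hε).mp htC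
  linarith

theorem floor_sub_floor_bounds (x u : ℝ) :
    ((⌊x + u⌋ : ℤ) : ℝ) - ⌊x⌋ ≤ u + 1 ∧ u - 1 ≤ ((⌊x + u⌋ : ℤ) : ℝ) - ⌊x⌋ := by
  have h1 := Int.floor_le x
  have h2 := Int.lt_floor_add_one x
  have h3 := Int.floor_le (x + u)
  have h4 := Int.lt_floor_add_one (x + u)
  constructor <;> linarith

/-- The Lyapunov exponent is bounded by the average of the norms of the generators. -/
theorem exists_logNorm_le (θ : Circle) (ρ : Rep) (n : ℕ) {a : ℝ} (ha : 0 ≤ a)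
    (hA : logNorm (pairA θ ρ n) ≤ a) (hB : logNorm (pairB θ ρ n) ≤ a) :
    ∃ C : ℝ, ∀ p, IsGenericPoint θ p → ∀ t, 0 ≤ t →
      logNorm (ρ.eval (crossingWord θ p t)) ≤
        C + a * ((rauzyLengths θ n).1 + (rauzyLengths θ n).2) * t := by
  obtain ⟨R, hR⟩ := exists_transport θ ρ n
  obtain ⟨hl, hm, hlm⟩ := rauzyLengths_nonneg_pos θ n
  refine ⟨2 * R + 2 * a, fun p hp t ht => ?_⟩
  obtain ⟨x, y, Φ, h, hg, htr, hΦ⟩ := hR p hp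
  have hS := htr.induction hg hl hm hlm
    (fun i j g => logNorm g ≤ logNorm (Φ 0) + a * (i - ⌊x⌋) + a * (j - ⌊y⌋)) (by simp)
    (fun i j g hgS => by
      have := logNorm_mul_le (pairA θ ρ n) g
      push_cast; linarith)
    (fun i j g hgS => by
      have := logNorm_mul_le (pairB θ ρ n) g
      push_cast; linarith) t ht
  have h0 : logNorm (Φ 0) ≤ R := by
    have h1 := (hΦ 0).1
    rw [crossingWord_zero] at h1
    have h2 : Φ 0 = (h 0)⁻¹ := by
      rw [eq_inv_iff_mul_eq_one, mul_eq_one_iff_eq_inv, eq_comm, inv_eq_iff_mul_eq_one, ← h1]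
      exact map_one (show Pi1 →* SL(2, ℝ) from ρ)
    rw [h2]; exact (hΦ 0).2.2
  obtain ⟨h1, h2, -⟩ := hΦ t
  rw [h1]
  have h3 := logNorm_mul_le (h t) (Φ t)
  have h4 := mul_le_mul_of_nonneg_left (floor_sub_floor_bounds x (t * (rauzyLengths θ n).1)).1 ha
  have h5 := mul_le_mul_of_nonneg_left (floor_sub_floor_bounds y (t * (rauzyLengths θ n).2)).1 ha
  beta_reduce at hS
  linarith

theorem le_logNorm_of_grows {P : Matrix (Fin 2) (Fin 2) ℝ} (hP : P.det ≠ 0) {M : SL(2, ℝ)} {s : ℝ}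
    (h : Grows P (Real.exp s) M) : s / 2 - Real.log 2 ≤ logNorm M := by
  have h1 := h.le_tr_sq hP
  have h2 := abs_tr_le_two_mul_opNorm M
  have h3 : Real.exp s ≤ (2 * opNorm M) ^ 2 := by
    refine h1.trans ?_
    rw [← sq_abs]
    gcongr
  have h4 := (Real.le_log_iff_exp_le (by have := opNorm_pos M; positivity)).mpr h3
  rw [Real.log_pow, Real.log_mul two_ne_zero (opNorm_pos M).ne'] at h4
  unfold logNorm
  push_cast at h4
  linarith

/-- A positive configuration on the trajectory makes the Lyapunov exponent positive. -/
theorem not_mem_spectrum_of_grows (θ : Circle) (ρ : Rep) (n : ℕ) {P : Matrix (Fin 2) (Fin 2) ℝ}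
    (hP : P.det ≠ 0) {η : ℝ} (hη : 1 < η) (hA : Grows P η (pairA θ ρ n))
    (hB : Grows P η (pairB θ ρ n)) : θ ∉ spectrum ρ := by
  obtain ⟨R, hR⟩ := exists_transport θ ρ n
  obtain ⟨hl, hm, hlm⟩ := rauzyLengths_nonneg_pos θ n
  have hη0 : 0 < Real.log η := Real.log_pos hη
  have hexp : η = Real.exp (Real.log η) := (Real.exp_log (by linarith)).symm
  refine not_mem_spectrum_of_le (ε := Real.log η * ((rauzyLengths θ n).1 + (rauzyLengths θ n).2) / 2)
    (C := Real.log η + Real.log 2 + 2 * R) (by positivity) (fun p hp t ht => ?_)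
  obtain ⟨x, y, Φ, h, hg, htr, hΦ⟩ := hR p hp
  have hS := htr.induction hg hl hm hlm
    (fun i j g => Grows P (Real.exp (Real.log η * ((i - ⌊x⌋) + (j - ⌊y⌋)))) (g * (Φ 0)⁻¹))
    (by simpa using Grows.one P)
    (fun i j g hgS => by
      have := hA.mul hgS (Real.exp_pos _).le
      rw [hexp, ← Real.exp_add, ← mul_assoc, Real.log_exp] at this
      refine this.mono (le_of_eq ?_)
      push_cast; ring_nf)
    (fun i j g hgS => by
      have := hB.mul hgS (Real.exp_pos _).le
      rw [hexp, ← Real.exp_add, ← mul_assoc, Real.log_exp] at this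
      refine this.mono (le_of_eq ?_)
      push_cast; ring_nf) t ht
  have h0 : logNorm (Φ 0)⁻¹ ≤ R := by
    have h1 := (hΦ 0).1
    rw [crossingWord_zero] at h1
    have h2 : (Φ 0)⁻¹ = h 0 := by
      rw [inv_eq_iff_mul_eq_one, mul_eq_one_iff_eq_inv, eq_comm, inv_eq_iff_mul_eq_one, ← h1]
      exact map_one (show Pi1 →* SL(2, ℝ) from ρ)
    rw [h2]; exact (hΦ 0).2.1
  obtain ⟨h1, -, h2⟩ := hΦ t
  have h3 := le_logNorm_of_grows hP hS
  have h4 := logNorm_mul_le (Φ t) (Φ 0)⁻¹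
  have h5 : logNorm (Φ t) ≤ R + logNorm (ρ.eval (crossingWord θ p t)) := by
    have h6 : Φ t = (h t)⁻¹ * ρ.eval (crossingWord θ p t) := by rw [h1]; group
    have h7 := logNorm_mul_le (h t)⁻¹ (ρ.eval (crossingWord θ p t))
    rw [← h6] at h7
    linarith
  have h8 := mul_le_mul_of_nonneg_left
    (floor_sub_floor_bounds x (t * (rauzyLengths θ n).1)).2 hη0.le
  have h9 := mul_le_mul_of_nonneg_left
    (floor_sub_floor_bounds y (t * (rauzyLengths θ n).2)).2 hη0.le
  linarith

/-! ### Irrational directions: growth -/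

/-- After a positive configuration, the growth of the pair is exponential in the length of the
words. -/
theorem exists_exp_le_tr_sq {θ : Circle} {ρ : Rep}
    (hT : ∀ n, ∃ m ≥ n, ¬ (IsTwistA θ m ↔ IsTwistA θ (m + 1))) {n₀ : ℕ}
    {P : Matrix (Fin 2) (Fin 2) ℝ} {η : ℝ} (hP : P.det ≠ 0) (hη : 1 < η)
    (hA : Grows P 1 (pairA θ ρ n₀)) (hB : Grows P 1 (pairB θ ρ n₀))
    (hBA : Grows P η (pairB θ ρ n₀ * pairA θ ρ n₀)) :
    θ ∉ spectrum ρ ∧ ∃ s : ℝ, 0 < s ∧ ∃ n₁, ∀ n ≥ n₁,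
      Real.exp (s * (wordLength θ n).1) ≤ trA θ ρ n ^ 2 ∧
      Real.exp (s * (wordLength θ n).2) ≤ trB θ ρ n ^ 2 := by
  have hall : ∀ n ≥ n₀, Grows P 1 (pairA θ ρ n) ∧ Grows P 1 (pairB θ ρ n) ∧
      Grows P η (pairB θ ρ n * pairA θ ρ n) := by
    intro n hn
    induction n, hn using Nat.le_induction with
    | base => exact ⟨hA, hB, hBA⟩
    | succ n hn ih =>
      obtain ⟨h1, h2, h3⟩ := ih
      by_cases h : IsTwistA θ n
      · obtain ⟨e1, e2⟩ := pair_succ_of_isTwistA ρ h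
        rw [e1, e2]
        exact ⟨h1, h3.mono hη.le, by simpa using h3.mul h1 zero_le_one⟩
      · obtain ⟨e1, e2⟩ := pair_succ_of_not ρ h
        rw [e1, e2]
        exact ⟨h3.mono hη.le, h2, by simpa using h2.mul h3 (by linarith)⟩
  have hkeepA : ∀ m ≥ n₀, Grows P η (pairA θ ρ m) → ∀ n ≥ m, Grows P η (pairA θ ρ n) := by
    intro m hm h n hn
    induction n, hn using Nat.le_induction with
    | base => exact h
    | succ n hn ih =>
      by_cases h : IsTwistA θ n
      · rw [(pair_succ_of_isTwistA ρ h).1]; exact ih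
      · rw [(pair_succ_of_not ρ h).1]; exact (hall n (hm.trans hn)).2.2
  have hkeepB : ∀ m ≥ n₀, Grows P η (pairB θ ρ m) → ∀ n ≥ m, Grows P η (pairB θ ρ n) := by
    intro m hm h n hn
    induction n, hn using Nat.le_induction with
    | base => exact h
    | succ n hn ih =>
      by_cases h : IsTwistA θ n
      · rw [(pair_succ_of_isTwistA ρ h).2]; exact (hall n (hm.trans hn)).2.2
      · rw [(pair_succ_of_not ρ h).2]; exact ih
  obtain ⟨n₁, h1A, h1B⟩ : ∃ n₁, Grows P η (pairA θ ρ n₁) ∧ Grows P η (pairB θ ρ n₁) := by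
    obtain ⟨m, hm, hch⟩ := hT n₀
    have hm' := hall m hm
    have hm'' := hall (m + 1) (by omega)
    refine ⟨m + 2, ?_⟩
    by_cases h : IsTwistA θ m
    · have h' : ¬ IsTwistA θ (m + 1) := by tauto
      have h2 : Grows P η (pairB θ ρ (m + 1)) := by
        rw [(pair_succ_of_isTwistA ρ h).2]; exact hm'.2.2
      exact ⟨by rw [(pair_succ_of_not ρ h').1]; exact hm''.2.2,
        hkeepB _ (by omega) h2 _ (by omega)⟩
    · have h' : IsTwistA θ (m + 1) := by tauto
      have h2 : Grows P η (pairA θ ρ (m + 1)) := by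
        rw [(pair_succ_of_not ρ h).1]; exact hm'.2.2
      exact ⟨hkeepA _ (by omega) h2 _ (by omega),
        by rw [(pair_succ_of_isTwistA ρ h').2]; exact hm''.2.2⟩
  refine ⟨not_mem_spectrum_of_grows θ ρ n₁ hP hη h1A h1B, ?_⟩
  have hlog := Real.log_pos hη
  set W : ℝ := (wordLength θ n₁).1 + (wordLength θ n₁).2 + 1 with hW
  have hW0 : 0 < W := by positivity
  have hgrow : ∀ n ≥ n₁, Grows P (Real.exp (Real.log η / W * (wordLength θ n).1)) (pairA θ ρ n) ∧
      Grows P (Real.exp (Real.log η / W * (wordLength θ n).2)) (pairB θ ρ n) := by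
    intro n hn
    induction n, hn using Nat.le_induction with
    | base =>
      have key : ∀ w : ℝ, w ≤ W → Real.exp (Real.log η / W * w) ≤ η := by
        intro w hw
        rw [← Real.le_log_iff_exp_le (by linarith)]
        calc Real.log η / W * w ≤ Real.log η / W * W := by gcongr
          _ = Real.log η := div_mul_cancel₀ _ hW0.ne'
      refine ⟨h1A.mono (key _ ?_), h1B.mono (key _ ?_)⟩ <;> rw [hW]
      · have : (0 : ℝ) ≤ (wordLength θ n₁).2 := by positivity
        linarith
      · have : (0 : ℝ) ≤ (wordLength θ n₁).1 := by positivity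
        linarith
    | succ n hn ih =>
      have hBA : Grows P (Real.exp (Real.log η / W * ((wordLength θ n).1 + (wordLength θ n).2)))
          (pairB θ ρ n * pairA θ ρ n) := by
        refine (ih.2.mul ih.1 (Real.exp_pos _).le).mono (le_of_eq ?_)
        rw [← Real.exp_add]; ring_nf
      by_cases h : IsTwistA θ n
      · obtain ⟨e1, e2⟩ := pair_succ_of_isTwistA ρ h
        rw [e1, e2, wordLength, if_pos h]
        exact ⟨ih.1, by push_cast; exact hBA⟩
      · obtain ⟨e1, e2⟩ := pair_succ_of_not ρ h
        rw [e1, e2, wordLength, if_neg h]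
        exact ⟨by push_cast; exact hBA, ih.2⟩
  exact ⟨Real.log η / W, by positivity, n₁, fun n hn =>
    ⟨(hgrow n hn).1.le_tr_sq hP, (hgrow n hn).2.le_tr_sq hP⟩⟩

theorem add_two_le_wordLength (θ : Circle) (n : ℕ) :
    1 ≤ (wordLength θ n).1 ∧ 1 ≤ (wordLength θ n).2 ∧
      n + 2 ≤ (wordLength θ n).1 + (wordLength θ n).2 := by
  induction n with
  | zero => simp [wordLength]
  | succ n ih =>
    rw [wordLength]
    split_ifs <;> refine ⟨?_, ?_, ?_⟩ <;> simp only <;> omega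

/-- A norm on `ℝⁿ` is bounded below by a multiple of the supremum norm. -/
theorem exists_mul_norm_le_seminorm {ι : Type*} [Fintype ι] (N : Seminorm ℝ (ι → ℝ))
    (hN : ∀ w, N w = 0 → w = 0) : ∃ k : ℝ, 0 < k ∧ ∀ w, k * ‖w‖ ≤ N w := by
  have hcont : Continuous N := N.convexOn.locallyLipschitz.continuous
  rcases (Metric.sphere (0 : ι → ℝ) 1).eq_empty_or_nonempty with he | hne
  · refine ⟨1, one_pos, fun w => ?_⟩
    have hw : w = 0 := by
      by_contra hw
      have : ‖w‖⁻¹ • w ∈ Metric.sphere (0 : ι → ℝ) 1 := by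
        rw [mem_sphere_zero_iff_norm, norm_smul, norm_inv, norm_norm,
          inv_mul_cancel₀ (norm_ne_zero_iff.mpr hw)]
      rw [he] at this
      exact this
    rw [hw]; simp
  · obtain ⟨v, hv, hmin⟩ := (isCompact_sphere (0 : ι → ℝ) 1).exists_isMinOn hne hcont.continuousOn
    have hv0 : v ≠ 0 := fun h => by simp [h] at hv
    refine ⟨N v, lt_of_le_of_ne (apply_nonneg N v) fun h => hv0 (hN v h.symm), fun w => ?_⟩
    rcases eq_or_ne w 0 with rfl | hw
    · simp
    have hw' : 0 < ‖w‖ := norm_pos_iff.mpr hw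
    have hmem : ‖w‖⁻¹ • w ∈ Metric.sphere (0 : ι → ℝ) 1 := by
      rw [mem_sphere_zero_iff_norm, norm_smul, norm_inv, norm_norm, inv_mul_cancel₀ hw'.ne']
    have h := hmin hmem
    simp only [mem_ofPred_eq, map_smul_eq_mul, norm_inv, norm_norm] at h
    rwa [← div_eq_inv_mul, le_div_iff₀ hw'] at h

/-- Exponential growth of the traces along an irrational direction, in the length of the words. -/
theorem exists_exp_wordLength_le {θ : Circle} {ρ : Rep} {s : ℝ} (hs : 0 < s) {n₁ : ℕ}
    (h : ∀ n ≥ n₁, Real.exp (s * (wordLength θ n).1) ≤ trA θ ρ n ^ 2 ∧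
      Real.exp (s * (wordLength θ n).2) ≤ trB θ ρ n ^ 2) {k : ℝ} (hk : 0 < k) :
    ∀ᶠ n in atTop,
      Real.exp (s / 4 * (max (wordLength θ n).1 (wordLength θ n).2 : ℕ)) ≤
        k * max |trA θ ρ n| |trB θ ρ n| := by
  filter_upwards [eventually_ge_atTop n₁,
    eventually_ge_atTop ⌈-Real.log k / (s / 8)⌉₊] with n hn hn'
  obtain ⟨h1, h2⟩ := h n hn
  obtain ⟨-, -, h3⟩ := add_two_le_wordLength θ n
  have key : ∀ w x : ℝ, Real.exp (s * w) ≤ x ^ 2 → Real.exp (s / 2 * w) ≤ |x| := by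
    intro w x hx
    apply le_of_sq_le_sq _ (abs_nonneg x)
    rw [sq_abs, ← Real.exp_nat_mul]
    refine (le_of_eq ?_).trans hx
    push_cast; ring_nf
  have h4 : Real.exp (s / 2 * (max (wordLength θ n).1 (wordLength θ n).2 : ℕ)) ≤
      max |trA θ ρ n| |trB θ ρ n| := by
    rcases max_choice (wordLength θ n).1 (wordLength θ n).2 with e | e <;> rw [e]
    · exact (key _ _ h1).trans (le_max_left _ _)
    · exact (key _ _ h2).trans (le_max_right _ _)
  have h5 : (n : ℝ) ≤ 2 * (max (wordLength θ n).1 (wordLength θ n).2 : ℕ) := by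
    have : n ≤ 2 * max (wordLength θ n).1 (wordLength θ n).2 := by omega
    exact_mod_cast this
  have h6 : -Real.log k ≤ s / 8 * n := by
    have := (Nat.le_ceil _).trans (Nat.cast_le.mpr hn')
    rwa [div_le_iff₀ (by positivity), mul_comm] at this
  refine le_trans ?_ (mul_le_mul_of_nonneg_left h4 hk.le)
  rw [← Real.exp_log hk, ← Real.exp_add, Real.exp_le_exp]
  have h7 := mul_le_mul_of_nonneg_left h5 (show 0 ≤ s / 8 by positivity)
  linarith

theorem max_abs_tr_le_norm_traceCoords (θ : Circle) (ρ : Rep) (n : ℕ) :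
    max |trA θ ρ n| |trB θ ρ n| ≤ ‖(act (trajectory θ n) ρ).traceCoords‖ := by
  have h0 := norm_le_pi_norm (act (trajectory θ n) ρ).traceCoords 0
  have h1 := norm_le_pi_norm (act (trajectory θ n) ρ).traceCoords 1
  have e0 : (act (trajectory θ n) ρ).traceCoords 0 = trA θ ρ n := trace_act_genA θ ρ n
  have e1 : (act (trajectory θ n) ρ).traceCoords 1 = trB θ ρ n := trace_act_genB θ ρ n
  rw [e0, Real.norm_eq_abs] at h0
  rw [e1, Real.norm_eq_abs] at h1
  exact max_le h0 h1

theorem tendsto_accelTime {θ : Circle} (h : Irrational (rotationAngle θ)) :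
    Tendsto (accelTime (rotationAngle θ)) atTop atTop :=
  tendsto_atTop_mono (le_accelTime h) tendsto_id

/-- The conclusions of the escape along an irrational direction. -/
theorem growth_of_irrational {θ : Circle} {ρ : Rep} (h : Irrational (rotationAngle θ)) {s : ℝ}
    (hs : 0 < s) {n₁ : ℕ}
    (hgrow : ∀ n ≥ n₁, Real.exp (s * (wordLength θ n).1) ≤ trA θ ρ n ^ 2 ∧
      Real.exp (s * (wordLength θ n).2) ≤ trB θ ρ n ^ 2) :
    Tendsto (fun n : ℕ => (act (trajectory θ n) ρ).cls) atTop (cocompact CharVar) ∧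
      ∀ N : Seminorm ℝ (Fin 3 → ℝ), (∀ w, N w = 0 → w = 0) →
        (∃ C : ℝ, 0 < C ∧ ∀ᶠ n : ℕ in atTop,
          Real.exp (C * n) ≤ N (act (trajectory θ n) ρ).traceCoords) ∧
        (∃ C : ℝ, 0 < C ∧ ∀ᶠ n : ℕ in atTop,
          Real.exp (C * cfDenom (rotationAngle θ) n) ≤
            N (act (trajectory θ (accelTime (rotationAngle θ) n)) ρ).traceCoords) := by
  have hlin : ∀ n : ℕ, s / 8 * n ≤ s / 4 * (max (wordLength θ n).1 (wordLength θ n).2 : ℕ) := by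
    intro n
    have h3 := (add_two_le_wordLength θ n).2.2
    have h5 : (n : ℝ) ≤ 2 * (max (wordLength θ n).1 (wordLength θ n).2 : ℕ) := by
      have : n ≤ 2 * max (wordLength θ n).1 (wordLength θ n).2 := by omega
      exact_mod_cast this
    have h7 := mul_le_mul_of_nonneg_left h5 (show 0 ≤ s / 8 by positivity)
    linarith
  constructor
  · apply tendsto_cocompact_of_tr
    refine tendsto_atTop_mono' atTop ?_ (Real.tendsto_exp_atTop.comp
      (tendsto_natCast_atTop_atTop.const_mul_atTop (show 0 < s / 8 by positivity)))
    filter_upwards [exists_exp_wordLength_le hs hgrow one_pos] with n hn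
    have h1 := Real.exp_le_exp.mpr (hlin n)
    have h2 := abs_nonneg (trA θ ρ n)
    have h3 := abs_nonneg (trB θ ρ n)
    have h4 := abs_nonneg (trBA θ ρ n)
    have h5 := max_le_add_of_nonneg h2 h3
    simp only [Function.comp]
    linarith
  · intro N hN
    obtain ⟨k, hk, hkN⟩ := exists_mul_norm_le_seminorm N hN
    have hev := exists_exp_wordLength_le hs hgrow hk
    have hle : ∀ n, k * max |trA θ ρ n| |trB θ ρ n| ≤ N (act (trajectory θ n) ρ).traceCoords :=
      fun n => (mul_le_mul_of_nonneg_left (max_abs_tr_le_norm_traceCoords θ ρ n) hk.le).trans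
        (hkN _)
    refine ⟨⟨s / 8, by positivity, ?_⟩, ⟨s / 4, by positivity, ?_⟩⟩
    · filter_upwards [hev] with n hn
      exact (Real.exp_le_exp.mpr (hlin n)).trans (hn.trans (hle n))
    · filter_upwards [(tendsto_accelTime h).eventually hev] with m hm
      refine le_trans (Real.exp_le_exp.mpr ?_) (hm.trans (hle _))
      have := cfDenom_le_wordLength h m
      gcongr

/-! ### Irrational directions: boundedness -/

/-- Bounded coefficients make the norms of the pair grow at most exponentially with time. -/
theorem exists_logNorm_pair_le {θ : Circle} {ρ : Rep} {R : ℝ} (hR : 0 ≤ R) {n₁ : ℕ}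
    (h : ∀ n ≥ n₁, |TwistOrbit.coeff (IsTwistA θ) (trA θ ρ) (trB θ ρ) n| ≤ R) :
    ∃ C : ℝ, 0 < C ∧ ∀ n ≥ n₁, 1 ≤ n →
      logNorm (pairA θ ρ n) ≤ C * n ∧ logNorm (pairB θ ρ n) ≤ C * n := by
  set D : ℝ := max (opNorm (pairA θ ρ n₁)) (max (opNorm (pairB θ ρ n₁))
    (opNorm (pairB θ ρ n₁ * pairA θ ρ n₁))) with hD
  have hD1 : 1 ≤ D := (one_le_opNorm _).trans (le_max_left _ _)
  have hall : ∀ n ≥ n₁, opNorm (pairA θ ρ n) ≤ D * (R + 1) ^ n ∧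
      opNorm (pairB θ ρ n) ≤ D * (R + 1) ^ n ∧
      opNorm (pairB θ ρ n * pairA θ ρ n) ≤ D * (R + 1) ^ n := by
    intro n hn
    induction n, hn using Nat.le_induction with
    | base =>
      have h1 : D ≤ D * (R + 1) ^ n₁ :=
        le_mul_of_one_le_right (by linarith) (one_le_pow₀ (by linarith))
      exact ⟨(le_max_left _ _).trans h1, ((le_max_left _ _).trans (le_max_right _ _)).trans h1,
        ((le_max_right _ _).trans (le_max_right _ _)).trans h1⟩
    | succ n hn ih =>
      obtain ⟨h1, h2, h3⟩ := ih
      have hc := h n hn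
      have hE : 0 ≤ D * (R + 1) ^ n := by positivity
      have hle : D * (R + 1) ^ n ≤ D * (R + 1) ^ (n + 1) := by
        rw [pow_succ]; nlinarith
      have hstep : ∀ a b c : ℝ, |a| ≤ R → 0 ≤ b → b ≤ D * (R + 1) ^ n → c ≤ D * (R + 1) ^ n →
          |a| * b + c ≤ D * (R + 1) ^ (n + 1) := by
        intro a b c ha hb0 hb hc
        have h4 := mul_le_mul ha hb hb0 hR
        rw [pow_succ]; linarith
      by_cases hT : IsTwistA θ n
      · obtain ⟨e1, e2⟩ := pair_succ_of_isTwistA ρ hT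
        rw [e1, e2]
        rw [TwistOrbit.coeff, if_pos hT] at hc
        exact ⟨h1.trans hle, h3.trans hle, (opNorm_le_of_coe_eq _ _ _ _ (coe_mul_sq _ _)).trans
          (hstep _ _ _ hc (opNorm_nonneg _) h3 h2)⟩
      · obtain ⟨e1, e2⟩ := pair_succ_of_not ρ hT
        rw [e1, e2]
        rw [TwistOrbit.coeff, if_neg hT] at hc
        exact ⟨h3.trans hle, h2.trans hle, (opNorm_le_of_coe_eq _ _ _ _ (coe_sq_mul _ _)).trans
          (hstep _ _ _ hc (opNorm_nonneg _) h3 h1)⟩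
  have hlog : 0 ≤ Real.log (R + 1) := Real.log_nonneg (by linarith)
  have hlogD : 0 ≤ Real.log D := Real.log_nonneg hD1
  refine ⟨Real.log D + Real.log (R + 1) + 1, by linarith, fun n hn hn1 => ?_⟩
  have hn1' : (1 : ℝ) ≤ n := by exact_mod_cast hn1
  have key : ∀ M : SL(2, ℝ), opNorm M ≤ D * (R + 1) ^ n →
      logNorm M ≤ (Real.log D + Real.log (R + 1) + 1) * n := by
    intro M hM
    have h1 := Real.log_le_log (opNorm_pos M) hM
    rw [Real.log_mul (by linarith) (by positivity), Real.log_pow] at h1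
    unfold logNorm
    nlinarith
  exact ⟨key _ (hall n hn).1, key _ (hall n hn).2.1⟩

theorem mem_spectrum_of_coeff_le {θ : Circle} {ρ : Rep}
    (hT : ∀ n, ∃ m ≥ n, ¬ (IsTwistA θ m ↔ IsTwistA θ (m + 1))) {R : ℝ} (hR : 0 ≤ R) {n₁ : ℕ}
    (h : ∀ n ≥ n₁, |TwistOrbit.coeff (IsTwistA θ) (trA θ ρ) (trB θ ρ) n| ≤ R) :
    θ ∈ spectrum ρ := by
  obtain ⟨C, hC, hle⟩ := exists_logNorm_pair_le hR h
  refine mem_spectrum_of_forall_le fun ε hε => ?_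
  obtain ⟨n, hn, hlen⟩ := exists_mul_length_le θ hT (div_pos hε hC) (max n₁ 1)
  obtain ⟨hA, hB⟩ := hle n ((le_max_left _ _).trans hn) ((le_max_right _ _).trans hn)
  obtain ⟨C', hC'⟩ := exists_logNorm_le θ ρ n (a := C * n) (by positivity) hA hB
  refine ⟨C', fun p hp t ht => (hC' p hp t ht).trans ?_⟩
  rw [le_div_iff₀ hC] at hlen
  have : C * n * ((rauzyLengths θ n).1 + (rauzyLengths θ n).2) ≤ ε := by linarith
  gcongr

/-- One step of the recursion for the bound on the traces. -/
noncomputable def nextBound (κ R : ℝ) : ℝ := R ^ 2 + √(R ^ 4 + κ)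

theorem le_nextBound {κ R : ℝ} (hR : 2 ≤ R) : R ≤ nextBound κ R := by
  have := Real.sqrt_nonneg (R ^ 4 + κ)
  unfold nextBound; nlinarith

theorem TwistOrbit.abs_succ_le {κ : ℝ} {T : ℕ → Prop} {x y z : ℕ → ℝ} (h : TwistOrbit κ T x y z)
    {R : ℝ} (hR : 2 ≤ R) {n : ℕ} (hx : |x n| ≤ R) (hy : |y n| ≤ R) :
    |x (n + 1)| ≤ nextBound κ R ∧ |y (n + 1)| ≤ nextBound κ R := by
  have hz := h.abs_z_le hR n hx hy
  have hle := le_nextBound (κ := κ) hR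
  by_cases hT : T n
  · obtain ⟨h1, h2, -⟩ := h.stepA n hT
    rw [h1, h2]; exact ⟨hx.trans hle, hz⟩
  · obtain ⟨h1, h2, -⟩ := h.stepB n hT
    rw [h1, h2]; exact ⟨hz, hy.trans hle⟩

theorem TwistOrbit.exists_abs_add_le {κ : ℝ} {T : ℕ → Prop} {x y z : ℕ → ℝ}
    (h : TwistOrbit κ T x y z) (R : ℝ) (m : ℕ) : ∃ R', ∀ n, |x n| ≤ R → |y n| ≤ R →
      ∀ j ≤ m, |x (n + j)| ≤ R' ∧ |y (n + j)| ≤ R' := by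
  suffices ∃ R', 2 ≤ R' ∧ ∀ n, |x n| ≤ R → |y n| ≤ R →
      ∀ j ≤ m, |x (n + j)| ≤ R' ∧ |y (n + j)| ≤ R' from this.imp fun _ h => h.2
  induction m with
  | zero =>
    refine ⟨max R 2, le_max_right _ _, fun n hx hy j hj => ?_⟩
    obtain rfl : j = 0 := by omega
    exact ⟨hx.trans (le_max_left _ _), hy.trans (le_max_left _ _)⟩
  | succ m ih =>
    obtain ⟨R', hR', hb⟩ := ih
    refine ⟨nextBound κ R', hR'.trans (le_nextBound hR'), fun n hx hy j hj => ?_⟩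
    rcases Nat.lt_or_ge m j with hlt | hle
    · obtain rfl : j = m + 1 := by omega
      obtain ⟨h1, h2⟩ := hb n hx hy m le_rfl
      exact h.abs_succ_le hR' h1 h2
    · obtain ⟨h1, h2⟩ := hb n hx hy j hle
      exact ⟨h1.trans (le_nextBound hR'), h2.trans (le_nextBound hR')⟩

theorem exists_accelTime_le {θ : Circle} (h : Irrational (rotationAngle θ)) (m₀ n : ℕ)
    (hn : accelTime (rotationAngle θ) m₀ ≤ n) : ∃ m ≥ m₀, ∃ j < cfDigit (rotationAngle θ) m,
      n = accelTime (rotationAngle θ) m + j := by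
  induction n, hn using Nat.le_induction with
  | base => exact ⟨m₀, le_rfl, 0, cfDigit_pos h m₀, rfl⟩
  | succ n hn ih =>
    obtain ⟨m, hm, j, hj, rfl⟩ := ih
    rcases Nat.lt_or_ge (j + 1) (cfDigit (rotationAngle θ) m) with hlt | hge
    · exact ⟨m, hm, j + 1, hlt, rfl⟩
    · exact ⟨m + 1, by omega, 0, cfDigit_pos h _, by rw [accelTime_succ]; omega⟩

/-- At the acceleration times, an orbit that never escapes is bounded in terms of `κ` only. -/
theorem eventually_accelTime_bounded {θ : Circle} (h : Irrational (rotationAngle θ)) {κ : ℝ}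
    (hκ : 0 < κ) {x y z : ℕ → ℝ} (ho : TwistOrbit κ (IsTwistA θ) x y z)
    (hE : ∀ n, ¬ Escaping (x n) (y n) (z n)) :
    ∃ m₀, ∀ m ≥ m₀,
      |x (accelTime (rotationAngle θ) m)| ≤ nextBound κ (2 + √(4 + κ)) ∧
      |y (accelTime (rotationAngle θ) m)| ≤ nextBound κ (2 + √(4 + κ)) := by
  obtain ⟨n₁, hn₁⟩ := ho.eventually_bounded_at_change hκ hE (exists_change h)
  refine ⟨n₁ + 2, fun m hm => ?_⟩
  have h1 := le_accelTime h m
  obtain ⟨m, rfl⟩ : ∃ m', m = m' + 1 := ⟨m - 1, by omega⟩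
  obtain ⟨n, hn⟩ : ∃ n, accelTime (rotationAngle θ) (m + 1) = n + 2 :=
    ⟨accelTime (rotationAngle θ) (m + 1) - 2, by omega⟩
  obtain ⟨h2, h3⟩ := hn₁ n (by omega) (not_isTwistA_iff_of_accelTime h hn)
  rw [hn]
  exact ho.abs_succ_le (by linarith [Real.sqrt_nonneg (4 + κ)]) h2 h3

theorem exists_abs_le_of_cfDigit_le {θ : Circle} (h : Irrational (rotationAngle θ)) {κ : ℝ}
    (hκ : 0 < κ) {x y z : ℕ → ℝ} (ho : TwistOrbit κ (IsTwistA θ) x y z)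
    (hE : ∀ n, ¬ Escaping (x n) (y n) (z n)) {M : ℕ}
    (hM : ∀ n, cfDigit (rotationAngle θ) n ≤ M) :
    ∃ R, ∀ n, |x n| ≤ R ∧ |y n| ≤ R := by
  obtain ⟨m₀, hm₀⟩ := eventually_accelTime_bounded h hκ ho hE
  obtain ⟨R, hR⟩ := ho.exists_abs_add_le (nextBound κ (2 + √(4 + κ))) M
  have hev : ∀ n ≥ accelTime (rotationAngle θ) m₀, max |x n| |y n| ≤ R := by
    intro n hn
    obtain ⟨m, hm, j, hj, rfl⟩ := exists_accelTime_le h m₀ n hn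
    obtain ⟨h1, h2⟩ := hm₀ m hm
    obtain ⟨h3, h4⟩ := hR _ h1 h2 j (hj.le.trans (hM m))
    exact max_le h3 h4
  have hbdd : BddAbove (range fun n => max |x n| |y n|) :=
    (isBoundedUnder_of_eventually_le (eventually_atTop.mpr ⟨_, hev⟩)).bddAbove_range
  obtain ⟨R', hR'⟩ := hbdd
  refine ⟨R', fun n => ?_⟩
  have := hR' (mem_range_self n)
  exact ⟨(le_max_left _ _).trans this, (le_max_right _ _).trans this⟩

/-! ### Rational directions -/

theorem exists_iterate_rauzyStep_eq_zero {g : ℝ} (hg : 0 < g) (k : ℕ) :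
    ∀ i j : ℕ, i + j ≤ k → ∃ n, (rauzyStep^[n] (i * g, j * g)).1 = 0 ∨
      (rauzyStep^[n] (i * g, j * g)).2 = 0 := by
  induction k with
  | zero => exact fun i j hij => ⟨0, Or.inl (by simp [show i = 0 by omega])⟩
  | succ k ih =>
    intro i j hij
    rcases Nat.eq_zero_or_pos i with rfl | hi
    · exact ⟨0, by simp⟩
    rcases Nat.eq_zero_or_pos j with rfl | hj
    · exact ⟨0, by simp⟩
    rcases le_or_gt j i with hji | hij'
    · obtain ⟨n, hn⟩ := ih (i - j) j (by omega)
      refine ⟨n + 1, ?_⟩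
      have e : rauzyStep (i * g, j * g) = (((i - j : ℕ) : ℝ) * g, j * g) := by
        rw [rauzyStep_of_le (by simp only; gcongr)]
        push_cast [Nat.cast_sub hji]
        rw [sub_mul]
      rwa [Function.iterate_succ_apply, e]
    · obtain ⟨n, hn⟩ := ih i (j - i) (by omega)
      refine ⟨n + 1, ?_⟩
      have e : rauzyStep (i * g, j * g) = (i * g, ((j - i : ℕ) : ℝ) * g) := by
        rw [rauzyStep_of_not_le (by simp only [not_le]; gcongr)]
        push_cast [Nat.cast_sub hij'.le]
        rw [sub_mul]
      rwa [Function.iterate_succ_apply, e]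

theorem exists_rauzyLengths_eq_zero {θ : Circle} (h : ¬ Irrational (rotationAngle θ)) :
    ∃ n, (rauzyLengths θ n).1 = 0 ∨ (rauzyLengths θ n).2 = 0 := by
  rw [Irrational, not_not] at h
  obtain ⟨r, hr⟩ := h
  have hs := circle_abs_add_pos θ
  have h0 : 0 ≤ rotationAngle θ := div_nonneg (abs_nonneg _) hs.le
  have h1 : rotationAngle θ ≤ 1 :=
    div_le_one_of_le₀ (le_add_of_nonneg_left (abs_nonneg _)) hs.le
  have hr0 : 0 ≤ r := by rw [← hr] at h0; exact_mod_cast h0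
  have hr1 : r ≤ 1 := by rw [← hr] at h1; exact_mod_cast h1
  have hnum : r.num.toNat ≤ r.den := by
    have := Rat.num_le_denom_iff.mpr hr1
    omega
  set S := |(θ : ℂ).re| + |(θ : ℂ).im| with hS
  have hden : (0 : ℝ) < r.den := by exact_mod_cast r.den_pos
  have hnumR : ((r.num.toNat : ℕ) : ℝ) = (r : ℝ) * r.den := by
    have h2 : ((r.num.toNat : ℤ)) = r.num := Int.toNat_of_nonneg (Rat.num_nonneg.mpr hr0)
    have h3 : r * r.den = r.num := Rat.mul_den_eq_num r
    have h4 : ((r.num.toNat : ℕ) : ℚ) = r * r.den := by rw [h3]; exact_mod_cast h2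
    exact_mod_cast h4
  have him : |(θ : ℂ).im| = r.num.toNat * (S / r.den) := by
    rw [hnumR, hr]
    rw [rotationAngle, ← hS]
    field_simp
  have hre : |(θ : ℂ).re| = (r.den - r.num.toNat : ℕ) * (S / r.den) := by
    rw [Nat.cast_sub hnum, sub_mul, ← him, mul_div_cancel₀ _ hden.ne', hS]
    ring
  obtain ⟨n, hn⟩ := exists_iterate_rauzyStep_eq_zero (div_pos hs hden) _
    (r.den - r.num.toNat) r.num.toNat le_rfl
  refine ⟨n, ?_⟩
  rw [rauzyLengths, hre, him]
  exact hn

theorem isTwistA_of_snd_eq_zero {θ : Circle} {n₁ : ℕ} (h : (rauzyLengths θ n₁).2 = 0) :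
    ∀ n ≥ n₁, IsTwistA θ n := by
  have hall : ∀ n ≥ n₁, (rauzyLengths θ n).2 = 0 := by
    intro n hn
    induction n, hn using Nat.le_induction with
    | base => exact h
    | succ n hn ih =>
      have hT : IsTwistA θ n := by
        rw [IsTwistA, ih]; exact (rauzyLengths_nonneg_pos θ n).1
      rw [rauzyLengths_succ_of_isTwistA hT]; exact ih
  intro n hn
  rw [IsTwistA, hall n hn]; exact (rauzyLengths_nonneg_pos θ n).1

theorem not_isTwistA_of_fst_eq_zero {θ : Circle} {n₁ : ℕ} (h : (rauzyLengths θ n₁).1 = 0) :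
    ∀ n ≥ n₁, ¬ IsTwistA θ n := by
  have hnot : ∀ n, (rauzyLengths θ n).1 = 0 → ¬ IsTwistA θ n := by
    intro n hn hT
    have h3 := (rauzyLengths_nonneg_pos θ n).2.2
    rw [IsTwistA] at hT
    linarith
  have hall : ∀ n ≥ n₁, (rauzyLengths θ n).1 = 0 := by
    intro n hn
    induction n, hn using Nat.le_induction with
    | base => exact h
    | succ n hn ih => rw [rauzyLengths_succ_of_not (hnot n ih)]; exact ih
  exact fun n hn => hnot n (hall n hn)

/-! ### Powers of a matrix -/

theorem sq_le_of_quadratic_le {x u v Q : ℝ} (hx : |x| < 2) (h : u ^ 2 + v ^ 2 - x * u * v = Q) :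
    |u| ≤ √(4 * Q / (4 - x ^ 2)) := by
  have hx2 : 0 < 4 - x ^ 2 := by
    have := sq_lt_sq.mpr (show |x| < |2| by rwa [abs_two])
    linarith
  apply Real.abs_le_sqrt
  rw [le_div_iff₀ hx2]
  nlinarith [sq_nonneg (2 * v - x * u)]

theorem exists_coe_pow_eq (X : SL(2, ℝ)) (k : ℕ) : ∃ u v : ℝ,
    ((X ^ k : SL(2, ℝ)) : Matrix (Fin 2) (Fin 2) ℝ) = u • (X : Matrix (Fin 2) (Fin 2) ℝ) - v • 1 ∧
      u ^ 2 + v ^ 2 - tr X * u * v = 1 := by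
  have hsq : (X : Matrix (Fin 2) (Fin 2) ℝ) * (X : Matrix (Fin 2) (Fin 2) ℝ) =
      tr X • (X : Matrix (Fin 2) (Fin 2) ℝ) - 1 := by
    have := coe_mul_sq X 1
    simpa using this
  induction k with
  | zero => exact ⟨0, -1, by simp, by ring⟩
  | succ k ih =>
    obtain ⟨u, v, h1, h2⟩ := ih
    refine ⟨tr X * u - v, u, ?_, by linear_combination h2⟩
    rw [pow_succ, Matrix.SpecialLinearGroup.coe_mul, h1, sub_mul, Matrix.smul_mul, hsq,
      Matrix.smul_mul, one_mul]
    module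

/-- The powers of an elliptic element are bounded. -/
theorem exists_logNorm_pow_le (X : SL(2, ℝ)) (hx : |tr X| < 2) :
    ∃ R : ℝ, ∀ k : ℕ, logNorm (X ^ k) ≤ R := by
  refine ⟨Real.log (√(4 * 1 / (4 - tr X ^ 2)) * opNorm X + √(4 * 1 / (4 - tr X ^ 2))),
    fun k => Real.log_le_log (opNorm_pos _) ?_⟩
  obtain ⟨u, v, h1, h2⟩ := exists_coe_pow_eq X k
  have hu := sq_le_of_quadratic_le hx h2
  have hv := sq_le_of_quadratic_le hx
    (show v ^ 2 + u ^ 2 - tr X * v * u = 1 by linear_combination h2)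
  have h3 : opNorm (X ^ k) ≤ |u| * opNorm X + |v| := by
    unfold opNorm
    rw [h1, map_sub, map_smul, map_smul, map_one]
    refine (norm_sub_le _ _).trans ?_
    rw [norm_smul, norm_smul, norm_one, Real.norm_eq_abs, Real.norm_eq_abs, mul_one]
  refine h3.trans ?_
  have := opNorm_nonneg X
  gcongr

theorem exists_eigenvalues {x : ℝ} (hx : 2 < |x|) :
    ∃ t s : ℝ, t * s = 1 ∧ t + s = x ∧ 1 < |t| := by
  obtain ⟨t, ht, htx⟩ := exists_add_inv_eq hx
  have ht0 : t ≠ 0 := by linarith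
  rcases abs_cases x with ⟨hx', -⟩ | ⟨hx', -⟩
  · exact ⟨t, t⁻¹, mul_inv_cancel₀ ht0, by rw [htx, hx'], ht.trans_le (le_abs_self t)⟩
  · exact ⟨-t, -t⁻¹, by rw [neg_mul_neg, mul_inv_cancel₀ ht0], by linarith,
      by rw [abs_neg]; exact ht.trans_le (le_abs_self t)⟩

theorem tr_pow_eq (X : SL(2, ℝ)) {t s : ℝ} (hts : t * s = 1) (hx : t + s = tr X) (k : ℕ) :
    tr (X ^ k) = t ^ k + s ^ k ∧ tr (X ^ (k + 1)) = t ^ (k + 1) + s ^ (k + 1) := by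
  induction k with
  | zero => simp [tr_one, hx]; norm_num
  | succ k ih =>
    refine ⟨ih.2, ?_⟩
    rw [pow_succ X (k + 1), pow_succ X k, tr_mul_sq, ← pow_succ, ih.1, ih.2, ← hx]
    linear_combination (t ^ k + s ^ k) * hts

/-- The powers of a hyperbolic element grow exponentially. -/
theorem exists_le_logNorm_pow (X : SL(2, ℝ)) (hx : 2 < |tr X|) :
    ∃ r : ℝ, 0 < r ∧ ∀ k : ℕ, r * k - Real.log 2 ≤ logNorm (X ^ k) := by
  obtain ⟨t, s, hts, htx, ht⟩ := exists_eigenvalues hx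
  refine ⟨Real.log |t|, Real.log_pos ht, fun k => ?_⟩
  have h1 : |t| ^ k ≤ |tr (X ^ k)| := by
    rw [(tr_pow_eq X hts htx k).1, ← abs_pow]
    apply sq_le_sq.mp
    have : t ^ k * s ^ k = 1 := by rw [← mul_pow, hts, one_pow]
    nlinarith [sq_nonneg (s ^ k)]
  have h2 := h1.trans (abs_tr_le_two_mul_opNorm (X ^ k))
  have h3 := Real.log_le_log (by positivity) h2
  rw [Real.log_pow, Real.log_mul two_ne_zero (opNorm_pos _).ne'] at h3
  unfold logNorm
  linarith

/-! ### Transport along closed leaves -/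

theorem IsTransport.eq_pow {G : Type*} [Group G] {x l y : ℝ} {A B : G} {Φ : ℝ → G}
    (h : IsTransport x l y 0 A B Φ) (hg : AvoidsLattice x l y 0) (hl : 0 < l) {t : ℝ}
    (ht : 0 ≤ t) : ∃ k : ℕ, |k - t * l| ≤ 1 ∧ Φ t = A ^ k * Φ 0 := by
  have hS := h.induction hg hl.le le_rfl (by linarith)
    (fun i j g => ⌊y⌋ ≤ j ∧ (j = ⌊y⌋ → ∃ k : ℕ, (k : ℤ) = i - ⌊x⌋ ∧ g = A ^ k * Φ 0))
    ⟨le_rfl, fun _ => ⟨0, by simp⟩⟩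
    (fun i j g hS => ⟨hS.1, fun hj => by
      obtain ⟨k, hk, rfl⟩ := hS.2 hj
      exact ⟨k + 1, by push_cast; omega, by rw [pow_succ', mul_assoc]⟩⟩)
    (fun i j g hS => ⟨by omega, fun hj => by omega⟩) t ht
  obtain ⟨k, hk, hΦ⟩ := hS.2 (by simp)
  refine ⟨k, ?_, hΦ⟩
  have hk' : (k : ℝ) = (⌊x + t * l⌋ : ℝ) - ⌊x⌋ := by exact_mod_cast hk
  obtain ⟨h1, h2⟩ := floor_sub_floor_bounds x (t * l)
  rw [hk', abs_le]
  constructor <;> linarith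

theorem abs_logNorm_mul_mul_sub_le (h M g : SL(2, ℝ)) {R : ℝ} (h1 : logNorm h ≤ R)
    (h2 : logNorm h⁻¹ ≤ R) (g1 : logNorm g ≤ R) (g2 : logNorm g⁻¹ ≤ R) :
    |logNorm (h * (M * g)) - logNorm M| ≤ 2 * R := by
  have e1 := logNorm_mul_le h (M * g)
  have e2 := logNorm_mul_le M g
  have e3 := logNorm_mul_le h⁻¹ (h * (M * g) * g⁻¹)
  have e4 := logNorm_mul_le (h * (M * g)) g⁻¹
  rw [show h⁻¹ * (h * (M * g) * g⁻¹) = M by group] at e3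
  rw [abs_le]
  constructor <;> linarith

/-- The word met along a segment of a line of rational direction is, up to a bounded factor, a
power of `X`. -/
def IsAlmostPower (θ : Circle) (ρ : Rep) (X : SL(2, ℝ)) : Prop :=
  ∃ l : ℝ, 0 < l ∧ ∃ R : ℝ, ∀ p, IsGenericPoint θ p → ∀ t, 0 ≤ t → ∃ k : ℕ, |k - t * l| ≤ 1 ∧
    |logNorm (ρ.eval (crossingWord θ p t)) - logNorm (X ^ k)| ≤ R

theorem isAlmostPower_of_transport {θ : Circle} {ρ : Rep} {X : SL(2, ℝ)} {l R : ℝ} (hl : 0 < l)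
    (h : ∀ p, IsGenericPoint θ p → ∃ (x y : ℝ) (B : SL(2, ℝ)) (Φ h : ℝ → SL(2, ℝ)),
      AvoidsLattice x l y 0 ∧ IsTransport x l y 0 X B Φ ∧
      ∀ t, ρ.eval (crossingWord θ p t) = h t * Φ t ∧ logNorm (h t) ≤ R ∧
        logNorm (h t)⁻¹ ≤ R) : IsAlmostPower θ ρ X := by
  refine ⟨l, hl, 2 * R, fun p hp t ht => ?_⟩
  obtain ⟨x, y, B, Φ, h, hg, htr, hΦ⟩ := h p hp
  obtain ⟨k, hk, hk'⟩ := htr.eq_pow hg hl ht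
  refine ⟨k, hk, ?_⟩
  have h0 : h 0 * Φ 0 = 1 := by
    rw [← (hΦ 0).1, crossingWord_zero]
    exact map_one (show Pi1 →* SL(2, ℝ) from ρ)
  have h1 : Φ 0 = (h 0)⁻¹ := (inv_eq_of_mul_eq_one_right h0).symm
  obtain ⟨h2, h3, h4⟩ := hΦ t
  rw [h2, hk']
  exact abs_logNorm_mul_mul_sub_le _ _ _ h3 h4 (by rw [h1]; exact (hΦ 0).2.2)
    (by rw [h1, inv_inv]; exact (hΦ 0).2.1)

theorem isAlmostPower_pairA {θ : Circle} (ρ : Rep) {n : ℕ} (h : (rauzyLengths θ n).2 = 0) :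
    IsAlmostPower θ ρ (pairA θ ρ n) := by
  obtain ⟨R, hR⟩ := exists_transport θ ρ n
  obtain ⟨-, -, hpos⟩ := rauzyLengths_nonneg_pos θ n
  rw [h] at hR hpos
  refine isAlmostPower_of_transport (R := R) (by linarith) fun p hp => ?_
  obtain ⟨x, y, Φ, h, hg, htr, hΦ⟩ := hR p hp
  exact ⟨x, y, _, Φ, h, hg, htr, hΦ⟩

theorem isAlmostPower_pairB {θ : Circle} (ρ : Rep) {n : ℕ} (h : (rauzyLengths θ n).1 = 0) :
    IsAlmostPower θ ρ (pairB θ ρ n) := by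
  obtain ⟨R, hR⟩ := exists_transport θ ρ n
  obtain ⟨-, -, hpos⟩ := rauzyLengths_nonneg_pos θ n
  rw [h] at hR hpos
  refine isAlmostPower_of_transport (R := R) (by linarith) fun p hp => ?_
  obtain ⟨x, y, Φ, h, hg, htr, hΦ⟩ := hR p hp
  exact ⟨y, x, _, Φ, h, hg.swap, htr.swap, hΦ⟩

theorem IsAlmostPower.mem_spectrum {θ : Circle} {ρ : Rep} {X : SL(2, ℝ)}
    (h : IsAlmostPower θ ρ X) (hx : |tr X| < 2) : θ ∈ spectrum ρ := by
  obtain ⟨l, hl, R, hR⟩ := h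
  obtain ⟨R', hR'⟩ := exists_logNorm_pow_le X hx
  refine mem_spectrum_of_forall_le fun ε hε => ⟨R + R', fun p hp t ht => ?_⟩
  obtain ⟨k, -, hk⟩ := hR p hp t ht
  have := (abs_le.mp hk).2
  have := hR' k
  have : 0 ≤ ε * t := by positivity
  linarith

theorem IsAlmostPower.not_mem_spectrum {θ : Circle} {ρ : Rep} {X : SL(2, ℝ)}
    (h : IsAlmostPower θ ρ X) (hx : 2 < |tr X|) : θ ∉ spectrum ρ := by
  obtain ⟨l, hl, R, hR⟩ := h
  obtain ⟨r, hr, hpow⟩ := exists_le_logNorm_pow X hx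
  refine not_mem_spectrum_of_le (ε := r * l) (C := r + Real.log 2 + R) (by positivity)
    fun p hp t ht => ?_
  obtain ⟨k, hk, hk'⟩ := hR p hp t ht
  have h1 := (abs_le.mp hk').1
  have h2 := mul_le_mul_of_nonneg_left (abs_le.mp hk).1 hr.le
  have h3 := hpow k
  linarith

/-! ### The dichotomy for rational directions -/

namespace TwistOrbit

variable {κ : ℝ} {T : ℕ → Prop} {x y z : ℕ → ℝ} {n₁ : ℕ}

theorem eq_of_eventually (h : TwistOrbit κ T x y z) (hT : ∀ n ≥ n₁, T n) :
    ∀ n ≥ n₁, x n = x n₁ := by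
  intro n hn
  induction n, hn using Nat.le_induction with
  | base => rfl
  | succ n hn ih => rw [(h.stepA n (hT n hn)).1, ih]

theorem bounded_of_eventually (h : TwistOrbit κ T x y z) (hT : ∀ n ≥ n₁, T n)
    (hx : |x n₁| < 2) : ∃ R, ∀ n ≥ n₁, |x n| ≤ R ∧ |y n| ≤ R ∧ |z n| ≤ R := by
  refine ⟨max 2 (√(4 * (κ + 4 - x n₁ ^ 2) / (4 - x n₁ ^ 2))), fun n hn => ?_⟩
  have hxn := h.eq_of_eventually hT n hn
  have hf := h.fricke n
  rw [hxn] at hf ⊢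
  refine ⟨hx.le.trans (le_max_left _ _), ?_, ?_⟩
  · exact (sq_le_of_quadratic_le (v := z n) hx (by linarith)).trans (le_max_right _ _)
  · exact (sq_le_of_quadratic_le (v := y n) hx (by linarith)).trans (le_max_right _ _)

theorem tendsto_of_eventually (h : TwistOrbit κ T x y z) (hT : ∀ n ≥ n₁, T n) {t s : ℝ}
    (hts : t * s = 1) (hx : t + s = x n₁) (ht : 1 < |t|) (hne : z n₁ ≠ s * y n₁) :
    Tendsto (fun n => |x n| + |y n| + |z n|) atTop atTop := by
  have hs : |s| ≤ 1 := by
    have h1 : |t| * |s| = 1 := by rw [← abs_mul, hts, abs_one]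
    nlinarith [abs_nonneg s]
  have hgeo : ∀ j, z (n₁ + j) - s * y (n₁ + j) = t ^ j * (z n₁ - s * y n₁) := by
    intro j
    induction j with
    | zero => simp
    | succ j ih =>
      obtain ⟨-, h2, h3⟩ := h.stepA (n₁ + j) (hT _ (by omega))
      rw [← add_assoc, h2, h3, h.eq_of_eventually hT _ (by omega), ← hx, pow_succ,
        mul_comm _ t, mul_assoc, ← ih]
      linear_combination y (n₁ + j) * hts
  rw [← tendsto_add_atTop_iff_nat n₁]
  refine tendsto_atTop_mono (fun j => ?_) ((tendsto_pow_atTop_atTop_of_one_lt ht).atTop_mul_const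
    (abs_pos.mpr (sub_ne_zero.mpr hne)))
  rw [← abs_pow, ← abs_mul, ← hgeo, add_comm n₁ j]
  have h1 := abs_sub (z (j + n₁)) (s * y (j + n₁))
  rw [abs_mul] at h1
  have h2 := mul_le_mul_of_nonneg_right hs (abs_nonneg (y (j + n₁)))
  have h3 := abs_nonneg (x (j + n₁))
  linarith

end TwistOrbit

theorem eq_one_or_eq_neg_one_of_isGeneric {ρ : Rep} (hρ : ρ.IsGeneric) (g : Pi1)
    (h : |tr (ρ.eval g)| = 2) : ρ.eval g = 1 ∨ ρ.eval g = -1 := by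
  by_contra! hne
  exact (hρ g).1 ⟨h, hne.1, hne.2⟩

theorem tr_eval_ne_zero_of_isGeneric {ρ : Rep} (hρ : ρ.IsGeneric) (g : Pi1) :
    tr (ρ.eval g) ≠ 0 := fun h =>
  (hρ g).2 ⟨by change |tr (ρ.eval g)| < 2; rw [h, abs_zero]; norm_num,
    isOfFinOrder_of_tr_eq_zero _ h⟩

theorem tr_commutator_of_abs_tr_eq_two {ρ : Rep} (hρ : ρ.IsGeneric) (g h : Pi1)
    (hg : |tr (ρ.eval g)| = 2) :
    tr (ρ.eval g * ρ.eval h * (ρ.eval g)⁻¹ * (ρ.eval h)⁻¹) = 2 := by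
  have key : ρ.eval g * ρ.eval h * (ρ.eval g)⁻¹ * (ρ.eval h)⁻¹ = 1 := by
    rcases eq_one_or_eq_neg_one_of_isGeneric hρ g hg with e | e <;> rw [e]
    · simp
    · simp [inv_neg]
  rw [key, tr_one]

/-- For a generic representation, no trace decreases under the iteration of a hyperbolic twist. -/
theorem tr_mul_ne_of_isGeneric {ρ : Rep} (hρ : ρ.IsGeneric) (g h : Pi1) {t s : ℝ}
    (hts : t * s = 1) (hx : t + s = tr (ρ.eval g)) (ht : 1 < |t|) :
    tr (ρ.eval h * ρ.eval g) ≠ s * tr (ρ.eval h) := by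
  intro hz
  set X := ρ.eval g with hX
  set Y := ρ.eval h with hY
  have hc := tr_commutator X Y
  have h1 := tr_mul_inv (Y * X * Y⁻¹) X
  rw [tr_conj, show X * (Y * X * Y⁻¹)⁻¹ = X * Y * X⁻¹ * Y⁻¹ by group] at h1
  have h2 : tr (X * (Y * X * Y⁻¹)) = 2 := by
    rw [hc, hz, ← hx] at h1
    linear_combination h1 + tr Y ^ 2 * hts
  have h3 : X * (Y * X * Y⁻¹) = 1 := by
    have e : X * (Y * X * Y⁻¹) = ρ.eval (g * (h * g * h⁻¹)) := by
      rw [Rep.eval_mul, Rep.eval_mul, Rep.eval_mul, Rep.eval_inv]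
    rw [e] at h2 ⊢
    rcases eq_one_or_eq_neg_one_of_isGeneric hρ _ (by rw [h2, abs_two]) with e1 | e1
    · exact e1
    · rw [e1, tr_neg, tr_one] at h2; norm_num at h2
  have h4 : Y * X = X⁻¹ * Y := by
    have := inv_eq_of_mul_eq_one_right h3
    rw [this]; group
  have h5 : tr (Y * X) = tr X * tr Y - tr (Y * X) := by
    rw [← tr_mul_inv, tr_mul_comm Y X⁻¹, ← h4]
  have h6 : (t - s) * tr Y = 0 := by
    rw [hz, ← hx] at h5
    linarith
  rcases mul_eq_zero.mp h6 with h7 | h7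
  · have : t = s := by linarith
    rw [← this] at hts
    have h8 : |t| * |t| = 1 := by rw [← abs_mul, hts, abs_one]
    nlinarith
  · exact tr_eval_ne_zero_of_isGeneric hρ h h7

theorem dichotomy_of_eventually {θ : Circle} {ρ : Rep} (hρ : ρ.IsGeneric) {c : ℝ} (hc : c ≠ 2)
    {T : ℕ → Prop} {x y z : ℕ → ℝ} (ho : TwistOrbit (c - 2) T x y z) {n₁ : ℕ}
    (hT : ∀ n ≥ n₁, T n) (g h : Pi1) (hx : x n₁ = tr (ρ.eval g)) (hy : y n₁ = tr (ρ.eval h))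
    (hz : z n₁ = tr (ρ.eval h * ρ.eval g)) (hpow : IsAlmostPower θ ρ (ρ.eval g)) :
    (θ ∈ spectrum ρ ∧ ∃ R, ∀ n ≥ n₁, |x n| ≤ R ∧ |y n| ≤ R ∧ |z n| ≤ R) ∨
      (θ ∉ spectrum ρ ∧ Tendsto (fun n => |x n| + |y n| + |z n|) atTop atTop) := by
  rcases lt_trichotomy |tr (ρ.eval g)| 2 with hlt | heq | hgt
  · exact Or.inl ⟨hpow.mem_spectrum hlt, ho.bounded_of_eventually hT (by rwa [hx])⟩
  · refine absurd ?_ hc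
    have h1 := tr_commutator_of_abs_tr_eq_two hρ g h heq
    rw [tr_commutator, ← hx, ← hy, ← hz] at h1
    linarith [ho.fricke n₁]
  · obtain ⟨t, s, hts, htx, ht⟩ := exists_eigenvalues hgt
    refine Or.inr ⟨hpow.not_mem_spectrum hgt,
      ho.tendsto_of_eventually hT hts (by rw [hx, htx]) ht ?_⟩
    rw [hz, hy]
    exact tr_mul_ne_of_isGeneric hρ g h hts htx ht

theorem dichotomy_of_rational {θ : Circle} (hθ : ¬ Irrational (rotationAngle θ)) {ρ : Rep}
    (hρ : ρ.IsGeneric) {c : ℝ} (hc : c ≠ 2) (hmem : ρ.cls ∈ relCharVar c) :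
    (θ ∈ spectrum ρ ∧ ∃ n₁ R, ∀ n ≥ n₁, |trA θ ρ n| ≤ R ∧ |trB θ ρ n| ≤ R ∧ |trBA θ ρ n| ≤ R) ∨
      (θ ∉ spectrum ρ ∧
        Tendsto (fun n => |trA θ ρ n| + |trB θ ρ n| + |trBA θ ρ n|) atTop atTop) := by
  obtain ⟨n₁, h1 | h1⟩ := exists_rauzyLengths_eq_zero hθ
  · have hd := dichotomy_of_eventually hρ hc (twistOrbit_tr θ hmem).swap
      (not_isTwistA_of_fst_eq_zero h1) _ _ rfl rfl (tr_mul_comm _ _) (isAlmostPower_pairB ρ h1)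
    rcases hd with ⟨hs, R, hR⟩ | ⟨hs, ht⟩
    · exact Or.inl ⟨hs, n₁, R, fun n hn => ⟨(hR n hn).2.1, (hR n hn).1, (hR n hn).2.2⟩⟩
    · refine Or.inr ⟨hs, ht.congr fun n => ?_⟩
      rw [add_comm |trB θ ρ n|]
  · rcases dichotomy_of_eventually hρ hc (twistOrbit_tr θ hmem) (isTwistA_of_snd_eq_zero h1) _ _
      rfl rfl rfl (isAlmostPower_pairA ρ h1) with ⟨hs, R, hR⟩ | h
    · exact Or.inl ⟨hs, n₁, R, hR⟩
    · exact Or.inr h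

theorem exists_isCompact_of_tr_le {c : ℝ} (hc : c ≠ 2) (R : ℝ) :
    ∃ K : Set CharVar, IsCompact K ∧ ∀ ρ : Rep, ρ.cls ∈ relCharVar c → ∀ θ n,
      |trA θ ρ n| ≤ R → |trB θ ρ n| ≤ R → |trBA θ ρ n| ≤ R →
        (act (trajectory θ n) ρ).cls ∈ K := by
  obtain ⟨K, hK, hmem⟩ := exists_isCompact_of_traceCoords_le hc (R + R ^ 2)
  exact ⟨K, hK, fun ρ hρ θ n hA hB hBA => hmem _ (trace_commutator_act_eq θ hρ n)
    (abs_traceCoords_act_le θ ρ n hA hB hBA)⟩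

/-- The dichotomy for irrational directions: either the orbit enters the escape region or `c < 2`,
and the traces grow, or it never does, and the coefficients of the recursion are bounded. -/
theorem dichotomy_of_irrational {θ : Circle} (hθ : Irrational (rotationAngle θ)) {ρ : Rep}
    {c : ℝ} (hc : c ≠ 2) (hmem : ρ.cls ∈ relCharVar c) :
    (θ ∈ spectrum ρ ∧ 0 < c - 2 ∧ ∀ n, ¬ Escaping (trA θ ρ n) (trB θ ρ n) (trBA θ ρ n)) ∨
      (θ ∉ spectrum ρ ∧ ∃ s : ℝ, 0 < s ∧ ∃ n₁, ∀ n ≥ n₁,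
        Real.exp (s * (wordLength θ n).1) ≤ trA θ ρ n ^ 2 ∧
        Real.exp (s * (wordLength θ n).2) ≤ trB θ ρ n ^ 2) := by
  have hT := exists_change hθ
  by_cases hesc : ∃ n, Escaping (trA θ ρ n) (trB θ ρ n) (trBA θ ρ n) ∨ c < 2
  · obtain ⟨n, hn⟩ := hesc
    have htr := tr_commutator_pair θ hmem n
    obtain ⟨P, η, hP, hη, hA, hB, hBA⟩ := exists_grows (pairA θ ρ n) (pairB θ ρ n)
      (by rwa [htr]) (by rwa [htr])
    exact Or.inr (exists_exp_le_tr_sq hT hP hη hA hB hBA)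
  · push Not at hesc
    have hE : ∀ n, ¬ Escaping (trA θ ρ n) (trB θ ρ n) (trBA θ ρ n) := fun n => (hesc n).1
    have hκ : 0 < c - 2 := sub_pos.mpr (lt_of_le_of_ne (hesc 0).2 hc.symm)
    obtain ⟨n₁, hn₁⟩ := (twistOrbit_tr θ hmem).eventually_abs_coeff_le hκ hE hT
    exact Or.inl ⟨mem_spectrum_of_coeff_le hT (by positivity) hn₁, hκ, hE⟩

end PuncturedTorus

theorem mainTheorem4 (c : ℝ) (hc : c ≠ 2) :
    ∃ K : Set PuncturedTorus.CharVar, IsCompact K ∧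
      ∀ ρ : PuncturedTorus.Rep, ρ.cls ∈ PuncturedTorus.relCharVar c → ρ.IsGeneric →
      ∀ θ : Circle,
        (θ ∉ PuncturedTorus.spectrum ρ →
          Tendsto (fun n : ℕ => (PuncturedTorus.act (PuncturedTorus.trajectory θ n) ρ).cls)
            atTop (cocompact PuncturedTorus.CharVar) ∧
          (Irrational (PuncturedTorus.rotationAngle θ) →
            ∀ N : Seminorm ℝ (Fin 3 → ℝ), (∀ w, N w = 0 → w = 0) →
              (∃ C : ℝ, 0 < C ∧ ∀ᶠ n : ℕ in atTop,
                Real.exp (C * n) ≤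
                  N (PuncturedTorus.act (PuncturedTorus.trajectory θ n) ρ).traceCoords) ∧
              (∃ C : ℝ, 0 < C ∧ ∀ᶠ n : ℕ in atTop,
                Real.exp (C * PuncturedTorus.cfDenom (PuncturedTorus.rotationAngle θ) n) ≤
                  N (PuncturedTorus.act (PuncturedTorus.trajectory θ
                    (PuncturedTorus.accelTime (PuncturedTorus.rotationAngle θ) n))
                    ρ).traceCoords))) ∧
        (θ ∈ PuncturedTorus.spectrum ρ →
          ¬ Tendsto (fun n : ℕ => (PuncturedTorus.act (PuncturedTorus.trajectory θ n) ρ).cls)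
            atTop (cocompact PuncturedTorus.CharVar) ∧
          (Irrational (PuncturedTorus.rotationAngle θ) →
            (∀ᶠ n : ℕ in atTop,
              (PuncturedTorus.act (PuncturedTorus.trajectory θ
                (PuncturedTorus.accelTime (PuncturedTorus.rotationAngle θ) n)) ρ).cls ∈ K) ∧
            ((∃ M : ℕ, ∀ n, PuncturedTorus.cfDigit (PuncturedTorus.rotationAngle θ) n ≤ M) →
              ∃ K' : Set PuncturedTorus.CharVar, IsCompact K' ∧
                ∀ n, (PuncturedTorus.act (PuncturedTorus.trajectory θ n) ρ).cls ∈ K'))) := by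
  obtain ⟨K, hK, hKmem⟩ := PuncturedTorus.exists_isCompact_of_tr_le hc (PuncturedTorus.nextBound (c - 2)
    (PuncturedTorus.nextBound (c - 2) (2 + √(4 + (c - 2)))))
  refine ⟨K, hK, fun ρ hρ hgen θ => ?_⟩
  by_cases hθ : Irrational (PuncturedTorus.rotationAngle θ)
  · have ho := PuncturedTorus.twistOrbit_tr θ hρ
    rcases PuncturedTorus.dichotomy_of_irrational hθ hc hρ with ⟨hs, hκ, hE⟩ | ⟨hs, s, hs0, n₁, hn₁⟩
    · refine ⟨fun h => absurd hs h, fun _ => ?_⟩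
      have hev : ∀ᶠ n : ℕ in atTop, (PuncturedTorus.act (PuncturedTorus.trajectory θ
          (PuncturedTorus.accelTime (PuncturedTorus.rotationAngle θ) n)) ρ).cls ∈ K := by
        obtain ⟨m₀, hm₀⟩ := PuncturedTorus.eventually_accelTime_bounded hθ hκ ho hE
        filter_upwards [eventually_ge_atTop m₀] with m hm
        obtain ⟨h1, h2⟩ := hm₀ m hm
        have hR₀ : 2 ≤ 2 + √(4 + (c - 2)) := le_add_of_nonneg_right (Real.sqrt_nonneg _)
        have hR := hR₀.trans (PuncturedTorus.le_nextBound (κ := c - 2) hR₀)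
        have hle := PuncturedTorus.le_nextBound (κ := c - 2) hR
        exact hKmem ρ hρ θ _ (h1.trans hle) (h2.trans hle) (ho.abs_z_le hR _ h1 h2)
      refine ⟨?_, fun _ => ⟨hev, ?_⟩⟩
      · exact PuncturedTorus.not_tendsto_cocompact_of_mem hK
          ((PuncturedTorus.tendsto_accelTime hθ).frequently hev.frequently)
      · rintro ⟨M, hM⟩
        obtain ⟨R, hR⟩ := PuncturedTorus.exists_abs_le_of_cfDigit_le hθ hκ ho hE hM
        have h2 : (2 : ℝ) ≤ max R 2 := le_max_right _ _
        have hle := PuncturedTorus.le_nextBound (κ := c - 2) h2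
        obtain ⟨K', hK', hmem⟩ := PuncturedTorus.exists_isCompact_of_tr_le hc
          (PuncturedTorus.nextBound (c - 2) (max R 2))
        refine ⟨K', hK', fun n => ?_⟩
        have hA := (hR n).1.trans (le_max_left R 2)
        have hB := (hR n).2.trans (le_max_left R 2)
        exact hmem ρ hρ θ n (hA.trans hle) (hB.trans hle) (ho.abs_z_le h2 n hA hB)
    · obtain ⟨h1, h2⟩ := PuncturedTorus.growth_of_irrational hθ hs0 hn₁
      exact ⟨fun _ => ⟨h1, fun _ => h2⟩, fun h => absurd h hs⟩
  · rcases PuncturedTorus.dichotomy_of_rational hθ hgen hc hρ with ⟨hs, n₁, R, hR⟩ | ⟨hs, ht⟩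
    · refine ⟨fun h => absurd hs h, fun _ => ⟨?_, fun h => absurd h hθ⟩⟩
      obtain ⟨K', hK', hmem⟩ := PuncturedTorus.exists_isCompact_of_tr_le hc R
      refine PuncturedTorus.not_tendsto_cocompact_of_mem hK' (Eventually.frequently ?_)
      filter_upwards [eventually_ge_atTop n₁] with n hn
      exact hmem ρ hρ θ n (hR n hn).1 (hR n hn).2.1 (hR n hn).2.2
    · exact ⟨fun _ => ⟨PuncturedTorus.tendsto_cocompact_of_tr ht, fun h => absurd h hθ⟩,
        fun h => absurd h hs⟩
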